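/- Let $\gamma_d(dx)=\pi^{-d/2}e^{-\|x\|^2}dx$ be the Gaussian measure on $\mathbb{R}^d$; functions are real-valued. For a multi-index $\nu$ let $$h_\nu(x)=\frac{1}{(2^{|\nu|}\nu!)^{1/2}}\prod_{i=1}^d(-1)^{\nu_i}e^{x_i^2}\partial_i^{\nu_i}(e^{-x_i^2})$$ be the normalized Hermite polynomials, which are eigenfunctions of $L=\frac12\Delta-\langle x,\nabla\rangle$ with $Lh_\nu=-|\nu|h_\nu$. Let $$T_tf(x)=\int_{\mathbb{R}^d}f\big(\sqrt{1-e^{-2t}}\,u+e^{-t}x\big)\,\gamma_d(du),\qquad P_tf(x)=\frac{1}{\sqrt{\pi}}\int_0^\infty\frac{e^{-u}}{\sqrt u}\,T_{t^2/4u}f(x)\,du$$ be the Ornstein--Uhlenbeck and the Poisson--Hermite semigroups. For $\alpha\ge 0$, $1<p<\infty$ and $1\le q<\infty$, let $k$ be the smallest integer greater than $\alpha$. The Gaussian Triebel--Lizorkin space $F^\alpha_{p,q}(\gamma_d)$ is the set of $f\in L^p(\gamma_d)$ for which $$\|f\|_{F^\alpha_{p,q}}:=\|f\|_{L^p(\gamma_d)}+\left\|\left(\int_0^\infty\Big(t^{k-\alpha}\Big|\frac{\partial^kP_tf}{\partial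 t^k}\Big|\Big)^q\frac{dt}{t}\right)^{1/q}\right\|_{L^p(\gamma_d)}<\infty .$$ For $\beta>0$, the Riesz potential $I_\beta=(-L)^{-\beta/2}\Pi_0$, where $\Pi_0f=f-\int f\,d\gamma_d$, is given on Hermite polynomials by $I_\beta h_\nu=|\nu|^{-\beta/2}h_\nu$ for $\nu\neq0$ and $I_\beta h_0=0$, and on $L^p(\gamma_d)$ by continuous linear extension. Theorem. Let $\alpha\ge0$, $\beta>0$, $1<p<\infty$ and $1\le q<\infty$. Then there is exactly one bounded linear operator $I_\beta$ on $L^p(\gamma_d)$ with the above values on the Hermite polynomials, and it is bounded from $F^\alpha_{p,q}(\gamma_d)$ into $F^{\alpha+\beta}_{p,q}(\gamma_d)$: there is a constant $C$, depending only on $d,p,q,\alpha,\beta$, such that for every $f\in F^\alpha_{p,q}(\gamma_d)$ we have $I_\beta f\in F^{\alpha+\beta}_{p,q}(\gamma_d)$ and $$\|I_\beta f\|_{F^{\alpha+\beta}_{p,q}}\le C\,\|f\|_{F^\alpha_{p,q}} .$$ -/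

import Mathlib

open MeasureTheory Set
open scoped ENNReal NNReal

noncomputable section

namespace GaussianTL

/-- Euclidean space `ℝ^d` with its Euclidean norm. -/
abbrev E (d : ℕ) : Type := EuclideanSpace ℝ (Fin d)

/-- The Gaussian measure `γ_d(dx) = π^{-d/2} e^{-‖x‖²} dx`. -/
def gaussian (d : ℕ) : Measure (E d) :=
  volume.withDensity fun x =>
    ENNReal.ofReal (Real.exp (-‖x‖ ^ 2) / Real.pi ^ ((d : ℝ) / 2))

/-- The normalized Hermite polynomial
`h_ν(x) = (2^{|ν|} ν!)^{-1/2} ∏ᵢ (-1)^{νᵢ} e^{xᵢ²} ∂ᵢ^{νᵢ} e^{-xᵢ²}`. -/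
def hermite {d : ℕ} (ν : Fin d → ℕ) (x : E d) : ℝ :=
  (1 / Real.sqrt (2 ^ (∑ i, ν i) * ∏ i, ((ν i).factorial : ℝ))) *
    ∏ i, ((-1) ^ (ν i) * Real.exp ((x i) ^ 2) *
      iteratedDeriv (ν i) (fun s : ℝ => Real.exp (-s ^ 2)) (x i))

/-- The Ornstein–Uhlenbeck semigroup
`T_t f(x) = ∫ f(√(1 - e^{-2t}) u + e^{-t} x) γ_d(du)`. -/
def ornsteinUhlenbeck {d : ℕ} (t : ℝ) (f : E d → ℝ) (x : E d) : ℝ :=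
  ∫ u, f (Real.sqrt (1 - Real.exp (-2 * t)) • u + Real.exp (-t) • x) ∂(gaussian d)

/-- The Poisson–Hermite semigroup
`P_t f(x) = π^{-1/2} ∫_0^∞ e^{-u} u^{-1/2} T_{t²/(4u)} f(x) du`. -/
def poissonHermite {d : ℕ} (t : ℝ) (f : E d → ℝ) (x : E d) : ℝ :=
  (1 / Real.sqrt Real.pi) *
    ∫ u in Ioi (0 : ℝ),
      Real.exp (-u) / Real.sqrt u * ornsteinUhlenbeck (t ^ 2 / (4 * u)) f x

/-- The smallest integer greater than `α`, for `α ≥ 0`. -/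
def order (α : ℝ) : ℕ := ⌊α⌋₊ + 1

/-- The function `x ↦ (∫_0^∞ (t^{k-α} |∂_t^k P_t f(x)|)^q dt/t)^{1/q}`, where `k` is the smallest
integer greater than `α`, with values in `[0, ∞]`. -/
def squareFunction {d : ℕ} (α q : ℝ) (f : E d → ℝ) (x : E d) : ℝ≥0∞ :=
  (∫⁻ t in Ioi (0 : ℝ),
    ENNReal.ofReal
      ((t ^ ((order α : ℝ) - α) *
        |iteratedDeriv (order α) (fun s : ℝ => poissonHermite s f x) t|) ^ q / t)) ^ (1 / q)

/-- The Gaussian Triebel–Lizorkin space `F^α_{p,q}(γ_d)`, as a set of elements of `L^p(γ_d)`. -/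
def TriebelLizorkin (d : ℕ) (p : ℝ≥0∞) (α q : ℝ) : Set (Lp ℝ p (gaussian d)) :=
  {f | eLpNorm (squareFunction α q (f : E d → ℝ)) p (gaussian d) < ∞}

/-- The norm `‖f‖_{F^α_{p,q}}`, as an extended nonnegative number; it is finite exactly on
`F^α_{p,q}(γ_d)`. -/
def triebelLizorkinNorm {d : ℕ} {p : ℝ≥0∞} (α q : ℝ) (f : Lp ℝ p (gaussian d)) : ℝ≥0∞ :=
  eLpNorm (f : E d → ℝ) p (gaussian d) +
    eLpNorm (squareFunction α q (f : E d → ℝ)) p (gaussian d)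

/-- A bounded operator `T` on `L^p(γ_d)` is the Riesz potential `I_β = (-L)^{-β/2} Π₀` if every
Hermite polynomial `h_ν` is (a representative of) an element of `L^p(γ_d)`, `T h_ν = |ν|^{-β/2} h_ν`
for `ν ≠ 0`, and `T h_0 = 0`. -/
def IsRieszPotential {d : ℕ} {p : ℝ≥0∞} [Fact (1 ≤ p)] (β : ℝ)
    (T : Lp ℝ p (gaussian d) →L[ℝ] Lp ℝ p (gaussian d)) : Prop :=
  ∀ ν : Fin d → ℕ, ∃ h : Lp ℝ p (gaussian d),
    (h : E d → ℝ) =ᵐ[gaussian d] hermite ν ∧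
      T h = (if ν = 0 then (0 : ℝ) else ((∑ i, ν i : ℕ) : ℝ) ^ (-(β / 2))) • h

end GaussianTL

end

/-!
Boundedness of the Riesz potential on Gaussian Triebel–Lizorkin spaces.

*The operator.* The operators used here act on Hermite polynomials through a symbol which depends
only on the degree (`HasSymbol`); most of them are averages `∫ w(s) T_s ds` of the
Ornstein–Uhlenbeck semigroup, with the Laplace transform of `w` as symbol. Since the Hermite
polynomials span a dense subspace of `L^p(γ_d)` (`eq_top_of_hermite_mem`), an operator is determined
by its symbol (`HasSymbol.unique`); this gives uniqueness of `I_β` and is the source of all operator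
identities below. For existence, Mehler's kernel shows that `S = T_s - ∫ · dγ` is a strict
contraction of `L^p(γ_d)` for large `s` (`exists_contraction`), and `Γ(b) n^{-b}`, `b = β/2`, is
written as the series `∑_j e^{-jsn} ∫_0^s (y + js)^{b-1} e^{-ny} dy`, in which `e^{-jsn}` is the
symbol of `S^j` for `n ≠ 0` (`exists_riesz`).

*The square function.* Subordination writes `∂_t^k P_t f` as an average of `T_s f` against an
explicit kernel with Laplace transform `∂_t^k e^{-t√λ}` (`laplace_poissonKernel`), for almost every
point and all `t` at once (`iteratedDeriv_poissonHermite`). Comparing symbols gives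
`∂_t^K P_t I_β f = Γ(β)⁻¹ ∫_0^∞ s^{β-1} ∂_t^K P_{t+s} f ds` (`poissonDeriv_riesz`), so with `K` the
order belonging to `α + β`, Hardy's inequality for `dt/t` (`lintegral_hardy_le`) bounds the square
function of `I_β f` pointwise by the `L^q(dt/t)` norm of `t^{K-α} ∂_t^K P_t f`. It remains to lower
the order of differentiation from `K` to the order `k` belonging to `α`. By the semigroup property
`∂_t^K P_{2t} f` is, up to the factor `t^{k-K}`, bounded by the positive smoothing operator
`smoothL t` applied to `|∂_t^k P_t f|`, and these operators satisfy the vector-valued inequality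
`‖(∫ (smoothL t F_t)^q dt/t)^{1/q}‖_p ≤ C ‖(∫ F_t^q dt/t)^{1/q}‖_p` (`gnorm_smoothL_le`).

*The vector-valued inequality.* The kernel of `smoothL t` is a decreasing function of the
Ornstein–Uhlenbeck time, so `smoothL t` is dominated by the ergodic maximal function, which is
bounded on `L^p(γ_d)`, `p > 1`, by the Hopf–Garsia maximal ergodic theorem. For `q = 1` the
inequality follows by duality from this maximal theorem, as the operators are symmetric; for general
`q` one factors `F_t = A_t^{1/q} H^{1-1/q}` with `H` comparable to the `L^q(dt/t)` norm of `F`.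
-/

noncomputable section

namespace GaussianTL

variable {d : ℕ}

/-! ### The Gaussian measure -/

lemma measurable_gaussianDensity :
    Measurable fun x : E d => ENNReal.ofReal (Real.exp (-‖x‖ ^ 2) / Real.pi ^ ((d : ℝ) / 2)) := by
  fun_prop

lemma integral_exp_neg_mul_sq_norm {b : ℝ} (hb : 0 < b) :
    ∫ x : E d, Real.exp (-b * ‖x‖ ^ 2) = (Real.pi / b) ^ ((d : ℝ) / 2) := by
  simpa using GaussianFourier.integral_rexp_neg_mul_sq_norm (V := E d) hb

lemma integrable_exp_neg_mul_sq_norm {b : ℝ} (hb : 0 < b) :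
    Integrable fun x : E d => Real.exp (-b * ‖x‖ ^ 2) := by
  refine Integrable.of_integral_ne_zero ?_
  rw [integral_exp_neg_mul_sq_norm hb]
  positivity

lemma integral_gaussian {F : Type*} [NormedAddCommGroup F] [NormedSpace ℝ F] (f : E d → F) :
    ∫ x, f x ∂(gaussian d) =
      ∫ x, (Real.exp (-‖x‖ ^ 2) / Real.pi ^ ((d : ℝ) / 2)) • f x := by
  rw [gaussian, integral_withDensity_eq_integral_toReal_smul measurable_gaussianDensity
    (by simp)]
  congr with x
  rw [ENNReal.toReal_ofReal (by positivity)]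

lemma integrable_gaussian_iff {F : Type*} [NormedAddCommGroup F] [NormedSpace ℝ F] {f : E d → F} :
    Integrable f (gaussian d) ↔
      Integrable fun x => (Real.exp (-‖x‖ ^ 2) / Real.pi ^ ((d : ℝ) / 2)) • f x := by
  rw [gaussian, integrable_withDensity_iff_integrable_smul' measurable_gaussianDensity
    (by simp)]
  refine integrable_congr (ae_of_all _ fun x => ?_)
  simp only
  rw [ENNReal.toReal_ofReal (by positivity)]

instance : IsProbabilityMeasure (gaussian d) := by
  constructor
  rw [gaussian, withDensity_apply _ MeasurableSet.univ, Measure.restrict_univ,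
    ← ofReal_integral_eq_lintegral_ofReal]
  · have h := integral_exp_neg_mul_sq_norm (d := d) one_pos
    simp only [neg_mul, one_mul, div_one] at h
    rw [integral_div, h, div_self (by positivity), ENNReal.ofReal_one]
  · have h := integrable_exp_neg_mul_sq_norm (d := d) one_pos
    simp only [neg_mul, one_mul] at h
    exact h.div_const _
  · exact ae_of_all _ fun x => by positivity

lemma integrable_exp_mul_sq_norm {b : ℝ} (hb : b < 1) :
    Integrable (fun x : E d => Real.exp (b * ‖x‖ ^ 2)) (gaussian d) := by
  rw [integrable_gaussian_iff]
  refine ((integrable_exp_neg_mul_sq_norm (d := d) (sub_pos.2 hb)).div_const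
    (Real.pi ^ ((d : ℝ) / 2))).congr (ae_of_all _ fun x => ?_)
  simp only [smul_eq_mul]
  rw [div_mul_eq_mul_div, ← Real.exp_add]
  ring_nf

/-- The reflection `(x, u) ↦ (r x + s u, s x - r u)` of `ℝ^d × ℝ^d`, as a linear map. -/
def reflection (r s : ℝ) : (E d × E d) →ₗ[ℝ] (E d × E d) :=
  LinearMap.prod (r • LinearMap.fst ℝ _ _ + s • LinearMap.snd ℝ _ _)
    (s • LinearMap.fst ℝ _ _ - r • LinearMap.snd ℝ _ _)

lemma reflection_apply (r s : ℝ) (z : E d × E d) :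
    reflection r s z = (r • z.1 + s • z.2, s • z.1 - r • z.2) := rfl

lemma reflection_reflection {r s : ℝ} (h : r ^ 2 + s ^ 2 = 1) (z : E d × E d) :
    reflection r s (reflection r s z) = z := by
  ext1
  · simp only [reflection_apply, smul_add, smul_sub, smul_smul]
    have : z.1 = (r ^ 2 + s ^ 2) • z.1 := by rw [h, one_smul]
    nth_rw 3 [this]
    module
  · simp only [reflection_apply, smul_add, smul_sub, smul_smul]
    have : z.2 = (r ^ 2 + s ^ 2) • z.2 := by rw [h, one_smul]
    nth_rw 3 [this]
    module

lemma norm_sq_reflection {r s : ℝ} (h : r ^ 2 + s ^ 2 = 1) (z : E d × E d) :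
    ‖(reflection r s z).1‖ ^ 2 + ‖(reflection r s z).2‖ ^ 2 = ‖z.1‖ ^ 2 + ‖z.2‖ ^ 2 := by
  simp only [reflection_apply, norm_add_sq_real, norm_sub_sq_real, norm_smul, mul_pow,
    inner_smul_left, inner_smul_right, Real.norm_eq_abs, sq_abs, RCLike.conj_to_real]
  linear_combination (‖z.1‖ ^ 2 + ‖z.2‖ ^ 2) * h

/-- A reflection has determinant `±1` because it is an involution, so it preserves Lebesgue
measure on `ℝ^d × ℝ^d`. -/
lemma measurePreserving_reflection_volume {r s : ℝ} (h : r ^ 2 + s ^ 2 = 1) :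
    MeasurePreserving (reflection (d := d) r s)
      ((volume : Measure (E d)).prod volume) (volume.prod volume) := by
  have hc : reflection (d := d) r s * reflection r s = 1 := by
    ext1 <;> ext1 <;> exact reflection_reflection h _
  have hdet : LinearMap.det (reflection (d := d) r s) * LinearMap.det (reflection (d := d) r s)
      = 1 := by
    rw [← map_mul, hc, map_one]
  have h0 : LinearMap.det (reflection (d := d) r s) ≠ 0 := by
    intro h0; simp [h0] at hdet
  have habs : |(LinearMap.det (reflection (d := d) r s))⁻¹| = 1 := by
    rcases mul_self_eq_one_iff.1 hdet with h1 | h1 <;> simp [h1]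
  refine ⟨(reflection (d := d) r s).continuous_of_finiteDimensional.measurable, ?_⟩
  rw [Measure.map_linearMap_addHaar_eq_smul_addHaar _ h0, habs]
  simp

lemma measurable_reflection (r s : ℝ) : Measurable (reflection (d := d) r s) :=
  (reflection (d := d) r s).continuous_of_finiteDimensional.measurable

/-- `γ_d ⊗ γ_d` is invariant under reflections mixing the two factors. -/
lemma measurePreserving_reflection {r s : ℝ} (h : r ^ 2 + s ^ 2 = 1) :
    MeasurePreserving (reflection (d := d) r s)
      ((gaussian d).prod (gaussian d)) ((gaussian d).prod (gaussian d)) := by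
  refine ⟨measurable_reflection r s, ?_⟩
  have hd : ∀ z : E d × E d,
      ENNReal.ofReal (Real.exp (-‖z.1‖ ^ 2) / Real.pi ^ ((d : ℝ) / 2)) *
      ENNReal.ofReal (Real.exp (-‖z.2‖ ^ 2) / Real.pi ^ ((d : ℝ) / 2)) =
      ENNReal.ofReal (Real.exp (-(‖z.1‖ ^ 2 + ‖z.2‖ ^ 2)) / Real.pi ^ ((d : ℝ) / 2)
        / Real.pi ^ ((d : ℝ) / 2)) := by
    intro z
    rw [← ENNReal.ofReal_mul (by positivity), neg_add, Real.exp_add]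
    ring_nf
  simp only [gaussian]
  rw [prod_withDensity measurable_gaussianDensity measurable_gaussianDensity]
  simp_rw [hd]
  refine Measure.ext fun A hA => ?_
  rw [Measure.map_apply (measurable_reflection r s) hA, withDensity_apply _ hA,
    withDensity_apply _ (measurable_reflection r s hA),
    ← (measurePreserving_reflection_volume h).setLIntegral_comp_preimage hA (by fun_prop)]
  refine setLIntegral_congr_fun (measurable_reflection r s hA) fun z _ => ?_
  simp only [norm_sq_reflection h]

/-- The law of `a u + b v` for independent standard Gaussian `u`, `v` and `a² + b² = 1`. -/
lemma lintegral_gaussian_combination {a b : ℝ} (h : a ^ 2 + b ^ 2 = 1) {F : E d → ℝ≥0∞}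
    (hF : Measurable F) :
    ∫⁻ u, ∫⁻ v, F (a • u + b • v) ∂(gaussian d) ∂(gaussian d) = ∫⁻ x, F x ∂(gaussian d) := by
  rw [← lintegral_prod (fun z : E d × E d => F (a • z.1 + b • z.2)) (by fun_prop)]
  have := (measurePreserving_reflection (d := d) h).lintegral_comp
    (f := fun z : E d × E d => F z.1) (by fun_prop)
  simp only [reflection_apply] at this
  rw [this, lintegral_prod _ (by fun_prop)]
  simp

/-! ### The Ornstein–Uhlenbeck semigroup on nonnegative functions -/

/-- The point `√(1 - e^{-2t}) u + e^{-t} x` of Mehler's formula. -/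
def mehlerPoint (t : ℝ) (u x : E d) : E d :=
  Real.sqrt (1 - Real.exp (-2 * t)) • u + Real.exp (-t) • x

/-- The Ornstein–Uhlenbeck semigroup on functions with values in `[0, ∞]`. -/
def ouL (t : ℝ) (F : E d → ℝ≥0∞) (x : E d) : ℝ≥0∞ :=
  ∫⁻ u, F (mehlerPoint t u x) ∂(gaussian d)

lemma continuous_mehlerPoint :
    Continuous fun z : ℝ × E d × E d => mehlerPoint z.1 z.2.1 z.2.2 := by
  unfold mehlerPoint; fun_prop

lemma measurable_mehlerPoint {X : Type*} [MeasurableSpace X] {a : X → ℝ} {u x : X → E d}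
    (ha : Measurable a) (hu : Measurable u) (hx : Measurable x) :
    Measurable fun z => mehlerPoint (a z) (u z) (x z) :=
  (show Measurable ((fun z : ℝ × E d × E d => mehlerPoint z.1 z.2.1 z.2.2) ∘
    fun z => (a z, u z, x z)) from
    continuous_mehlerPoint.measurable.comp (ha.prodMk (hu.prodMk hx)))

attribute [fun_prop] measurable_mehlerPoint

lemma mehler_sq_add_sq {t : ℝ} (ht : 0 ≤ t) :
    Real.exp (-t) ^ 2 + Real.sqrt (1 - Real.exp (-2 * t)) ^ 2 = 1 := by
  rw [Real.sq_sqrt, ← Real.exp_nat_mul]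
  · push_cast; ring_nf
  · rw [sub_nonneg, Real.exp_le_one_iff]; linarith

/-- Joint measurability, also for functions depending on a parameter. -/
lemma measurable_ouL {X : Type*} [MeasurableSpace X] {a : X → ℝ} {x : X → E d}
    {F : X → E d → ℝ≥0∞} (ha : Measurable a) (hF : Measurable (Function.uncurry F))
    (hx : Measurable x) : Measurable fun z => ouL (a z) (F z) (x z) := by
  unfold ouL
  refine Measurable.lintegral_prod_right'
    (f := fun w : X × E d => F w.1 (mehlerPoint (a w.1) w.2 (x w.1))) ?_
  exact hF.comp (measurable_fst.prodMk (measurable_mehlerPoint (ha.comp measurable_fst)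
    measurable_snd (hx.comp measurable_fst)))

lemma measurable_ouL_comp {X : Type*} [MeasurableSpace X] {a : X → ℝ} {x : X → E d}
    {F : E d → ℝ≥0∞} (ha : Measurable a) (hF : Measurable F) (hx : Measurable x) :
    Measurable fun z => ouL (a z) F (x z) :=
  measurable_ouL ha (F := fun _ => F) (hF.comp measurable_snd) hx

/-- Symmetry of `T_t`: a reflection of the product measure interchanges `(x, u)` with the pair whose
first component is the Mehler point. -/
lemma lintegral_prod_mul_ouL {t : ℝ} (ht : 0 ≤ t) {F G : E d → ℝ≥0∞} (hF : Measurable F)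
    (hG : Measurable G) :
    ∫⁻ x, G x * ouL t F x ∂(gaussian d) = ∫⁻ x, F x * ouL t G x ∂(gaussian d) := by
  have key : ∀ {F G : E d → ℝ≥0∞}, Measurable F → Measurable G →
      ∫⁻ x, G x * ouL t F x ∂(gaussian d) =
      ∫⁻ z, G z.1 * F (mehlerPoint t z.2 z.1) ∂((gaussian d).prod (gaussian d)) := by
    intro F G hF hG
    rw [lintegral_prod _ (by fun_prop)]
    refine lintegral_congr fun x => ?_
    exact (lintegral_const_mul _ (by fun_prop)).symm
  have hr := mehler_sq_add_sq ht
  have hm : ∀ z : E d × E d, mehlerPoint t z.2 z.1 = (reflection (Real.exp (-t))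
      (Real.sqrt (1 - Real.exp (-2 * t))) z).1 := by
    intro z; rw [reflection_apply, mehlerPoint, add_comm]
  have hm' : ∀ z : E d × E d, mehlerPoint t (reflection (Real.exp (-t))
      (Real.sqrt (1 - Real.exp (-2 * t))) z).2 (reflection (Real.exp (-t))
      (Real.sqrt (1 - Real.exp (-2 * t))) z).1 = z.1 := by
    intro z; rw [hm, reflection_reflection hr]
  rw [key hF hG, key hG hF, ← (measurePreserving_reflection hr).lintegral_comp (by fun_prop)]
  refine lintegral_congr fun z => ?_
  rw [hm', mul_comm, hm]

@[simp] lemma ouL_const (t : ℝ) (c : ℝ≥0∞) (x : E d) : ouL t (fun _ => c) x = c := by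
  simp [ouL]

/-- The Gaussian measure is invariant. -/
lemma lintegral_ouL {t : ℝ} (ht : 0 ≤ t) {F : E d → ℝ≥0∞} (hF : Measurable F) :
    ∫⁻ x, ouL t F x ∂(gaussian d) = ∫⁻ x, F x ∂(gaussian d) := by
  simpa using lintegral_prod_mul_ouL ht hF (G := fun _ => 1) measurable_const

lemma ouL_mono (t : ℝ) {F G : E d → ℝ≥0∞} (h : F ≤ G) (x : E d) : ouL t F x ≤ ouL t G x :=
  lintegral_mono fun _ => h _

lemma ouL_add (t : ℝ) {F G : E d → ℝ≥0∞} (hF : Measurable F) (x : E d) :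
    ouL t (F + G) x = ouL t F x + ouL t G x :=
  lintegral_add_left (by fun_prop) _

/-- The semigroup law. -/
lemma ouL_ouL {a b : ℝ} (ha : 0 ≤ a) (hb : 0 ≤ b) {F : E d → ℝ≥0∞} (hF : Measurable F) (x : E d) :
    ouL a (ouL b F) x = ouL (a + b) F x := by
  set ra := Real.exp (-a) with hra
  set rb := Real.exp (-b) with hrb
  set sa := Real.sqrt (1 - Real.exp (-2 * a)) with hsa
  set sb := Real.sqrt (1 - Real.exp (-2 * b)) with hsb
  set S := Real.sqrt (1 - Real.exp (-2 * (a + b))) with hS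
  have h1 : ra ^ 2 + sa ^ 2 = 1 := mehler_sq_add_sq ha
  have h2 : rb ^ 2 + sb ^ 2 = 1 := mehler_sq_add_sq hb
  have hr : Real.exp (-(a + b)) = ra * rb := by rw [hra, hrb, ← Real.exp_add]; ring_nf
  have h3 : (ra * rb) ^ 2 + S ^ 2 = 1 := by
    rw [← hr]; exact mehler_sq_add_sq (add_nonneg ha hb)
  have hSS : S ^ 2 = (rb * sa) ^ 2 + sb ^ 2 := by
    linear_combination h3 - h2 - rb ^ 2 * h1
  have e1 : ouL a (ouL b F) x = ∫⁻ u, ∫⁻ v, F ((rb * sa) • u + sb • v + (ra * rb) • x)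
      ∂(gaussian d) ∂(gaussian d) := by
    simp only [ouL, mehlerPoint, ← hra, ← hrb, ← hsa, ← hsb]
    refine lintegral_congr fun u => lintegral_congr fun v => ?_
    congr 1
    module
  have e2 : ouL (a + b) F x = ∫⁻ w, F (S • w + (ra * rb) • x) ∂(gaussian d) := by
    simp only [ouL, mehlerPoint, ← hS, hr]
  rw [e1, e2]
  -- By rotation invariance the Gaussian variables of variances `(rb sa)²` and `sb²` add up to one
  -- of variance `S²`. This divides by `S`, which vanishes when both times are zero.
  by_cases h0 : S = 0
  · have h4 : rb * sa = 0 := by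
      rw [h0] at hSS; nlinarith [sq_nonneg (rb * sa), sq_nonneg sb]
    have h5 : sb = 0 := by
      rw [h0] at hSS; nlinarith [sq_nonneg (rb * sa), sq_nonneg sb]
    simp [h0, h4, h5]
  · have hn : (rb * sa / S) ^ 2 + (sb / S) ^ 2 = 1 := by
      field_simp; linarith
    rw [← lintegral_gaussian_combination hn (F := fun w => F (S • w + (ra * rb) • x))
      (by fun_prop)]
    refine lintegral_congr fun u => lintegral_congr fun v => ?_
    congr 2
    rw [smul_add, smul_smul, smul_smul, mul_div_cancel₀ _ h0, mul_div_cancel₀ _ h0]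

/-! ### The maximal ergodic theorem -/

section Ergodic

variable {Ω : Type*} [MeasurableSpace Ω] {μ : Measure Ω}

lemma measurable_finset_sup {s : Finset ℕ} {f : ℕ → Ω → ℝ≥0∞} (hf : ∀ n ∈ s, Measurable (f n)) :
    Measurable fun x => s.sup fun n => f n x := by
  induction s using Finset.induction_on with
  | empty => exact measurable_const
  | insert a s _ ih =>
    simp only [Finset.sup_insert]
    exact (hf a (by simp)).sup (ih fun n hn => hf n (by simp [hn]))

/-- A weak-type inequality localized to the level sets of `A` implies the strong-type inequality
with Doob's constant. The truncation `min A c` makes both sides of the absorption step finite. -/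
lemma lintegral_rpow_le_of_mul_meas_le [IsProbabilityMeasure μ] {F A : Ω → ℝ≥0∞}
    (hF : Measurable F) (hA : Measurable A) {p : ℝ} (hp : 1 < p)
    (h : ∀ t : ℝ, 0 < t → ENNReal.ofReal t * μ {x | ENNReal.ofReal t < A x} ≤
      ∫⁻ x in {x | ENNReal.ofReal t < A x}, F x ∂μ) :
    (∫⁻ x, A x ^ p ∂μ) ^ (1 / p) ≤ ENNReal.ofReal (p / (p - 1)) * (∫⁻ x, F x ^ p ∂μ) ^ (1 / p) := by
  have hp0 : 0 < p := by linarith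
  have hp1 : 0 < p - 1 := by linarith
  have key : ∀ n : ℕ, (∫⁻ x, (min (A x) n) ^ p ∂μ) ^ (1 / p) ≤
      ENNReal.ofReal (p / (p - 1)) * (∫⁻ x, F x ^ p ∂μ) ^ (1 / p) := by
    intro n
    set B : Ω → ℝ≥0∞ := fun x => min (A x) n with hB
    have hBm : Measurable B := hA.min measurable_const
    have hBn : ∀ x, B x ≤ n := fun x => min_le_right _ _
    have hBt : ∀ x, B x ≠ ∞ := fun x => ne_top_of_le_ne_top (by simp) (hBn x)
    have e1 : ∫⁻ x, B x ^ p ∂μ = ENNReal.ofReal p *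
        ∫⁻ t in Ioi (0:ℝ), μ {x | t < (B x).toReal} * ENNReal.ofReal (t ^ (p - 1)) := by
      rw [← lintegral_rpow_eq_lintegral_meas_lt_mul μ (ae_of_all _ fun x => ENNReal.toReal_nonneg)
        hBm.ennreal_toReal.aemeasurable hp0]
      refine lintegral_congr fun x => ?_
      rw [← ENNReal.ofReal_rpow_of_nonneg ENNReal.toReal_nonneg hp0.le, ENNReal.ofReal_toReal (hBt x)]
    -- The weak-type inequality passes from `A` to `B = min A n`, as the two have the same level
    -- sets below `n`; it is inserted into the layer-cake formula `e1`, and `e4` follows by Tonelli.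
    have e2 : ∀ t ∈ Ioi (0:ℝ), μ {x | t < (B x).toReal} * ENNReal.ofReal (t ^ (p - 1)) ≤
        ∫⁻ x, F x * (Ioo 0 (B x).toReal).indicator (fun t => ENNReal.ofReal (t ^ (p - 2))) t ∂μ := by
      intro t ht
      have ht' : (0:ℝ) < t := ht
      have hset : {x | t < (B x).toReal} = {x | ENNReal.ofReal t < B x} := by
        ext x
        simp only [mem_ofPred_eq]
        exact (ENNReal.ofReal_lt_iff_lt_toReal ht'.le (hBt x)).symm
      have hmeas : MeasurableSet {x | ENNReal.ofReal t < B x} :=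
        measurableSet_lt measurable_const hBm
      have hwk : ENNReal.ofReal t * μ {x | ENNReal.ofReal t < B x} ≤
          ∫⁻ x in {x | ENNReal.ofReal t < B x}, F x ∂μ := by
        by_cases hn : ENNReal.ofReal t < n
        · have : {x | ENNReal.ofReal t < B x} = {x | ENNReal.ofReal t < A x} := by
            ext x; simp [hB, hn]
          rw [this]; exact h t ht'
        · have : {x | ENNReal.ofReal t < B x} = ∅ := by
            ext x; simp only [hB, mem_ofPred_eq, lt_min_iff, hn, and_false, mem_empty_iff_false]
          rw [this]; simp
      have hsplit : ENNReal.ofReal (t ^ (p - 1)) = ENNReal.ofReal t * ENNReal.ofReal (t ^ (p - 2)) := by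
        rw [← ENNReal.ofReal_mul ht'.le, ← Real.rpow_one_add' ht'.le (by linarith)]
        ring_nf
      rw [hsplit, hset, mul_comm, mul_right_comm]
      refine (mul_le_mul_left hwk _).trans (le_of_eq ?_)
      rw [← lintegral_indicator hmeas, ← lintegral_mul_const _ (hF.indicator hmeas)]
      refine lintegral_congr fun x => ?_
      by_cases hx : ENNReal.ofReal t < B x
      · have hx' : t < (B x).toReal := (ENNReal.ofReal_lt_iff_lt_toReal ht'.le (hBt x)).1 hx
        rw [indicator_of_mem (by exact hx), indicator_of_mem (by exact ⟨ht', hx'⟩)]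
      · have hx' : ¬ t < (B x).toReal := fun h' =>
          hx ((ENNReal.ofReal_lt_iff_lt_toReal ht'.le (hBt x)).2 h')
        rw [indicator_of_notMem (by exact hx), indicator_of_notMem (fun h' => hx' h'.2)]
        simp
    have e3 : ∀ x, ∫⁻ t in Ioi (0:ℝ),
        (Ioo 0 (B x).toReal).indicator (fun t => ENNReal.ofReal (t ^ (p - 2))) t =
        ENNReal.ofReal (1 / (p - 1)) * B x ^ (p - 1) := by
      intro x
      have hb : 0 ≤ (B x).toReal := ENNReal.toReal_nonneg
      rw [lintegral_indicator measurableSet_Ioo, Measure.restrict_restrict measurableSet_Ioo,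
        inter_eq_left.2 (fun y hy => hy.1), setLIntegral_congr Ioo_ae_eq_Ioc,
        ← ofReal_integral_eq_lintegral_ofReal]
      · rw [← intervalIntegral.integral_of_le hb, integral_rpow (Or.inl (by linarith))]
        rw [show p - 2 + 1 = p - 1 by ring, Real.zero_rpow hp1.ne', sub_zero,
          ← ENNReal.ofReal_toReal (hBt x), ENNReal.ofReal_rpow_of_nonneg hb hp1.le,
          ← ENNReal.ofReal_mul (by positivity), ENNReal.ofReal_toReal (hBt x)]
        congr 1; ring
      · exact (intervalIntegral.intervalIntegrable_rpow' (by linarith)).1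
      · filter_upwards [self_mem_ae_restrict measurableSet_Ioc] with t ht
        exact Real.rpow_nonneg ht.1.le _
    have e4 : ∫⁻ x, B x ^ p ∂μ ≤ ENNReal.ofReal (p / (p - 1)) * ∫⁻ x, F x * B x ^ (p - 1) ∂μ := by
      rw [e1]
      have hmeas2 : Measurable (Function.uncurry fun (t : ℝ) (x : Ω) => F x *
          (Ioo 0 (B x).toReal).indicator (fun t => ENNReal.ofReal (t ^ (p - 2))) t) := by
        have : (Function.uncurry fun (t : ℝ) (x : Ω) => F x *
          (Ioo 0 (B x).toReal).indicator (fun t => ENNReal.ofReal (t ^ (p - 2))) t) =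
          fun z : ℝ × Ω => F z.2 * ({z : ℝ × Ω | 0 < z.1 ∧ z.1 < (B z.2).toReal}).indicator
            (fun z => ENNReal.ofReal (z.1 ^ (p - 2))) z := by
          funext z; rfl
        rw [this]
        refine (hF.comp measurable_snd).mul (Measurable.indicator (by fun_prop) ?_)
        exact (measurableSet_lt measurable_const measurable_fst).inter
          (measurableSet_lt measurable_fst (hBm.ennreal_toReal.comp measurable_snd))
      calc _ ≤ ENNReal.ofReal p * ∫⁻ t in Ioi (0:ℝ), ∫⁻ x, F x *
            (Ioo 0 (B x).toReal).indicator (fun t => ENNReal.ofReal (t ^ (p - 2))) t ∂μ := by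
            gcongr 1
            exact setLIntegral_mono' measurableSet_Ioi e2
        _ = ENNReal.ofReal p * ∫⁻ x, (∫⁻ t in Ioi (0:ℝ), F x *
            (Ioo 0 (B x).toReal).indicator (fun t => ENNReal.ofReal (t ^ (p - 2))) t) ∂μ := by
            rw [lintegral_lintegral_swap hmeas2.aemeasurable]
        _ = ENNReal.ofReal p * ∫⁻ x, ENNReal.ofReal (1 / (p - 1)) * (F x * B x ^ (p - 1)) ∂μ := by
            congr 1
            refine lintegral_congr fun x => ?_
            rw [lintegral_const_mul _ (Measurable.indicator (by fun_prop) measurableSet_Ioo), e3]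
            ring
        _ = _ := by
            rw [lintegral_const_mul _ (by fun_prop), ← mul_assoc,
              ← ENNReal.ofReal_mul hp0.le]
            congr 2; ring
    set I := ∫⁻ x, B x ^ p ∂μ with hI
    have hIt : I ≠ ∞ := by
      refine ne_top_of_le_ne_top ?_ (lintegral_mono (g := fun _ => (n : ℝ≥0∞) ^ p)
        fun x => ENNReal.rpow_le_rpow (hBn x) hp0.le)
      simp [hp0.le]
    have hconj := Real.HolderConjugate.conjExponent hp
    -- Hölder turns the right-hand side into a multiple of `I ^ (1 - 1 / p)`, which is absorbed.
    have e5 : I ≤ ENNReal.ofReal (p / (p - 1)) * (∫⁻ x, F x ^ p ∂μ) ^ (1 / p) * I ^ (1 - 1 / p) := by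
      refine e4.trans ?_
      rw [mul_assoc]
      gcongr
      refine (ENNReal.lintegral_mul_le_Lp_mul_Lq μ hconj hF.aemeasurable
        (hBm.pow_const _).aemeasurable).trans (le_of_eq ?_)
      have hpq : (p - 1) * p.conjExponent = p := by
        rw [Real.conjExponent]; field_simp
      have hq : 1 / p.conjExponent = 1 - 1 / p := by
        rw [Real.conjExponent]; field_simp
      simp_rw [← ENNReal.rpow_mul, hpq, hq]
      rw [hI]
    by_cases hI0 : I = 0
    · rw [hI0, ENNReal.zero_rpow_of_pos (by positivity)]; exact zero_le
    · have : I = I ^ (1 / p) * I ^ (1 - 1 / p) := by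
        rw [← ENNReal.rpow_add _ _ hI0 hIt]; simp
      nth_rw 1 [this] at e5
      have hfin : I ^ (1 - 1 / p) ≠ ∞ := ENNReal.rpow_ne_top_of_nonneg
        (by rw [sub_nonneg, div_le_one hp0]; exact hp.le) hIt
      have hne : I ^ (1 - 1 / p) ≠ 0 := by simp [ENNReal.rpow_eq_zero_iff, hI0, hIt]
      exact (ENNReal.mul_le_mul_iff_left hne hfin).1 e5
  have hsup : ∀ x, A x ^ p = ⨆ n : ℕ, (min (A x) n) ^ p := by
    intro x
    have h1 : A x = ⨆ n : ℕ, min (A x) n := by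
      rw [← inf_iSup_eq, ENNReal.iSup_natCast]; simp
    have h2 := (ENNReal.orderIsoRpow p hp0).map_iSup (fun n : ℕ => min (A x) (n : ℝ≥0∞))
    simp only [ENNReal.orderIsoRpow_apply] at h2
    rw [← h2, ← h1]
  simp_rw [hsup]
  rw [lintegral_iSup (fun n => (hA.min measurable_const).pow_const _) (fun m n hmn x => by
    simp only
    gcongr)]
  have h2 := (ENNReal.orderIsoRpow (1 / p) (by positivity)).map_iSup
    (fun n : ℕ => ∫⁻ x, (min (A x) (n : ℝ≥0∞)) ^ p ∂μ)
  simp only [ENNReal.orderIsoRpow_apply] at h2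
  rw [h2]
  exact iSup_le key

/-- The sums `F + U F + ⋯ + U^{n-1} F`. -/
def ergodicSum (U : (Ω → ℝ≥0∞) → Ω → ℝ≥0∞) (F : Ω → ℝ≥0∞) : ℕ → Ω → ℝ≥0∞
  | 0 => 0
  | n + 1 => F + U (ergodicSum U F n)

/-- A positive operator on nonnegative functions which fixes constants and preserves the
integral. -/
structure IsMarkov (μ : Measure Ω) (U : (Ω → ℝ≥0∞) → Ω → ℝ≥0∞) : Prop where
  meas : ∀ F, Measurable F → Measurable (U F)
  mono : ∀ F G, F ≤ G → U F ≤ U G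
  add : ∀ F G, Measurable F → U (F + G) = U F + U G
  const : ∀ c, U (fun _ => c) = fun _ => c
  int : ∀ F, Measurable F → ∫⁻ x, U F x ∂μ = ∫⁻ x, F x ∂μ

variable {U : (Ω → ℝ≥0∞) → Ω → ℝ≥0∞}

lemma IsMarkov.measurable_ergodicSum (hU : IsMarkov μ U) {F : Ω → ℝ≥0∞} (hF : Measurable F)
    (n : ℕ) : Measurable (ergodicSum U F n) := by
  induction n with
  | zero => exact measurable_zero
  | succ n ih => exact hF.add (hU.meas _ ih)

lemma IsMarkov.lintegral_ergodicSum (hU : IsMarkov μ U) {F : Ω → ℝ≥0∞} (hF : Measurable F)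
    (n : ℕ) : ∫⁻ x, ergodicSum U F n x ∂μ = n * ∫⁻ x, F x ∂μ := by
  induction n with
  | zero => simp [ergodicSum]
  | succ n ih =>
    have : ∫⁻ x, ergodicSum U F (n + 1) x ∂μ = ∫⁻ x, F x + U (ergodicSum U F n) x ∂μ := rfl
    rw [this, lintegral_add_left hF, hU.int _ (hU.measurable_ergodicSum hF n), ih]
    push_cast; ring

/-- The maximal ergodic theorem, after Garsia: with `M = max_n (S_n - n c)⁺`, positivity of `U`
gives `M + c ≤ F + U M` on `{M > 0}`, and `∫ U M = ∫ M` cancels. -/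
lemma IsMarkov.mul_meas_le [IsProbabilityMeasure μ] (hU : IsMarkov μ U) {F : Ω → ℝ≥0∞}
    (hF : Measurable F) (hFi : ∫⁻ x, F x ∂μ ≠ ∞) (N : ℕ) {c : ℝ≥0∞} (hc : c ≠ ∞) :
    c * μ {x | ∃ n ≤ N, n * c < ergodicSum U F n x} ≤
      ∫⁻ x in {x | ∃ n ≤ N, n * c < ergodicSum U F n x}, F x ∂μ := by
  set S := ergodicSum U F with hS
  set M : Ω → ℝ≥0∞ := fun x => (Finset.range (N + 1)).sup fun n => S n x - n * c with hM
  have hSm : ∀ n, Measurable (S n) := hU.measurable_ergodicSum hF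
  have hMm : Measurable M := by
    refine measurable_finset_sup fun n _ => ?_
    exact (hSm n).sub measurable_const
  have hEM : {x | ∃ n ≤ N, n * c < S n x} = {x | 0 < M x} := by
    ext x
    simp [hM, Finset.lt_sup_iff]
  rw [hEM]
  set A := {x | 0 < M x} with hA
  have hAm : MeasurableSet A := measurableSet_lt measurable_const hMm
  have hpt : ∀ x ∈ A, M x + c ≤ F x + U M x := by
    intro x hx
    obtain ⟨n, hn, hnx⟩ := Finset.exists_mem_eq_sup (Finset.range (N + 1)) (by simp)
      fun n => S n x - n * c
    have hMx : M x = S n x - n * c := hnx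
    have hlt : n * c < S n x := by
      have : 0 < M x := hx
      rwa [hMx, tsub_pos_iff_lt] at this
    -- The maximizing index is positive because `S 0 = 0`; for `n = m + 1`, `U` is applied to
    -- `S m ≤ M + m c`.
    cases n with
    | zero => simp [hS, ergodicSum] at hlt
    | succ m =>
      have hle : S m ≤ M + fun _ => m * c := by
        intro y
        have : S m y - m * c ≤ M y := Finset.le_sup (f := fun n : ℕ => S n y - n * c)
          (Finset.mem_range.2 (by have := Finset.mem_range.1 hn; omega))
        exact tsub_le_iff_right.1 this
      have h1 : S (m + 1) x ≤ F x + (U M x + m * c) := by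
        have := hU.mono _ _ hle x
        rw [hU.add _ _ hMm, hU.const] at this
        exact add_le_add le_rfl this
      have h2 : M x + (m + 1 : ℕ) * c = S (m + 1) x := by
        rw [hMx, tsub_add_cancel_of_le hlt.le]
      have h3 : (m : ℝ≥0∞) * c ≠ ∞ := ENNReal.mul_ne_top (by simp) hc
      refine (ENNReal.add_le_add_iff_right h3).1 ?_
      calc M x + c + m * c = M x + (m + 1 : ℕ) * c := by push_cast; ring
        _ = S (m + 1) x := h2
        _ ≤ _ := by rw [add_assoc]; exact h1
  have hMi : ∫⁻ x, M x ∂μ ≠ ∞ := by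
    refine ne_top_of_le_ne_top (b := ∫⁻ x, ∑ n ∈ Finset.range (N + 1), S n x ∂μ) ?_ ?_
    · rw [lintegral_finsetSum _ fun n _ => hSm n]
      refine ENNReal.sum_ne_top.2 fun n _ => ?_
      rw [hU.lintegral_ergodicSum hF]
      exact ENNReal.mul_ne_top (by simp) hFi
    · refine lintegral_mono fun x => Finset.sup_le fun n hn => tsub_le_self.trans ?_
      exact Finset.single_le_sum (f := fun n => S n x) (fun _ _ => zero_le) hn
  have hMA : ∫⁻ x in A, M x ∂μ = ∫⁻ x, M x ∂μ := by
    rw [← lintegral_indicator hAm]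
    refine lintegral_congr fun x => ?_
    by_cases hx : x ∈ A
    · rw [indicator_of_mem hx]
    · rw [indicator_of_notMem hx]
      exact (nonpos_iff_eq_zero.1 (not_lt.1 hx)).symm
  have h1 : ∫⁻ x in A, (M x + c) ∂μ ≤ ∫⁻ x in A, (F x + U M x) ∂μ :=
    setLIntegral_mono' hAm hpt
  rw [lintegral_add_left hMm, lintegral_add_left hF, hMA, setLIntegral_const] at h1
  have h2 : ∫⁻ x in A, U M x ∂μ ≤ ∫⁻ x, M x ∂μ := by
    rw [← hU.int M hMm]; exact setLIntegral_le_lintegral _ _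
  refine (ENNReal.add_le_add_iff_left hMi).1 (h1.trans ?_)
  rw [add_comm]
  gcongr

/-- The dominated ergodic theorem for finitely many averages. -/
lemma IsMarkov.maximal_le [IsProbabilityMeasure μ] (hU : IsMarkov μ U) {F : Ω → ℝ≥0∞}
    (hF : Measurable F) {p : ℝ} (hp : 1 < p) (N : ℕ) :
    (∫⁻ x, ((Finset.range (N + 1)).sup fun n => ergodicSum U F n x / n) ^ p ∂μ) ^ (1 / p) ≤
      ENNReal.ofReal (p / (p - 1)) * (∫⁻ x, F x ^ p ∂μ) ^ (1 / p) := by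
  have hp0 : 0 < p := by linarith
  -- The maximal ergodic theorem needs `F` integrable; otherwise `‖F‖_p = ∞`.
  by_cases hFi : ∫⁻ x, F x ∂μ = ∞
  · have : (∫⁻ x, F x ^ p ∂μ) ^ (1 / p) = ∞ := by
      have h1 := ENNReal.lintegral_mul_le_Lp_mul_Lq μ (Real.HolderConjugate.conjExponent hp)
        hF.aemeasurable (measurable_const (a := (1 : ℝ≥0∞))).aemeasurable
      simp only [Pi.mul_apply, mul_one, ENNReal.one_rpow, lintegral_const, measure_univ] at h1
      exact top_le_iff.1 (hFi ▸ h1)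
    rw [this, ENNReal.mul_top]
    · exact le_top
    · have : 0 < p / (p - 1) := div_pos hp0 (by linarith)
      simpa using this
  refine lintegral_rpow_le_of_mul_meas_le hF ?_ hp fun t ht => ?_
  · refine measurable_finset_sup fun n _ => ?_
    exact (hU.measurable_ergodicSum hF n).div_const _
  · have hset : {x | ENNReal.ofReal t < (Finset.range (N + 1)).sup
        fun n => ergodicSum U F n x / n} =
        {x | ∃ n ≤ N, n * ENNReal.ofReal t < ergodicSum U F n x} := by
      ext x
      simp only [Finset.lt_sup_iff, mem_ofPred_eq, Finset.mem_range, Nat.lt_succ_iff]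
      refine exists_congr fun n => and_congr_right fun _ => ?_
      rcases Nat.eq_zero_or_pos n with rfl | hn
      · simp [ergodicSum]
      · rw [ENNReal.lt_div_iff_mul_lt (by simp) (by simp), mul_comm]
    rw [hset]
    exact hU.mul_meas_le hF hFi N ENNReal.ofReal_ne_top

end Ergodic

/-! ### The maximal function of the Ornstein–Uhlenbeck semigroup -/

/-- Jensen's inequality for a weight `k` that need not be normalized. -/
lemma rpow_lintegral_mul_le {Ω : Type*} [MeasurableSpace Ω] {μ : Measure Ω} {k g : Ω → ℝ≥0∞}
    (hk : AEMeasurable k μ) (hg : AEMeasurable g μ) {q : ℝ} (hq : 1 ≤ q) :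
    (∫⁻ a, k a * g a ∂μ) ^ q ≤ (∫⁻ a, k a ∂μ) ^ (q - 1) * ∫⁻ a, k a * g a ^ q ∂μ := by
  have hq0 : 0 < q := by linarith
  have h1 : (0 : ℝ) ≤ 1 / q := by positivity
  have h2 : 0 ≤ 1 - 1 / q := by rw [sub_nonneg, div_le_one hq0]; exact hq
  have h := ENNReal.lintegral_mul_norm_pow_le (μ := μ) (f := fun a => k a * g a ^ q) (g := k)
    (hk.mul (hg.pow_const _)) hk h1 h2 (by ring)
  have e : ∀ a, (k a * g a ^ q) ^ (1 / q) * k a ^ (1 - 1 / q) = k a * g a := by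
    intro a
    rw [ENNReal.mul_rpow_of_nonneg _ _ h1, ← ENNReal.rpow_mul, mul_one_div_cancel hq0.ne',
      ENNReal.rpow_one, mul_right_comm, ← ENNReal.rpow_add_of_nonneg _ _ h1 h2]
    simp
  simp_rw [e] at h
  refine (ENNReal.rpow_le_rpow h hq0.le).trans (le_of_eq ?_)
  rw [ENNReal.mul_rpow_of_nonneg _ _ hq0.le, ← ENNReal.rpow_mul, ← ENNReal.rpow_mul,
    one_div_mul_cancel hq0.ne', ENNReal.rpow_one, sub_mul, one_div_mul_cancel hq0.ne', one_mul,
    mul_comm]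

lemma lintegral_Ioi_add_rpow {a c b : ℝ} (hac : 0 < a + c) (hb : 1 < b) :
    ∫⁻ s in Ioi a, ENNReal.ofReal ((s + c) ^ (-b)) =
      ENNReal.ofReal ((a + c) ^ (1 - b) / (b - 1)) := by
  have hint : IntegrableOn (fun s : ℝ => (s + c) ^ (-b)) (Ioi a) :=
    integrableOn_add_rpow_Ioi_of_lt (by linarith) (by linarith)
  rw [← ofReal_integral_eq_lintegral_ofReal hint]
  · congr 1
    have hd : ∀ x ∈ Ici a, HasDerivAt (fun s : ℝ => (s + c) ^ (1 - b) / (1 - b))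
        ((x + c) ^ (-b)) x := by
      intro x hx
      have hx' : x + c ≠ 0 := by have : a ≤ x := hx; linarith
      refine ((((hasDerivAt_id x).add_const c).rpow_const (p := 1 - b)
        (Or.inl hx')).div_const (1 - b)).congr_deriv ?_
      have : 1 - b ≠ 0 := by linarith
      rw [one_mul, mul_comm, mul_div_assoc, div_self this, mul_one]
      simp
    have ht : Filter.Tendsto (fun s : ℝ => (s + c) ^ (1 - b) / (1 - b)) Filter.atTop (nhds 0) := by
      have h1 := (tendsto_rpow_neg_atTop (y := b - 1) (by linarith)).comp
        (Filter.tendsto_atTop_add_const_right Filter.atTop c Filter.tendsto_id)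
      have h2 := h1.div_const (1 - b)
      rw [zero_div] at h2
      refine h2.congr fun s => ?_
      simp [Function.comp]
    rw [integral_Ioi_of_hasDerivAt_of_tendsto' hd hint ht, zero_sub, ← neg_sub b 1, div_neg, neg_neg]
  · filter_upwards [self_mem_ae_restrict measurableSet_Ioi] with s hs
    have : a < s := hs
    exact Real.rpow_nonneg (by linarith) _

/-- The quasi-norm of `L^p(γ_d)` for functions with values in `[0, ∞]`. -/
def gnorm (p : ℝ) (F : E d → ℝ≥0∞) : ℝ≥0∞ := (∫⁻ x, F x ^ p ∂(gaussian d)) ^ (1 / p)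

lemma gnorm_mono {p : ℝ} (hp : 0 < p) {F G : E d → ℝ≥0∞} (h : ∀ᵐ x ∂(gaussian d), F x ≤ G x) :
    gnorm p F ≤ gnorm p G := by
  refine ENNReal.rpow_le_rpow (lintegral_mono_ae ?_) (by positivity)
  filter_upwards [h] with x hx
  exact ENNReal.rpow_le_rpow hx hp.le

lemma gnorm_const_mul {p : ℝ} (hp : 0 < p) (c : ℝ≥0∞) (hc : c ≠ ∞) (F : E d → ℝ≥0∞) :
    gnorm p (fun x => c * F x) = c * gnorm p F := by
  unfold gnorm
  simp_rw [ENNReal.mul_rpow_of_nonneg _ _ hp.le]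
  rw [lintegral_const_mul' _ _ (ENNReal.rpow_ne_top_of_nonneg hp.le hc),
    ENNReal.mul_rpow_of_nonneg _ _ (by positivity), ← ENNReal.rpow_mul,
    mul_one_div_cancel hp.ne', ENNReal.rpow_one]

lemma gnorm_iSup {p : ℝ} (hp : 0 < p) {F : ℕ → E d → ℝ≥0∞} (hF : ∀ n, Measurable (F n))
    (hmono : Monotone F) : gnorm p (fun x => ⨆ n, F n x) = ⨆ n, gnorm p (F n) := by
  unfold gnorm
  have h1 : ∀ x, (⨆ n, F n x) ^ p = ⨆ n, (F n x) ^ p := fun x =>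
    (ENNReal.orderIsoRpow p hp).map_iSup fun n => F n x
  simp_rw [h1]
  rw [lintegral_iSup (fun n => (hF n).pow_const _) (fun m n hmn x =>
    ENNReal.rpow_le_rpow (hmono hmn x) hp.le)]
  exact (ENNReal.orderIsoRpow (1 / p) (by positivity)).map_iSup _

lemma isMarkov_ouL {t : ℝ} (ht : 0 ≤ t) : IsMarkov (gaussian d) (ouL (d := d) t) where
  meas _ hF := measurable_ouL_comp measurable_const hF measurable_id
  mono _ _ h := ouL_mono t h
  add _ _ hF := funext fun x => ouL_add t hF x
  const c := funext fun x => ouL_const t c x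
  int _ hF := lintegral_ouL ht hF

lemma measurable_ouL_time {F : E d → ℝ≥0∞} (hF : Measurable F) (x : E d) :
    Measurable fun s => ouL s F x :=
  measurable_ouL_comp measurable_id hF measurable_const

lemma measurable_ouL_prod {F : E d → ℝ≥0∞} (hF : Measurable F) :
    Measurable fun z : ℝ × E d => ouL z.1 F z.2 :=
  measurable_ouL_comp measurable_fst hF measurable_snd

/-- The time average `ε⁻¹ ∫_0^ε T_s F ds`. -/
def avgL (ε : ℝ) (F : E d → ℝ≥0∞) (x : E d) : ℝ≥0∞ :=
  (∫⁻ s in Ioc 0 ε, ouL s F x) / ENNReal.ofReal ε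

lemma measurable_avgL (ε : ℝ) {F : E d → ℝ≥0∞} (hF : Measurable F) : Measurable (avgL ε F) := by
  unfold avgL
  refine Measurable.div_const ?_ _
  exact Measurable.lintegral_prod_left' (measurable_ouL_prod hF)

lemma ouL_lintegral {t : ℝ} (ht : 0 ≤ t) {F : E d → ℝ≥0∞} (hF : Measurable F) {w : ℝ → ℝ≥0∞}
    (hw : Measurable w) {S : Set ℝ} (hS : MeasurableSet S) (hS0 : S ⊆ Ici 0) (x : E d) :
    ouL t (fun y => ∫⁻ s in S, w s * ouL s F y) x = ∫⁻ s in S, w s * ouL (t + s) F x := by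
  have h1 : Measurable (Function.uncurry fun (u : E d) (s : ℝ) =>
      w s * ouL s F (mehlerPoint t u x)) := by
    exact Measurable.mul (f := fun z : E d × ℝ => w z.2)
      (g := fun z : E d × ℝ => ouL z.2 F (mehlerPoint t z.1 x)) (hw.comp measurable_snd)
      (measurable_ouL_comp measurable_snd hF
        (measurable_mehlerPoint measurable_const measurable_fst measurable_const))
  have e := lintegral_lintegral_swap (μ := gaussian d) (ν := volume.restrict S)
    (f := fun (u : E d) (s : ℝ) => w s * ouL s F (mehlerPoint t u x)) h1.aemeasurable
  refine e.trans (setLIntegral_congr_fun hS fun s hs => ?_)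
  have hm : Measurable fun u => ouL s F (mehlerPoint t u x) :=
    measurable_ouL_comp measurable_const hF
      (measurable_mehlerPoint measurable_const measurable_id measurable_const)
  rw [← ouL_ouL ht (hS0 hs) hF]
  exact lintegral_const_mul _ hm

/-- Sums of iterates of `T_ε` applied to a time average are again time averages. -/
lemma ergodicSum_avgL {ε : ℝ} (hε : 0 < ε) {F : E d → ℝ≥0∞} (hF : Measurable F) (n : ℕ)
    (x : E d) : ergodicSum (ouL ε) (avgL ε F) n x =
      (∫⁻ s in Ioc 0 (n * ε), ouL s F x) / ENNReal.ofReal ε := by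
  induction n generalizing x with
  | zero => simp [ergodicSum]
  | succ n ih =>
    have h0 : ergodicSum (ouL ε) (avgL ε F) (n + 1) x =
      avgL ε F x + ouL ε (ergodicSum (ouL ε) (avgL ε F) n) x := rfl
    have h1 : ergodicSum (ouL ε) (avgL ε F) n =
        fun y => ∫⁻ s in Ioc 0 (n * ε), (ENNReal.ofReal ε)⁻¹ * ouL s F y := by
      funext y
      rw [ih, lintegral_const_mul _ (measurable_ouL_time hF y), div_eq_mul_inv, mul_comm]
    rw [h0, h1, ouL_lintegral hε.le hF measurable_const measurableSet_Ioc
      (fun s hs => hs.1.le), lintegral_const_mul _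
      (by exact (measurable_ouL_time hF x).comp (measurable_const_add ε)), avgL,
      mul_comm, ← div_eq_mul_inv, ← ENNReal.add_div]
    congr 1
    have h2 : ∫⁻ s in Ioc 0 (n * ε), ouL (ε + s) F x = ∫⁻ s in Ioc ε (ε + n * ε), ouL s F x := by
      have := (measurePreserving_add_left volume ε).setLIntegral_comp_preimage_emb
        (measurableEmbedding_addLeft ε) (fun s => ouL s F x) (Ioc ε (ε + n * ε))
      rw [← this]
      congr 2
      ext s; simp
    rw [h2, show ((n + 1 : ℕ) : ℝ) * ε = ε + n * ε by push_cast; ring,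
      ← Ioc_union_Ioc_eq_Ioc (b := ε) (c := ε + n * ε) hε.le (by
        have : 0 ≤ n * ε := by positivity
        linarith), lintegral_union measurableSet_Ioc]
    exact Set.disjoint_left.2 fun s hs hs' => not_lt.2 hs.2 hs'.1

lemma rpow_ouL_le {p : ℝ} (hp : 1 ≤ p) (t : ℝ) {F : E d → ℝ≥0∞} (hF : Measurable F) (x : E d) :
    ouL t F x ^ p ≤ ouL t (fun y => F y ^ p) x := by
  have := rpow_lintegral_mul_le (μ := gaussian d) (k := fun _ => 1)
    (g := fun u => F (mehlerPoint t u x)) aemeasurable_const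
    (hF.comp (measurable_mehlerPoint measurable_const measurable_id
      measurable_const)).aemeasurable hp
  simpa [ouL] using this

lemma gnorm_avgL_le {p : ℝ} (hp : 1 ≤ p) {ε : ℝ} (hε : 0 < ε) {F : E d → ℝ≥0∞}
    (hF : Measurable F) : gnorm p (avgL ε F) ≤ gnorm p F := by
  refine ENNReal.rpow_le_rpow ?_ (by positivity)
  have hε0 : ENNReal.ofReal ε ≠ 0 := by simpa using hε
  have hFp : Measurable fun y => F y ^ p := hF.pow_const _
  have h1 : ∀ x, avgL ε F x ^ p ≤
      ∫⁻ s in Ioc 0 ε, (ENNReal.ofReal ε)⁻¹ * ouL s (fun y => F y ^ p) x := by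
    intro x
    have := rpow_lintegral_mul_le (μ := volume.restrict (Ioc 0 ε))
      (k := fun _ => (ENNReal.ofReal ε)⁻¹) (g := fun s => ouL s F x) aemeasurable_const
      (measurable_ouL_time hF x).aemeasurable hp
    rw [lintegral_const_mul _ (measurable_ouL_time hF x), mul_comm, ← div_eq_mul_inv] at this
    refine this.trans ?_
    rw [lintegral_const, Measure.restrict_apply_univ, Real.volume_Ioc, sub_zero,
      ENNReal.inv_mul_cancel hε0 ENNReal.ofReal_ne_top, ENNReal.one_rpow, one_mul]
    gcongr with s
    exact rpow_ouL_le hp s hF x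
  refine (lintegral_mono h1).trans (le_of_eq ?_)
  have hm : Measurable (Function.uncurry fun (x : E d) (s : ℝ) =>
      (ENNReal.ofReal ε)⁻¹ * ouL s (fun y => F y ^ p) x) :=
    Measurable.mul (f := fun _ => (ENNReal.ofReal ε)⁻¹)
      (g := fun z : E d × ℝ => ouL z.2 (fun y => F y ^ p) z.1) measurable_const
      (measurable_ouL_comp measurable_snd hFp measurable_fst)
  rw [lintegral_lintegral_swap hm.aemeasurable]
  have h2 : ∀ s ∈ Ioc 0 ε, ∫⁻ x, (ENNReal.ofReal ε)⁻¹ * ouL s (fun y => F y ^ p) x ∂(gaussian d) =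
      (ENNReal.ofReal ε)⁻¹ * ∫⁻ x, F x ^ p ∂(gaussian d) := by
    intro s hs
    rw [lintegral_const_mul _ ((isMarkov_ouL hs.1.le).meas _ hFp), lintegral_ouL hs.1.le hFp]
  rw [setLIntegral_congr_fun measurableSet_Ioc h2, setLIntegral_const, Real.volume_Ioc, sub_zero,
    mul_right_comm, ENNReal.inv_mul_cancel hε0 ENNReal.ofReal_ne_top, one_mul]

/-- The averages over `(0, n 2^{-k}]` for `n ≤ 4^k`; this is increasing in `k`. -/
def maxSeq (F : E d → ℝ≥0∞) (k : ℕ) (x : E d) : ℝ≥0∞ :=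
  (Finset.range (4 ^ k + 1)).sup fun n =>
    ergodicSum (ouL ((2 : ℝ) ^ k)⁻¹) (avgL ((2 : ℝ) ^ k)⁻¹ F) n x / n

/-- The ergodic maximal function, as a supremum over dyadic times. -/
def maxFn (F : E d → ℝ≥0∞) (x : E d) : ℝ≥0∞ := ⨆ k, maxSeq F k x

lemma measurable_maxSeq {F : E d → ℝ≥0∞} (hF : Measurable F) (k : ℕ) :
    Measurable (maxSeq F k) := by
  refine measurable_finset_sup fun n _ => Measurable.div_const ?_ _
  exact (isMarkov_ouL (by positivity)).measurable_ergodicSum (measurable_avgL _ hF) n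

lemma measurable_maxFn {F : E d → ℝ≥0∞} (hF : Measurable F) : Measurable (maxFn F) :=
  Measurable.iSup fun k => measurable_maxSeq hF k

lemma le_maxSeq {F : E d → ℝ≥0∞} (hF : Measurable F) {k n : ℕ} (hn : n ≤ 4 ^ k) (x : E d) :
    (∫⁻ s in Ioc 0 (n * ((2 : ℝ) ^ k)⁻¹), ouL s F x) / ENNReal.ofReal (((2 : ℝ) ^ k)⁻¹) / n
      ≤ maxSeq F k x := by
  rw [← ergodicSum_avgL (by positivity) hF]
  exact Finset.le_sup (f := fun n : ℕ =>
    ergodicSum (ouL ((2 : ℝ) ^ k)⁻¹) (avgL ((2 : ℝ) ^ k)⁻¹ F) n x / n)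
    (Finset.mem_range.2 (Nat.lt_succ_of_le hn))

/-- The average over `(0, n 2^{-k}]` is also the one over `(0, 2n 2^{-(k+1)}]`. -/
lemma monotone_maxSeq {F : E d → ℝ≥0∞} (hF : Measurable F) : Monotone (maxSeq F) := by
  refine monotone_nat_of_le_succ fun k x => Finset.sup_le fun n hn => ?_
  rw [ergodicSum_avgL (by positivity) hF]
  have hn' : n ≤ 4 ^ k := Nat.lt_succ_iff.1 (Finset.mem_range.1 hn)
  refine le_trans (le_of_eq ?_) (le_maxSeq hF (k := k + 1) (n := 2 * n)
    (by rw [pow_succ]; omega) x)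
  have e1 : ((2 * n : ℕ) : ℝ) * ((2 : ℝ) ^ (k + 1))⁻¹ = n * ((2 : ℝ) ^ k)⁻¹ := by
    push_cast; rw [pow_succ]; field_simp
  have e2 : ENNReal.ofReal (((2 : ℝ) ^ k)⁻¹) = 2 * ENNReal.ofReal (((2 : ℝ) ^ (k + 1))⁻¹) := by
    rw [← ENNReal.ofReal_ofNat, ← ENNReal.ofReal_mul (by norm_num), pow_succ]
    congr 1; field_simp
  rw [e1, e2, div_eq_mul_inv, div_eq_mul_inv, div_eq_mul_inv, div_eq_mul_inv,
    ENNReal.mul_inv (by simp) (by simp)]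
  push_cast
  rw [ENNReal.mul_inv (by simp) (by simp)]
  ring

lemma gnorm_maxFn_le {p : ℝ} (hp : 1 < p) {F : E d → ℝ≥0∞} (hF : Measurable F) :
    gnorm p (maxFn F) ≤ ENNReal.ofReal (p / (p - 1)) * gnorm p F := by
  unfold maxFn
  rw [gnorm_iSup (by linarith) (measurable_maxSeq hF) (monotone_maxSeq hF)]
  refine iSup_le fun k => ?_
  refine ((isMarkov_ouL (d := d) (t := ((2 : ℝ) ^ k)⁻¹) (by positivity)).maximal_le
    (measurable_avgL ((2 : ℝ) ^ k)⁻¹ hF) hp (4 ^ k)).trans ?_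
  gcongr
  exact gnorm_avgL_le hp.le (by positivity) hF

/-- The average over any interval `(0, N]` is at most twice the maximal function: `N` is rounded up
to a dyadic time which is at most `2 N`. -/
lemma lintegral_Ioc_ouL_le {F : E d → ℝ≥0∞} (hF : Measurable F) {N : ℝ} (hN : 0 < N) (x : E d) :
    ∫⁻ s in Ioc 0 N, ouL s F x ≤ ENNReal.ofReal (2 * N) * maxFn F x := by
  obtain ⟨k, hk⟩ : ∃ k : ℕ, N⁻¹ ≤ 2 ^ k ∧ 2 * N ≤ 2 ^ k := by
    obtain ⟨k, hk⟩ := pow_unbounded_of_one_lt (max N⁻¹ (2 * N)) (one_lt_two (α := ℝ))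
    exact ⟨k, (le_max_left _ _).trans hk.le, (le_max_right _ _).trans hk.le⟩
  set ε := ((2 : ℝ) ^ k)⁻¹ with hε
  have hεpos : 0 < ε := by positivity
  have h2 : (2 : ℝ) ^ k * ε = 1 := by rw [hε]; field_simp
  have hεN : ε ≤ N := by rw [hε]; exact inv_le_of_inv_le₀ hN hk.1
  set n := ⌈N * 2 ^ k⌉₊ with hn
  have hn1 : N ≤ n * ε := by
    have := Nat.le_ceil (N * 2 ^ k)
    calc N = N * 2 ^ k * ε := by rw [mul_assoc, h2, mul_one]
      _ ≤ n * ε := by gcongr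
  have hn2 : n * ε ≤ 2 * N := by
    have := (Nat.ceil_lt_add_one (a := N * 2 ^ k) (by positivity)).le
    calc n * ε ≤ (N * 2 ^ k + 1) * ε := by gcongr
      _ = N + ε := by rw [add_mul, mul_assoc, h2]; ring
      _ ≤ _ := by linarith
  have hn0 : n ≠ 0 := by
    rw [hn]; positivity
  have hn4 : n ≤ 4 ^ k := by
    have : (n : ℝ) ≤ 4 ^ k := by
      have h3 : (n : ℝ) * ε * 2 ^ k ≤ 2 * N * 2 ^ k := by gcongr
      rw [mul_assoc, mul_comm ε, h2, mul_one] at h3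
      refine h3.trans ?_
      rw [show (4 : ℝ) = 2 * 2 by norm_num, mul_pow]
      gcongr
      exact hk.2
    exact_mod_cast this
  have h3 := (le_maxSeq hF hn4 x).trans (le_iSup (fun k => maxSeq F k x) k)
  have h4 : ENNReal.ofReal ε ≠ 0 := by simpa using hεpos
  have h5 : (n : ℝ≥0∞) ≠ 0 := by simpa using hn0
  rw [ENNReal.div_le_iff h5 (by simp), ENNReal.div_le_iff h4 (by simp)] at h3
  calc _ ≤ ∫⁻ s in Ioc 0 (n * ε), ouL s F x := lintegral_mono_set (Ioc_subset_Ioc_right hn1)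
    _ ≤ _ := h3
    _ = ENNReal.ofReal (n * ε) * maxFn F x := by
      rw [ENNReal.ofReal_mul (by positivity), ENNReal.ofReal_natCast, maxFn]; ring
    _ ≤ _ := by gcongr

/-! ### The smoothing operators -/

/-- The subordination kernel `t (s + t²)^{-3/2}`, which dominates all time derivatives of the
kernel of the Poisson semigroup. -/
def kap (t s : ℝ) : ℝ := t * (s + t ^ 2) ^ (-(3 / 2) : ℝ)

lemma kap_nonneg {t s : ℝ} (ht : 0 ≤ t) (hs : 0 ≤ s) : 0 ≤ kap t s := by
  unfold kap; positivity

@[fun_prop]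
lemma measurable_kap : Measurable fun z : ℝ × ℝ => kap z.1 z.2 := by
  unfold kap; fun_prop

lemma lintegral_kap {t : ℝ} (ht : 0 < t) : ∫⁻ s in Ioi (0:ℝ), ENNReal.ofReal (kap t s) = 2 := by
  unfold kap
  simp_rw [ENNReal.ofReal_mul ht.le]
  rw [lintegral_const_mul _ (by fun_prop), lintegral_Ioi_add_rpow (by positivity) (by norm_num),
    ← ENNReal.ofReal_mul ht.le, zero_add]
  have : (t ^ 2) ^ (1 - 3 / 2 : ℝ) = t⁻¹ := by
    rw [← Real.rpow_natCast, ← Real.rpow_mul ht.le]; norm_num [Real.rpow_neg_one]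
  rw [this]
  have : t * (t⁻¹ / (3 / 2 - 1)) = 2 := by field_simp; norm_num
  rw [this]; simp

/-- The positive operator `∫_0^∞ t (s + t²)^{-3/2} T_s ds`. -/
def smoothL (t : ℝ) (F : E d → ℝ≥0∞) (x : E d) : ℝ≥0∞ :=
  ∫⁻ s in Ioi (0 : ℝ), ENNReal.ofReal (kap t s) * ouL s F x

/-- The kernel is a mixture of the uniform kernels of time averages, so that `smoothL t F` is
dominated by the ergodic maximal function. -/
lemma smoothL_le_maxFn {t : ℝ} (ht : 0 < t) {F : E d → ℝ≥0∞} (hF : Measurable F) (x : E d) :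
    smoothL t F x ≤ 6 * maxFn F x := by
  -- This is `kap t s = ∫_s^∞ (3/2) t (N + t²)^{-5/2} dN`.
  have h1 : ∀ s ∈ Ioi (0:ℝ), ENNReal.ofReal (kap t s) * ouL s F x = ∫⁻ N in Ioi (0:ℝ),
      (Iio N).indicator (fun s => ENNReal.ofReal (3 / 2 * t * (N + t ^ 2) ^ (-(5 / 2) : ℝ)) *
        ouL s F x) s := by
    intro s hs
    have hs' : (0:ℝ) < s := hs
    have : ∀ N : ℝ, (Iio N).indicator
        (fun s => ENNReal.ofReal (3 / 2 * t * (N + t ^ 2) ^ (-(5 / 2) : ℝ)) * ouL s F x) s =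
        (Ioi s).indicator (fun N => ENNReal.ofReal (3 / 2 * t) *
          (ENNReal.ofReal ((N + t ^ 2) ^ (-(5 / 2) : ℝ)) * ouL s F x)) N := by
      intro N
      by_cases h : s < N
      · rw [indicator_of_mem (by exact h), indicator_of_mem (by exact h),
          ENNReal.ofReal_mul (by positivity), mul_assoc]
      · rw [indicator_of_notMem (by exact h), indicator_of_notMem (by exact h)]
    simp_rw [this]
    rw [lintegral_indicator measurableSet_Ioi, Measure.restrict_restrict measurableSet_Ioi,
      inter_eq_left.2 (Ioi_subset_Ioi hs'.le), lintegral_const_mul _ (by fun_prop),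
      lintegral_mul_const _ (by fun_prop), lintegral_Ioi_add_rpow (by positivity) (by norm_num),
      ← mul_assoc, ← ENNReal.ofReal_mul (by positivity), kap]
    congr 2
    norm_num
    ring
  have hmeas : Measurable (Function.uncurry fun s N : ℝ => (Iio N).indicator
      (fun s => ENNReal.ofReal (3 / 2 * t * (N + t ^ 2) ^ (-(5 / 2) : ℝ)) * ouL s F x) s) := by
    have : (Function.uncurry fun s N : ℝ => (Iio N).indicator
      (fun s => ENNReal.ofReal (3 / 2 * t * (N + t ^ 2) ^ (-(5 / 2) : ℝ)) * ouL s F x) s) =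
      {z : ℝ × ℝ | z.1 < z.2}.indicator (fun z =>
        ENNReal.ofReal (3 / 2 * t * (z.2 + t ^ 2) ^ (-(5 / 2) : ℝ)) * ouL z.1 F x) := by
      funext z; rfl
    rw [this]
    refine Measurable.indicator ?_ (measurableSet_lt measurable_fst measurable_snd)
    exact (by fun_prop : Measurable fun z : ℝ × ℝ =>
      ENNReal.ofReal (3 / 2 * t * (z.2 + t ^ 2) ^ (-(5 / 2) : ℝ))).mul
      ((measurable_ouL_time hF x).comp measurable_fst)
  rw [smoothL, setLIntegral_congr_fun measurableSet_Ioi h1,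
    lintegral_lintegral_swap hmeas.aemeasurable]
  -- For fixed `N` the inner integral is `N` times a time average, and `N ≤ N + t²` makes the
  -- remaining integral over `N` that of `3 kap t N`, which is `6`.
  have h2 : ∀ N ∈ Ioi (0:ℝ), ∫⁻ s in Ioi (0:ℝ), (Iio N).indicator
      (fun s => ENNReal.ofReal (3 / 2 * t * (N + t ^ 2) ^ (-(5 / 2) : ℝ)) * ouL s F x) s ≤
      ENNReal.ofReal (3 * t) * (ENNReal.ofReal ((N + t ^ 2) ^ (-(3 / 2) : ℝ)) * maxFn F x) := by
    intro N hN
    have hN' : (0:ℝ) < N := hN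
    rw [lintegral_indicator measurableSet_Iio, Measure.restrict_restrict measurableSet_Iio,
      lintegral_const_mul _ (measurable_ouL_time hF x)]
    calc _ ≤ ENNReal.ofReal (3 / 2 * t * (N + t ^ 2) ^ (-(5 / 2) : ℝ)) *
          (ENNReal.ofReal (2 * N) * maxFn F x) := by
          gcongr
          refine (lintegral_mono_set fun s hs => ?_).trans (lintegral_Ioc_ouL_le hF hN' x)
          exact ⟨hs.2, (show s < N from hs.1).le⟩
      _ = ENNReal.ofReal (3 / 2 * t * (N + t ^ 2) ^ (-(5 / 2) : ℝ) * (2 * N)) * maxFn F x := by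
          rw [← mul_assoc, ← ENNReal.ofReal_mul (by positivity)]
      _ ≤ ENNReal.ofReal (3 * t * (N + t ^ 2) ^ (-(3 / 2) : ℝ)) * maxFn F x := by
          gcongr ENNReal.ofReal ?_ * _
          have : (N + t ^ 2) ^ (-(3 / 2) : ℝ) = (N + t ^ 2) ^ (-(5 / 2) : ℝ) * (N + t ^ 2) := by
            rw [← Real.rpow_add_one (by positivity)]; norm_num
          rw [this]
          have h0 : 0 ≤ (N + t ^ 2) ^ (-(5 / 2) : ℝ) := by positivity
          have : 3 * t * ((N + t ^ 2) ^ (-(5 / 2) : ℝ) * (N + t ^ 2)) =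
            3 / 2 * t * (N + t ^ 2) ^ (-(5 / 2) : ℝ) * (2 * N) +
            3 * t * ((N + t ^ 2) ^ (-(5 / 2) : ℝ) * t ^ 2) := by ring
          rw [this]
          have : 0 ≤ 3 * t * ((N + t ^ 2) ^ (-(5 / 2) : ℝ) * t ^ 2) := by positivity
          linarith
      _ = _ := by rw [ENNReal.ofReal_mul (by positivity), mul_assoc]
  refine (setLIntegral_mono' measurableSet_Ioi h2).trans (le_of_eq ?_)
  have h3 := lintegral_kap ht
  unfold kap at h3
  simp_rw [ENNReal.ofReal_mul ht.le] at h3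
  rw [lintegral_const_mul _ (by fun_prop)] at h3
  rw [lintegral_const_mul _ (by fun_prop), lintegral_mul_const _ (by fun_prop),
    ENNReal.ofReal_mul (by norm_num), ← mul_assoc, mul_assoc (ENNReal.ofReal 3), h3]
  norm_num

/-! ### The vector-valued inequality for the smoothing operators -/

lemma measurable_smoothL {X : Type*} [MeasurableSpace X] {a : X → ℝ} {x : X → E d}
    {F : X → E d → ℝ≥0∞} (ha : Measurable a) (hF : Measurable (Function.uncurry F))
    (hx : Measurable x) : Measurable fun z => smoothL (a z) (F z) (x z) := by
  unfold smoothL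
  refine Measurable.lintegral_prod_right'
    (f := fun w : X × ℝ => ENNReal.ofReal (kap (a w.1) w.2) * ouL w.2 (F w.1) (x w.1)) ?_
  refine Measurable.mul (f := fun w : X × ℝ => ENNReal.ofReal (kap (a w.1) w.2))
      (g := fun w : X × ℝ => ouL w.2 (F w.1) (x w.1)) ?_ ?_
  · exact (measurable_kap.comp ((ha.comp measurable_fst).prodMk measurable_snd)).ennreal_ofReal
  · refine measurable_ouL (F := fun w : X × ℝ => F w.1) measurable_snd ?_ (hx.comp measurable_fst)
    exact hF.comp ((measurable_fst.comp measurable_fst).prodMk measurable_snd)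

lemma measurable_smoothL_comp {X : Type*} [MeasurableSpace X] {a : X → ℝ} {x : X → E d}
    {F : E d → ℝ≥0∞} (ha : Measurable a) (hF : Measurable F)
    (hx : Measurable x) : Measurable fun z => smoothL (a z) F (x z) :=
  measurable_smoothL ha (F := fun _ => F) (hF.comp measurable_snd) hx

lemma smoothL_mono {t : ℝ} {F G : E d → ℝ≥0∞} (h : F ≤ G) (x : E d) :
    smoothL t F x ≤ smoothL t G x :=
  lintegral_mono fun _ => mul_le_mul_right (ouL_mono _ h x) _

lemma smoothL_const_mul (t : ℝ) {c : ℝ≥0∞} (hc : c ≠ ∞) (F : E d → ℝ≥0∞) (x : E d) :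
    smoothL t (fun y => c * F y) x = c * smoothL t F x := by
  unfold smoothL ouL
  simp_rw [lintegral_const_mul' _ _ hc]
  rw [← lintegral_const_mul' _ _ hc]
  refine lintegral_congr fun s => ?_
  ring

lemma measurable_kap_ofReal (t : ℝ) : Measurable fun s => ENNReal.ofReal (kap t s) :=
  (measurable_kap.comp (measurable_const.prodMk measurable_id)).ennreal_ofReal

/-- Symmetry of `smoothL t`, inherited from that of the semigroup. -/
lemma lintegral_mul_smoothL (t : ℝ) {F G : E d → ℝ≥0∞} (hF : Measurable F) (hG : Measurable G) :
    ∫⁻ x, G x * smoothL t F x ∂(gaussian d) = ∫⁻ x, F x * smoothL t G x ∂(gaussian d) := by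
  have key : ∀ {F G : E d → ℝ≥0∞}, Measurable F → Measurable G →
      ∫⁻ x, G x * smoothL t F x ∂(gaussian d) = ∫⁻ s in Ioi (0:ℝ), ENNReal.ofReal (kap t s) *
        ∫⁻ x, G x * ouL s F x ∂(gaussian d) := by
    intro F G hF hG
    have hm : Measurable (Function.uncurry fun (x : E d) (s : ℝ) =>
        G x * (ENNReal.ofReal (kap t s) * ouL s F x)) := by
      refine Measurable.mul (f := fun z : E d × ℝ => G z.1)
        (g := fun z : E d × ℝ => ENNReal.ofReal (kap t z.2) * ouL z.2 F z.1)
        (hG.comp measurable_fst) ?_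
      exact Measurable.mul (f := fun z : E d × ℝ => ENNReal.ofReal (kap t z.2))
        (g := fun z : E d × ℝ => ouL z.2 F z.1)
        ((measurable_kap_ofReal t).comp measurable_snd)
        (measurable_ouL_comp measurable_snd hF measurable_fst)
    have h1 : ∀ x, G x * smoothL t F x =
        ∫⁻ s in Ioi (0:ℝ), G x * (ENNReal.ofReal (kap t s) * ouL s F x) := by
      intro x
      exact (lintegral_const_mul _ ((measurable_kap_ofReal t).mul (measurable_ouL_time hF x))).symm
    simp_rw [h1]
    rw [lintegral_lintegral_swap hm.aemeasurable]
    refine lintegral_congr fun s => ?_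
    rw [← lintegral_const_mul' _ _ ENNReal.ofReal_ne_top]
    refine lintegral_congr fun x => ?_
    ring
  rw [key hF hG, key hG hF]
  refine setLIntegral_congr_fun measurableSet_Ioi fun s hs => ?_
  rw [lintegral_prod_mul_ouL (le_of_lt hs) hF hG]

lemma lintegral_smoothL {t : ℝ} (ht : 0 < t) {F : E d → ℝ≥0∞} (hF : Measurable F) :
    ∫⁻ x, smoothL t F x ∂(gaussian d) = 2 * ∫⁻ x, F x ∂(gaussian d) := by
  have := lintegral_mul_smoothL t hF (G := fun _ => 1) measurable_const
  simp only [one_mul] at this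
  rw [this]
  have h1 : ∀ x : E d, smoothL t (fun _ => 1) x = 2 := by
    intro x
    simp [smoothL, lintegral_kap ht]
  simp_rw [h1]
  rw [lintegral_mul_const _ hF, mul_comm]

/-- Hölder's inequality for the positive operator `smoothL t`. -/
lemma smoothL_mul_rpow_le (t : ℝ) {A B : E d → ℝ≥0∞} (hA : Measurable A) (hB : Measurable B)
    {a b : ℝ} (ha : 0 ≤ a) (hb : 0 ≤ b) (hab : a + b = 1) (x : E d) :
    smoothL t (fun y => A y ^ a * B y ^ b) x ≤ smoothL t A x ^ a * smoothL t B x ^ b := by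
  have h1 : ∀ s, ouL s (fun y => A y ^ a * B y ^ b) x ≤ ouL s A x ^ a * ouL s B x ^ b := by
    intro s
    have hm := measurable_mehlerPoint (d := d) (measurable_const (a := s)) measurable_id
      (measurable_const (a := x))
    exact ENNReal.lintegral_mul_norm_pow_le (hA.comp hm).aemeasurable (hB.comp hm).aemeasurable
      ha hb hab
  have h2 : ∀ s, ENNReal.ofReal (kap t s) * (ouL s A x ^ a * ouL s B x ^ b) =
      (ENNReal.ofReal (kap t s) * ouL s A x) ^ a * (ENNReal.ofReal (kap t s) * ouL s B x) ^ b := by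
    intro s
    rw [ENNReal.mul_rpow_of_nonneg _ _ ha, ENNReal.mul_rpow_of_nonneg _ _ hb, mul_mul_mul_comm,
      ← ENNReal.rpow_add_of_nonneg _ _ ha hb, hab, ENNReal.rpow_one]
  calc smoothL t (fun y => A y ^ a * B y ^ b) x
      ≤ ∫⁻ s in Ioi (0:ℝ), ENNReal.ofReal (kap t s) * (ouL s A x ^ a * ouL s B x ^ b) :=
        lintegral_mono fun s => mul_le_mul_right (h1 s) _
    _ ≤ _ := by
        simp_rw [h2]
        exact ENNReal.lintegral_mul_norm_pow_le
          ((measurable_kap_ofReal t).mul (measurable_ouL_time hA x)).aemeasurable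
          ((measurable_kap_ofReal t).mul (measurable_ouL_time hB x)).aemeasurable ha hb hab

/-- The norm of `L^p(γ_d)` is recovered by testing against functions of the dual space. -/
lemma gnorm_le_of_forall_lintegral_mul_le {p : ℝ} (hp : 1 < p) {a : E d → ℝ≥0∞}
    (ha : Measurable a) {K : ℝ≥0∞}
    (h : ∀ G : E d → ℝ≥0∞, Measurable G →
      ∫⁻ x, a x * G x ∂(gaussian d) ≤ K * gnorm p.conjExponent G) : gnorm p a ≤ K := by
  have hp0 : 0 < p := by linarith
  have hp1 : 0 < p - 1 := by linarith
  have hsup : ∀ x, a x = ⨆ n : ℕ, min (a x) n := by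
    intro x; rw [← inf_iSup_eq, ENNReal.iSup_natCast]; simp
  have e : gnorm p a = gnorm p fun x => ⨆ n : ℕ, min (a x) n := by
    congr 1; funext x; exact hsup x
  rw [e, gnorm_iSup hp0 (fun n => ha.min measurable_const) (fun m n hmn x => by
    simp only; gcongr)]
  refine iSup_le fun n => ?_
  -- The test function is `B ^ (p - 1)` for the truncation `B = min a n`, whose norm is finite, so
  -- that it can be cancelled.
  set B : E d → ℝ≥0∞ := fun x => min (a x) n with hB
  have hBn : ∀ x, B x ≤ n := fun x => min_le_right _ _
  have hBm : Measurable B := ha.min measurable_const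
  set I := ∫⁻ x, B x ^ p ∂(gaussian d) with hI
  have hIt : I ≠ ∞ := by
    refine ne_top_of_le_ne_top ?_ (lintegral_mono (g := fun _ => (n : ℝ≥0∞) ^ p)
      fun x => ENNReal.rpow_le_rpow (hBn x) hp0.le)
    simp [hp0.le]
  have hpq : (p - 1) * p.conjExponent = p := by
    rw [Real.conjExponent]; field_simp
  have hq : 1 / p.conjExponent = 1 - 1 / p := by
    rw [Real.conjExponent]; field_simp
  have h1 : I ≤ K * I ^ (1 - 1 / p) := by
    calc I ≤ ∫⁻ x, a x * B x ^ (p - 1) ∂(gaussian d) := by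
          refine lintegral_mono fun x => ?_
          have : B x ^ p = B x * B x ^ (p - 1) := by
            have := ENNReal.rpow_add_of_nonneg (x := B x) 1 (p - 1) zero_le_one hp1.le
            rw [ENNReal.rpow_one] at this
            rw [← this]; congr 1; ring
          rw [this]
          gcongr
          exact min_le_left _ _
      _ ≤ K * gnorm p.conjExponent (fun x => B x ^ (p - 1)) := h _ (hBm.pow_const _)
      _ = _ := by
          unfold gnorm
          simp_rw [← ENNReal.rpow_mul, hpq, hq]
          rw [hI]
  by_cases hI0 : I = 0
  · change I ^ (1 / p) ≤ K
    rw [hI0, ENNReal.zero_rpow_of_pos (by positivity)]; exact zero_le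
  · have : I = I ^ (1 / p) * I ^ (1 - 1 / p) := by
      rw [← ENNReal.rpow_add _ _ hI0 hIt]; simp
    nth_rw 1 [this] at h1
    have hfin : I ^ (1 - 1 / p) ≠ ∞ := ENNReal.rpow_ne_top_of_nonneg
      (by rw [sub_nonneg, div_le_one hp0]; exact hp.le) hIt
    have hne : I ^ (1 - 1 / p) ≠ 0 := by simp [ENNReal.rpow_eq_zero_iff, hI0, hIt]
    exact (ENNReal.mul_le_mul_iff_left hne hfin).1 h1

/-- The case `q = 1`, which is dual to the maximal theorem in `L^{p'}`. -/
lemma gnorm_lintegral_smoothL_le {p : ℝ} (hp : 1 < p) {ν : Measure ℝ} [SFinite ν]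
    (hν : ∀ᵐ t ∂ν, 0 < t) {A : ℝ → E d → ℝ≥0∞} (hA : Measurable (Function.uncurry A)) :
    gnorm p (fun x => ∫⁻ t, smoothL t (A t) x ∂ν) ≤
      ENNReal.ofReal (6 * p) * gnorm p (fun x => ∫⁻ t, A t x ∂ν) := by
  have hS : Measurable fun z : E d × ℝ => smoothL z.2 (A z.2) z.1 :=
    measurable_smoothL (F := fun z : E d × ℝ => A z.2) measurable_snd
      (hA.comp ((measurable_snd.comp measurable_fst).prodMk measurable_snd)) measurable_fst
  refine gnorm_le_of_forall_lintegral_mul_le hp (Measurable.lintegral_prod_right' hS)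
    fun G hG => ?_
  have hconj := Real.HolderConjugate.conjExponent hp
  have hpc : 1 < p.conjExponent := hconj.symm.lt
  have hAm : ∀ t, Measurable (A t) := fun t => hA.comp (measurable_const.prodMk measurable_id)
  have hAx : ∀ x, Measurable fun t => A t x := fun x => hA.comp (measurable_id.prodMk measurable_const)
  have hAs : Measurable fun z : E d × ℝ => A z.2 z.1 := hA.comp measurable_swap
  have hint : ∀ {H : E d → ℝ≥0∞} {Φ : E d → ℝ → ℝ≥0∞}, Measurable H →
      Measurable (Function.uncurry Φ) →
      ∫⁻ x, (∫⁻ t, Φ x t ∂ν) * H x ∂(gaussian d) = ∫⁻ t, ∫⁻ x, H x * Φ x t ∂(gaussian d) ∂ν := by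
    intro H Φ hH hΦ
    have hm : Measurable (Function.uncurry fun (t : ℝ) (x : E d) => H x * Φ x t) :=
      Measurable.mul (f := fun z : ℝ × E d => H z.2) (g := fun z : ℝ × E d => Φ z.2 z.1)
        (hH.comp measurable_snd) (hΦ.comp measurable_swap)
    rw [lintegral_lintegral_swap hm.aemeasurable]
    refine lintegral_congr fun x => ?_
    rw [mul_comm, lintegral_const_mul]
    exact hΦ.comp (measurable_const.prodMk measurable_id)
  calc ∫⁻ x, (∫⁻ t, smoothL t (A t) x ∂ν) * G x ∂(gaussian d)
      = ∫⁻ t, ∫⁻ x, G x * smoothL t (A t) x ∂(gaussian d) ∂ν := hint hG hS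
    _ ≤ ∫⁻ t, ∫⁻ x, (6 * maxFn G x) * A t x ∂(gaussian d) ∂ν := by
        refine lintegral_mono_ae ?_
        filter_upwards [hν] with t ht
        rw [lintegral_mul_smoothL t (hAm t) hG]
        refine lintegral_mono fun x => ?_
        rw [mul_comm]
        gcongr
        exact smoothL_le_maxFn ht hG x
    _ = ∫⁻ x, (∫⁻ t, A t x ∂ν) * (6 * maxFn G x) ∂(gaussian d) :=
        (hint (Φ := fun x t => A t x) ((measurable_maxFn hG).const_mul 6) hAs).symm
    _ ≤ gnorm p (fun x => ∫⁻ t, A t x ∂ν) * gnorm p.conjExponent (fun x => 6 * maxFn G x) :=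
        ENNReal.lintegral_mul_le_Lp_mul_Lq _ hconj
          (Measurable.lintegral_prod_right' hAs).aemeasurable
          ((measurable_maxFn hG).const_mul 6).aemeasurable
    _ ≤ gnorm p (fun x => ∫⁻ t, A t x ∂ν) * (ENNReal.ofReal (6 * p) * gnorm p.conjExponent G) := by
        gcongr
        rw [gnorm_const_mul (by linarith) 6 (by simp)]
        have h1 := gnorm_maxFn_le hpc hG
        have h2 : p.conjExponent / (p.conjExponent - 1) = p := by
          have : p - 1 ≠ 0 := by linarith
          rw [Real.conjExponent]; field_simp; ring
        rw [h2] at h1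
        rw [ENNReal.ofReal_mul (by norm_num), mul_assoc]
        simpa using mul_le_mul_right h1 6
    _ = _ := by ring

lemma gnorm_add_const_le {p : ℝ} (hp : 1 ≤ p) {F : E d → ℝ≥0∞} (hF : Measurable F) (c : ℝ≥0∞) :
    gnorm p (fun x => F x + c) ≤ gnorm p F + c := by
  have h := ENNReal.lintegral_Lp_add_le (μ := gaussian d) hF.aemeasurable
    (measurable_const (a := c)).aemeasurable hp
  refine h.trans (le_of_eq ?_)
  have hp0 : p ≠ 0 := by linarith
  simp only [gnorm, lintegral_const, measure_univ, mul_one]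
  rw [← ENNReal.rpow_mul, mul_one_div_cancel hp0, ENNReal.rpow_one]

/-- The operators `smoothL t` are bounded on `L^p(γ_d; L^q(ν))`. The function is factored as
`F = A^{1/q} H^{1 - 1/q}` with `H` comparable to the `L^q(ν)` norm of `F`, which reduces the claim
to the case `q = 1` for `A` and to the maximal theorem for `H`. -/
theorem gnorm_smoothL_le {p q : ℝ} (hp : 1 < p) (hq : 1 ≤ q) {ν : Measure ℝ} [SFinite ν]
    (hν : ∀ᵐ t ∂ν, 0 < t) {F : ℝ → E d → ℝ≥0∞} (hF : Measurable (Function.uncurry F)) :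
    gnorm p (fun x => (∫⁻ t, smoothL t (F t) x ^ q ∂ν) ^ (1 / q)) ≤
      ENNReal.ofReal (6 * (p + p / (p - 1))) *
        gnorm p (fun x => (∫⁻ t, F t x ^ q ∂ν) ^ (1 / q)) := by
  have hp0 : 0 < p := by linarith
  have hp1 : 0 < p - 1 := by linarith
  have hq0 : 0 < q := by linarith
  have ha : (0 : ℝ) ≤ 1 / q := by positivity
  have hb : 0 ≤ 1 - 1 / q := by rw [sub_nonneg, div_le_one hq0]; exact hq
  have hFs : Measurable fun z : E d × ℝ => F z.2 z.1 := hF.comp measurable_swap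
  set H₀ : E d → ℝ≥0∞ := fun x => (∫⁻ t, F t x ^ q ∂ν) ^ (1 / q) with hH₀
  have hH₀m : Measurable H₀ :=
    (Measurable.lintegral_prod_right' (f := fun z : E d × ℝ => F z.2 z.1 ^ q)
      (hFs.pow_const _)).pow_const _
  set C := ENNReal.ofReal (6 * (p + p / (p - 1))) with hC
  -- The constant `δ` keeps `H = H₀ + δ` away from zero, where the negative power `H ^ (1 - q)`
  -- would be infinite.
  suffices key : ∀ δ : ℝ≥0∞, 0 < δ → δ ≠ ∞ →
      gnorm p (fun x => (∫⁻ t, smoothL t (F t) x ^ q ∂ν) ^ (1 / q)) ≤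
        C * gnorm p (fun x => H₀ x + δ) by
    refine ENNReal.le_of_forall_pos_le_add fun ε hε _ => ?_
    have hC0 : C ≠ 0 := by
      have : 0 < 6 * (p + p / (p - 1)) := by positivity
      simpa [hC] using this
    have hδ : 0 < (ε : ℝ≥0∞) / C :=
      ENNReal.div_pos (by exact_mod_cast hε.ne') ENNReal.ofReal_ne_top
    refine (key _ hδ (ENNReal.div_ne_top ENNReal.coe_ne_top hC0)).trans ?_
    refine (mul_le_mul_right (gnorm_add_const_le hp.le hH₀m _) C).trans (le_of_eq ?_)
    rw [mul_add, ENNReal.mul_div_cancel hC0 ENNReal.ofReal_ne_top]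
  intro δ hδ hδt
  set H : E d → ℝ≥0∞ := fun x => H₀ x + δ with hH
  have hHm : Measurable H := hH₀m.add measurable_const
  have hH0 : ∀ x, H x ≠ 0 := fun x => (hδ.trans_le le_add_self).ne'
  -- Where `H = ∞` the product `F ^ q * H ^ (1 - q)` could vanish, so that `A` is set to `∞` there.
  set A : ℝ → E d → ℝ≥0∞ := fun t x => if H x = ∞ then ∞ else F t x ^ q * H x ^ (1 - q) with hA
  have hAm : Measurable (Function.uncurry A) := by
    refine Measurable.ite ?_ measurable_const ?_
    · exact (hHm.comp measurable_snd) (measurableSet_singleton ∞)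
    · exact (hF.pow_const q).mul ((hHm.comp measurable_snd).pow_const (1 - q))
  have hfac : ∀ t x, F t x ≤ A t x ^ (1 / q) * H x ^ (1 - 1 / q) := by
    intro t x
    by_cases hx : H x = ∞
    · have : A t x = ∞ := if_pos hx
      rw [this, hx, ENNReal.top_rpow_of_pos (by positivity), ENNReal.top_mul]
      · exact le_top
      · rcases hb.lt_or_eq with h | h
        · rw [ENNReal.top_rpow_of_pos h]; simp
        · rw [← h]; simp
    · have : A t x = F t x ^ q * H x ^ (1 - q) := if_neg hx
      rw [this, ENNReal.mul_rpow_of_nonneg _ _ ha, ← ENNReal.rpow_mul, ← ENNReal.rpow_mul,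
        mul_one_div_cancel hq0.ne', ENNReal.rpow_one, mul_assoc, ← ENNReal.rpow_add _ _ (hH0 x) hx]
      have : (1 - q) * (1 / q) + (1 - 1 / q) = 0 := by field_simp; ring
      rw [this, ENNReal.rpow_zero, mul_one]
  have hAH : ∀ x, ∫⁻ t, A t x ∂ν ≤ H x := by
    intro x
    by_cases hx : H x = ∞
    · rw [hx]; exact le_top
    · have h1 : ∀ t, A t x = F t x ^ q * H x ^ (1 - q) := fun t => if_neg hx
      have h2 : H x ^ (1 - q) ≠ ∞ := by
        simp [ENNReal.rpow_eq_top_iff, hx, hH0 x]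
      simp_rw [h1]
      rw [lintegral_mul_const' _ _ h2]
      have h3 : ∫⁻ t, F t x ^ q ∂ν = H₀ x ^ q := by
        rw [hH₀]; simp only
        rw [← ENNReal.rpow_mul, one_div_mul_cancel hq0.ne', ENNReal.rpow_one]
      rw [h3]
      calc H₀ x ^ q * H x ^ (1 - q) ≤ H x ^ q * H x ^ (1 - q) := by
            gcongr; exact le_self_add
        _ = H x := by rw [← ENNReal.rpow_add _ _ (hH0 x) hx]; simp
  have hAmt : ∀ t, Measurable (A t) := fun t => hAm.comp (measurable_const.prodMk measurable_id)
  set a : E d → ℝ≥0∞ := fun x => ∫⁻ t, smoothL t (A t) x ∂ν with ha'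
  set b : E d → ℝ≥0∞ := fun x => 6 * maxFn H x with hb'
  have ham : Measurable a := Measurable.lintegral_prod_right'
    (f := fun z : E d × ℝ => smoothL z.2 (A z.2) z.1)
    (measurable_smoothL (F := fun z : E d × ℝ => A z.2) measurable_snd
      (hAm.comp ((measurable_snd.comp measurable_fst).prodMk measurable_snd)) measurable_fst)
  have hbm : Measurable b := (measurable_maxFn hHm).const_mul 6
  -- Hölder for `smoothL t`, with the maximal function of `H` dominating `smoothL t H` for all `t`.
  have hpt : ∀ x, (∫⁻ t, smoothL t (F t) x ^ q ∂ν) ^ (1 / q) ≤ a x ^ (1 / q) * b x ^ (1 - 1 / q) := by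
    intro x
    have hmA : Measurable fun t => smoothL t (A t) x :=
      measurable_smoothL (F := A) measurable_id hAm measurable_const
    have h1 : ∫⁻ t, smoothL t (F t) x ^ q ∂ν ≤ ∫⁻ t, smoothL t (A t) x * b x ^ (q - 1) ∂ν := by
      refine lintegral_mono_ae ?_
      filter_upwards [hν] with t ht
      have h2 : smoothL t (F t) x ≤ smoothL t (A t) x ^ (1 / q) * b x ^ (1 - 1 / q) := by
        refine (smoothL_mono (hfac t) x).trans ((smoothL_mul_rpow_le t (hAmt t) hHm ha hb
          (by ring) x).trans ?_)
        gcongr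
        exact smoothL_le_maxFn ht hHm x
      refine (ENNReal.rpow_le_rpow h2 hq0.le).trans (le_of_eq ?_)
      rw [ENNReal.mul_rpow_of_nonneg _ _ hq0.le, ← ENNReal.rpow_mul, ← ENNReal.rpow_mul,
        one_div_mul_cancel hq0.ne', ENNReal.rpow_one, sub_mul, one_div_mul_cancel hq0.ne', one_mul]
    rw [lintegral_mul_const _ hmA] at h1
    refine (ENNReal.rpow_le_rpow h1 ha).trans (le_of_eq ?_)
    rw [ENNReal.mul_rpow_of_nonneg _ _ ha, ← ENNReal.rpow_mul]
    congr 2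
    field_simp
  have hna : gnorm p a ≤ C * gnorm p H := by
    refine (gnorm_lintegral_smoothL_le hp hν hAm).trans ?_
    refine mul_le_mul' (ENNReal.ofReal_le_ofReal ?_) (gnorm_mono hp0 (ae_of_all _ hAH))
    have : 0 ≤ p / (p - 1) := by positivity
    linarith
  have hnb : gnorm p b ≤ C * gnorm p H := by
    rw [hb', gnorm_const_mul hp0 6 (by simp)]
    refine (mul_le_mul_right (gnorm_maxFn_le hp hHm) 6).trans ?_
    rw [← mul_assoc]
    refine mul_le_mul' ?_ le_rfl
    rw [← ENNReal.ofReal_ofNat, ← ENNReal.ofReal_mul (by norm_num)]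
    refine ENNReal.ofReal_le_ofReal ?_
    linarith
  calc gnorm p (fun x => (∫⁻ t, smoothL t (F t) x ^ q ∂ν) ^ (1 / q))
      ≤ gnorm p (fun x => a x ^ (1 / q) * b x ^ (1 - 1 / q)) := gnorm_mono hp0 (ae_of_all _ hpt)
    _ ≤ gnorm p a ^ (1 / q) * gnorm p b ^ (1 - 1 / q) := by
        unfold gnorm
        rw [← ENNReal.rpow_mul, ← ENNReal.rpow_mul, mul_comm (1 / p), mul_comm (1 / p),
          ENNReal.rpow_mul, ENNReal.rpow_mul, ← ENNReal.mul_rpow_of_nonneg _ _ (by positivity)]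
        refine ENNReal.rpow_le_rpow ?_ (by positivity)
        have h1 : ∀ x, (a x ^ (1 / q) * b x ^ (1 - 1 / q)) ^ p =
            (a x ^ p) ^ (1 / q) * (b x ^ p) ^ (1 - 1 / q) := by
          intro x
          rw [ENNReal.mul_rpow_of_nonneg _ _ hp0.le, ← ENNReal.rpow_mul, ← ENNReal.rpow_mul,
            ← ENNReal.rpow_mul, ← ENNReal.rpow_mul, mul_comm p, mul_comm p]
        simp_rw [h1]
        exact ENNReal.lintegral_mul_norm_pow_le (ham.pow_const _).aemeasurable
          (hbm.pow_const _).aemeasurable ha hb (by ring)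
    _ ≤ (C * gnorm p H) ^ (1 / q) * (C * gnorm p H) ^ (1 - 1 / q) := by gcongr
    _ = C * gnorm p H := by
        rw [← ENNReal.rpow_add_of_nonneg _ _ ha hb]; simp

/-! ### Hermite polynomials -/

open Polynomial in
/-- The physicists' Hermite polynomials in one variable. -/
def hermitePoly : ℕ → ℝ[X]
  | 0 => 1
  | n + 1 => 2 * X * hermitePoly n - derivative (hermitePoly n)

open Polynomial in
lemma derivative_hermitePoly (n : ℕ) :
    derivative (hermitePoly (n + 1)) = C (2 * ((n : ℝ) + 1)) * hermitePoly n := by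
  induction n with
  | zero => simp [hermitePoly, ← C_ofNat]
  | succ n ih =>
    have h2 : derivative (derivative (hermitePoly (n + 1))) =
        C (2 * ((n : ℝ) + 1)) * derivative (hermitePoly n) := by rw [ih, derivative_C_mul]
    rw [hermitePoly, derivative_sub, h2, derivative_mul, derivative_mul, ih]
    simp only [derivative_X, derivative_ofNat]
    rw [hermitePoly]
    simp only [map_mul, map_add, map_natCast, map_one, Nat.cast_succ, C_ofNat]
    ring

open Polynomial in
lemma hermitePoly_succ_succ (n : ℕ) (y : ℝ) : (hermitePoly (n + 2)).eval y =
    2 * y * (hermitePoly (n + 1)).eval y - 2 * ((n : ℝ) + 1) * (hermitePoly n).eval y := by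
  rw [hermitePoly, derivative_hermitePoly]
  simp

lemma iteratedDeriv_exp_neg_sq (n : ℕ) : iteratedDeriv n (fun s : ℝ => Real.exp (-s ^ 2)) =
    fun s => (-1) ^ n * (hermitePoly n).eval s * Real.exp (-s ^ 2) := by
  induction n with
  | zero => simp [hermitePoly]
  | succ n ih =>
    rw [iteratedDeriv_succ, ih]
    funext s
    have h1 : HasDerivAt (fun s : ℝ => Real.exp (-s ^ 2)) (Real.exp (-s ^ 2) * -(2 * s)) s := by
      simpa using ((hasDerivAt_pow 2 s).neg).exp
    have h2 := (((hermitePoly n).hasDerivAt s).const_mul ((-1 : ℝ) ^ n)).mul h1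
    have h3 := h2.deriv
    rw [show (fun s => (-1 : ℝ) ^ n * (hermitePoly n).eval s * Real.exp (-s ^ 2)) =
      (fun y => (-1 : ℝ) ^ n * (hermitePoly n).eval y) * fun s : ℝ => Real.exp (-s ^ 2) from rfl, h3,
      hermitePoly]
    simp only [Polynomial.eval_sub, Polynomial.eval_mul, Polynomial.eval_ofNat, Polynomial.eval_X]
    ring

/-- Polynomials grow more slowly than any `e^{ε y²}`. -/
lemma exists_abs_eval_le (P : Polynomial ℝ) {ε : ℝ} (hε : 0 < ε) :
    ∃ C : ℝ, 0 ≤ C ∧ ∀ y : ℝ, |P.eval y| ≤ C * Real.exp (ε * y ^ 2) := by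
  induction P using Polynomial.induction_on' with
  | add P Q hP hQ =>
    obtain ⟨C, hC, h1⟩ := hP
    obtain ⟨D, hD, h2⟩ := hQ
    refine ⟨C + D, by positivity, fun y => ?_⟩
    rw [Polynomial.eval_add, add_mul]
    exact (abs_add_le _ _).trans (add_le_add (h1 y) (h2 y))
  | monomial n a =>
    refine ⟨|a| * (1 + n.factorial / ε ^ n), by positivity, fun y => ?_⟩
    rw [Polynomial.eval_monomial, abs_mul, mul_assoc]
    gcongr
    have h1 : |y ^ n| ≤ 1 + (y ^ 2) ^ n := by
      rw [← pow_mul, mul_comm 2 n, pow_mul, ← sq_abs (y ^ n)]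
      nlinarith [sq_nonneg (|y ^ n| - 1)]
    have h2 := Real.pow_div_factorial_le_exp (ε * y ^ 2) (by positivity) n
    rw [div_le_iff₀ (by positivity), mul_pow] at h2
    have h3 : (y ^ 2) ^ n ≤ n.factorial / ε ^ n * Real.exp (ε * y ^ 2) := by
      rw [div_mul_eq_mul_div, le_div_iff₀ (by positivity)]
      linarith
    have h4 : 1 ≤ Real.exp (ε * y ^ 2) := Real.one_le_exp (by positivity)
    linarith

lemma integrable_eval_mul_exp (P : Polynomial ℝ) :
    Integrable fun u : ℝ => P.eval u * Real.exp (-u ^ 2) := by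
  obtain ⟨C, hC, h⟩ := exists_abs_eval_le P (ε := 1 / 2) (by norm_num)
  refine ((integrable_exp_neg_mul_sq (b := 1 / 2) (by norm_num)).const_mul C).mono'
    (by fun_prop) (ae_of_all _ fun u => ?_)
  rw [Real.norm_eq_abs, abs_mul, Real.abs_exp]
  calc _ ≤ C * Real.exp (1 / 2 * u ^ 2) * Real.exp (-u ^ 2) := by gcongr; exact h u
    _ = _ := by rw [mul_assoc, ← Real.exp_add]; ring_nf

/-- Gaussian integration by parts. -/
lemma integral_two_mul_eval_mul_exp (Q : Polynomial ℝ) :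
    ∫ u : ℝ, 2 * u * Q.eval u * Real.exp (-u ^ 2) =
      ∫ u : ℝ, (Polynomial.derivative Q).eval u * Real.exp (-u ^ 2) := by
  have h2 : ∀ u : ℝ, HasDerivAt (fun u => Q.eval u * Real.exp (-u ^ 2))
      ((Polynomial.derivative Q).eval u * Real.exp (-u ^ 2) - 2 * u * Q.eval u * Real.exp (-u ^ 2))
      u := by
    intro u
    have h1 : HasDerivAt (fun s : ℝ => Real.exp (-s ^ 2)) (Real.exp (-u ^ 2) * -(2 * u)) u := by
      simpa using ((hasDerivAt_pow 2 u).neg).exp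
    refine ((Q.hasDerivAt u).mul h1).congr_deriv ?_
    ring
  have i1 := integrable_eval_mul_exp (Polynomial.derivative Q)
  have i2 : Integrable fun u : ℝ => 2 * u * Q.eval u * Real.exp (-u ^ 2) := by
    refine (integrable_eval_mul_exp (2 * Polynomial.X * Q)).congr (ae_of_all _ fun u => ?_)
    simp only [Polynomial.eval_mul, Polynomial.eval_ofNat, Polynomial.eval_X]
  have h3 := integral_eq_zero_of_hasDerivAt_of_integrable h2 (i1.sub i2) (integrable_eval_mul_exp Q)
  rw [integral_sub i1 i2] at h3
  linarith

/-- Mehler's formula on Hermite polynomials in one variable. -/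
lemma integral_hermitePoly {r s : ℝ} (hrs : r ^ 2 + s ^ 2 = 1) (n : ℕ) (x : ℝ) :
    ∫ u : ℝ, (hermitePoly n).eval (s * u + r * x) * Real.exp (-u ^ 2) =
      r ^ n * (hermitePoly n).eval x * Real.sqrt Real.pi := by
  have h0 : ∫ u : ℝ, Real.exp (-u ^ 2) = Real.sqrt Real.pi := by
    simpa using _root_.integral_gaussian 1
  have hcomp : ∀ (P : Polynomial ℝ) (u : ℝ),
      P.eval (s * u + r * x) =
        (P.comp (Polynomial.C s * Polynomial.X + Polynomial.C (r * x))).eval u := by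
    intro P u; simp
  have hint : ∀ P : Polynomial ℝ,
      Integrable fun u : ℝ => P.eval (s * u + r * x) * Real.exp (-u ^ 2) := by
    intro P
    simp_rw [hcomp P]
    exact integrable_eval_mul_exp _
  have hibp : ∀ P : Polynomial ℝ, ∫ u : ℝ, 2 * u * P.eval (s * u + r * x) * Real.exp (-u ^ 2) =
      s * ∫ u : ℝ, (Polynomial.derivative P).eval (s * u + r * x) * Real.exp (-u ^ 2) := by
    intro P
    simp_rw [hcomp P]
    rw [integral_two_mul_eval_mul_exp, ← integral_const_mul]
    congr with u
    rw [Polynomial.derivative_comp]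
    simp
    ring
  have hint2 : ∀ P : Polynomial ℝ,
      Integrable fun u : ℝ => 2 * u * P.eval (s * u + r * x) * Real.exp (-u ^ 2) := by
    intro P
    simp_rw [hcomp P]
    refine (integrable_eval_mul_exp (2 * Polynomial.X *
      P.comp (Polynomial.C s * Polynomial.X + Polynomial.C (r * x)))).congr
      (ae_of_all _ fun u => ?_)
    simp only [Polynomial.eval_mul, Polynomial.eval_ofNat, Polynomial.eval_X]
  -- The three-term recurrence at `s u + r x` yields a term with the factor `u`, which integration
  -- by parts turns into a derivative, that is, into the Hermite polynomial of the preceding degree.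
  induction n using Nat.strong_induction_on with
  | _ n ih =>
    match n with
    | 0 => simp [hermitePoly, h0]
    | 1 =>
      have e : ∀ u : ℝ, (hermitePoly 1).eval (s * u + r * x) * Real.exp (-u ^ 2) =
          s * (2 * u * (1 : Polynomial ℝ).eval (s * u + r * x) * Real.exp (-u ^ 2)) +
          2 * r * x * ((1 : Polynomial ℝ).eval (s * u + r * x) * Real.exp (-u ^ 2)) := by
        intro u; simp [hermitePoly]; ring
      simp_rw [e]
      rw [integral_add ((hint2 1).const_mul _) ((hint 1).const_mul _), integral_const_mul,
        integral_const_mul, hibp]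
      simp only [Polynomial.derivative_one, Polynomial.eval_zero, Polynomial.eval_one, zero_mul,
        one_mul, integral_zero, h0]
      simp only [hermitePoly, Polynomial.derivative_one, sub_zero, mul_one, Polynomial.eval_mul,
        Polynomial.eval_ofNat, Polynomial.eval_X]
      ring
    | n + 2 =>
      have e : ∀ u : ℝ, (hermitePoly (n + 2)).eval (s * u + r * x) * Real.exp (-u ^ 2) =
          s * (2 * u * (hermitePoly (n + 1)).eval (s * u + r * x) * Real.exp (-u ^ 2)) +
          2 * r * x * ((hermitePoly (n + 1)).eval (s * u + r * x) * Real.exp (-u ^ 2)) -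
          2 * (n + 1) * ((hermitePoly n).eval (s * u + r * x) * Real.exp (-u ^ 2)) := by
        intro u; rw [hermitePoly_succ_succ]; ring
      have i1 := (hint2 (hermitePoly (n + 1))).const_mul s
      have i2 := (hint (hermitePoly (n + 1))).const_mul (2 * r * x)
      have i12 : Integrable fun u : ℝ =>
          s * (2 * u * (hermitePoly (n + 1)).eval (s * u + r * x) * Real.exp (-u ^ 2)) +
          2 * r * x * ((hermitePoly (n + 1)).eval (s * u + r * x) * Real.exp (-u ^ 2)) := i1.add i2
      simp_rw [e]
      rw [integral_sub i12 ((hint _).const_mul _), integral_add i1 i2, integral_const_mul,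
        integral_const_mul, integral_const_mul, hibp, ih (n + 1) (by omega), ih n (by omega),
        derivative_hermitePoly, hermitePoly_succ_succ]
      have e2 : ∀ u : ℝ, (Polynomial.C (2 * ((n : ℝ) + 1)) * hermitePoly n).eval (s * u + r * x) *
          Real.exp (-u ^ 2) = 2 * ((n : ℝ) + 1) * ((hermitePoly n).eval (s * u + r * x) *
          Real.exp (-u ^ 2)) := by
        intro u; simp; ring
      simp_rw [e2]
      rw [integral_const_mul, ih n (by omega)]
      have hs : s ^ 2 = 1 - r ^ 2 := by linarith
      have : s * (s * (2 * ((n : ℝ) + 1) * (r ^ n * (hermitePoly n).eval x * Real.sqrt Real.pi))) =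
        s ^ 2 * (2 * ((n : ℝ) + 1) * (r ^ n * (hermitePoly n).eval x * Real.sqrt Real.pi)) := by ring
      rw [this, hs]
      ring

/-- The product `∏ᵢ H_{νᵢ}(xᵢ)` of unnormalized Hermite polynomials. -/
def prodHermite (ν : Fin d → ℕ) (x : E d) : ℝ := ∏ i, (hermitePoly (ν i)).eval (x i)

/-- The normalizing constant of `hermite ν`. -/
def hermiteConst (ν : Fin d → ℕ) : ℝ :=
  1 / Real.sqrt (2 ^ (∑ i, ν i) * ∏ i, ((ν i).factorial : ℝ))

lemma hermiteConst_ne_zero (ν : Fin d → ℕ) : hermiteConst ν ≠ 0 := by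
  have : 0 < ∏ i, ((ν i).factorial : ℝ) := Finset.prod_pos fun i _ => by positivity
  unfold hermiteConst
  positivity

lemma hermite_eq (ν : Fin d → ℕ) (x : E d) : hermite ν x = hermiteConst ν * prodHermite ν x := by
  rw [hermite, hermiteConst, prodHermite]
  congr 1
  refine Finset.prod_congr rfl fun i _ => ?_
  rw [iteratedDeriv_exp_neg_sq]
  have h1 : ((-1 : ℝ) ^ ν i) * (-1) ^ ν i = 1 := by rw [← mul_pow]; simp
  have h2 : Real.exp ((x i) ^ 2) * Real.exp (-(x i) ^ 2) = 1 := by rw [← Real.exp_add]; simp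
  linear_combination ((hermitePoly (ν i)).eval (x i) * Real.exp ((x i) ^ 2) *
    Real.exp (-(x i) ^ 2)) * h1 + (hermitePoly (ν i)).eval (x i) * h2

lemma integral_gaussian_prod (g : Fin d → ℝ → ℝ) :
    ∫ u : E d, ∏ i, g i (u i) ∂(gaussian d) =
      ∏ i, ((∫ u : ℝ, g i u * Real.exp (-u ^ 2)) / Real.sqrt Real.pi) := by
  rw [integral_gaussian, ← (PiLp.volume_preserving_toLp (Fin d)).integral_comp
    (MeasurableEquiv.toLp 2 (Fin d → ℝ)).measurableEmbedding]
  have h1 : ∀ y : Fin d → ℝ, (Real.exp (-‖WithLp.toLp 2 y‖ ^ 2) / Real.pi ^ ((d : ℝ) / 2)) •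
      ∏ i, g i ((WithLp.toLp 2 y : E d) i) =
      (∏ i, g i (y i) * Real.exp (-(y i) ^ 2)) / Real.pi ^ ((d : ℝ) / 2) := by
    intro y
    rw [EuclideanSpace.norm_sq_eq, ← Finset.sum_neg_distrib, Real.exp_sum, Finset.prod_mul_distrib]
    simp only [Real.norm_eq_abs, sq_abs, smul_eq_mul]
    ring
  simp_rw [h1]
  rw [integral_div, integral_fintype_prod_volume_eq_prod (f := fun i u => g i u * Real.exp (-u ^ 2)),
    Finset.prod_div_distrib]
  congr 1
  rw [Finset.prod_const, Finset.card_univ, Fintype.card_fin, Real.sqrt_eq_rpow, ← Real.rpow_natCast,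
    ← Real.rpow_mul Real.pi_pos.le]
  congr 1; ring

/-- Hermite polynomials are eigenfunctions of the Ornstein–Uhlenbeck semigroup. -/
lemma ornsteinUhlenbeck_hermite {t : ℝ} (ht : 0 ≤ t) (ν : Fin d → ℕ) (x : E d) :
    ornsteinUhlenbeck t (hermite ν) x = Real.exp (-((∑ i, ν i : ℕ) : ℝ) * t) * hermite ν x := by
  unfold ornsteinUhlenbeck
  simp_rw [hermite_eq]
  rw [integral_const_mul, mul_left_comm]
  congr 1
  have := integral_gaussian_prod (d := d) fun i u => (hermitePoly (ν i)).eval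
    (Real.sqrt (1 - Real.exp (-2 * t)) * u + Real.exp (-t) * x i)
  have e : ∀ u : E d, prodHermite ν
      (Real.sqrt (1 - Real.exp (-2 * t)) • u + Real.exp (-t) • x) =
      ∏ i, (hermitePoly (ν i)).eval
        (Real.sqrt (1 - Real.exp (-2 * t)) * u i + Real.exp (-t) * x i) := by
    intro u; simp [prodHermite]
  simp_rw [e]
  rw [this]
  have h3 : ∀ i, (∫ u : ℝ, (hermitePoly (ν i)).eval
      (Real.sqrt (1 - Real.exp (-2 * t)) * u + Real.exp (-t) * x i) * Real.exp (-u ^ 2)) /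
      Real.sqrt Real.pi = Real.exp (-t) ^ ν i * (hermitePoly (ν i)).eval (x i) := by
    intro i
    rw [integral_hermitePoly (mehler_sq_add_sq ht), mul_div_assoc, div_self (by positivity), mul_one]
  simp_rw [h3]
  rw [Finset.prod_mul_distrib, Finset.prod_pow_eq_pow_sum, prodHermite, ← Real.exp_nat_mul]
  congr 2
  ring

lemma continuous_hermite (ν : Fin d → ℕ) : Continuous (hermite (d := d) ν) := by
  have : hermite (d := d) ν = fun x => hermiteConst ν * prodHermite ν x := funext (hermite_eq ν)
  rw [this]
  unfold prodHermite
  fun_prop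

/-- Functions which grow more slowly than any `e^{ε ‖x‖²}`. -/
def SubGaussian (g : E d → ℝ) : Prop :=
  ∀ ε : ℝ, 0 < ε → ∃ C : ℝ, 0 ≤ C ∧ ∀ x, |g x| ≤ C * Real.exp (ε * ‖x‖ ^ 2)

lemma SubGaussian.mul {f g : E d → ℝ} (hf : SubGaussian f) (hg : SubGaussian g) :
    SubGaussian fun x => f x * g x := by
  intro ε hε
  obtain ⟨C, hC, h1⟩ := hf (ε / 2) (by positivity)
  obtain ⟨D, hD, h2⟩ := hg (ε / 2) (by positivity)
  refine ⟨C * D, by positivity, fun x => ?_⟩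
  rw [abs_mul]
  calc |f x| * |g x| ≤ (C * Real.exp (ε / 2 * ‖x‖ ^ 2)) * (D * Real.exp (ε / 2 * ‖x‖ ^ 2)) :=
        mul_le_mul (h1 x) (h2 x) (abs_nonneg _) (by positivity)
    _ = C * D * Real.exp (ε * ‖x‖ ^ 2) := by
        rw [mul_mul_mul_comm, ← Real.exp_add]; ring_nf

lemma SubGaussian.add {f g : E d → ℝ} (hf : SubGaussian f) (hg : SubGaussian g) :
    SubGaussian fun x => f x + g x := by
  intro ε hε
  obtain ⟨C, hC, h1⟩ := hf ε hε
  obtain ⟨D, hD, h2⟩ := hg ε hε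
  refine ⟨C + D, by positivity, fun x => ?_⟩
  rw [add_mul]
  exact (abs_add_le _ _).trans (add_le_add (h1 x) (h2 x))

lemma subGaussian_of_bounded {f : E d → ℝ} {M : ℝ} (hM : ∀ x, |f x| ≤ M) : SubGaussian f := by
  intro ε hε
  have h0 : 0 ≤ M := (abs_nonneg _).trans (hM 0)
  refine ⟨M, h0, fun x => (hM x).trans ?_⟩
  have : 1 ≤ Real.exp (ε * ‖x‖ ^ 2) := Real.one_le_exp (by positivity)
  nlinarith

lemma subGaussian_exp_coord (c : ℝ) (i : Fin d) :
    SubGaussian fun x : E d => Real.exp (c * |x i|) := by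
  intro ε hε
  refine ⟨Real.exp (c ^ 2 / (4 * ε)), by positivity, fun x => ?_⟩
  rw [Real.abs_exp, ← Real.exp_add, Real.exp_le_exp]
  have h1 : |x i| ≤ ‖x‖ := PiLp.norm_apply_le x i
  have h2 : |x i| ^ 2 ≤ ‖x‖ ^ 2 := by gcongr
  have h3 : 0 ≤ ε * (|x i| - c / (2 * ε)) ^ 2 := by positivity
  have h4 : ε * (|x i| - c / (2 * ε)) ^ 2 = ε * |x i| ^ 2 - c * |x i| + c ^ 2 / (4 * ε) := by
    field_simp; ring
  nlinarith

lemma subGaussian_eval_coord (P : Polynomial ℝ) (i : Fin d) :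
    SubGaussian fun x : E d => P.eval (x i) := by
  intro ε hε
  obtain ⟨C, hC, h⟩ := exists_abs_eval_le P hε
  refine ⟨C, hC, fun x => (h _).trans ?_⟩
  have h1 : |x i| ≤ ‖x‖ := PiLp.norm_apply_le x i
  have h2 : x i ^ 2 ≤ ‖x‖ ^ 2 := by rw [← sq_abs]; gcongr
  gcongr

lemma subGaussian_hermite (ν : Fin d → ℕ) : SubGaussian (hermite (d := d) ν) := by
  have : hermite (d := d) ν = fun x => hermiteConst ν * prodHermite ν x := funext (hermite_eq ν)
  rw [this]
  refine (subGaussian_of_bounded (M := |hermiteConst ν|) fun _ => le_rfl).mul ?_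
  unfold prodHermite
  have : ∀ s : Finset (Fin d), SubGaussian fun x : E d => ∏ i ∈ s, (hermitePoly (ν i)).eval (x i) := by
    intro s
    induction s using Finset.induction_on with
    | empty => simpa using subGaussian_of_bounded (M := |(1 : ℝ)|) fun _ => le_rfl
    | insert a s ha ih =>
      simp_rw [Finset.prod_insert ha]
      exact (subGaussian_eval_coord _ a).mul ih
  exact this _

lemma memLp_exp_sq {p : ℝ≥0∞} (hp0 : p ≠ 0) (hp : p ≠ ∞) :
    MemLp (fun x : E d => Real.exp (1 / (2 * p.toReal) * ‖x‖ ^ 2)) p (gaussian d) := by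
  have h0 : 0 < p.toReal := ENNReal.toReal_pos hp0 hp
  rw [← integrable_norm_rpow_iff (by fun_prop) hp0 hp]
  refine (integrable_exp_mul_sq_norm (d := d) (b := 1 / 2) (by norm_num)).congr
    (ae_of_all _ fun x => ?_)
  simp only
  rw [Real.norm_eq_abs, Real.abs_exp, ← Real.exp_mul]
  congr 1
  field_simp

lemma SubGaussian.memLp {g : E d → ℝ} (hg : SubGaussian g) (hm : Continuous g) {p : ℝ≥0∞}
    (hp0 : p ≠ 0) (hp : p ≠ ∞) : MemLp g p (gaussian d) := by
  have h0 : 0 < p.toReal := ENNReal.toReal_pos hp0 hp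
  obtain ⟨C, hC, h⟩ := hg (1 / (2 * p.toReal)) (by positivity)
  refine ((memLp_exp_sq hp0 hp).const_mul C).of_le hm.aestronglyMeasurable
    (ae_of_all _ fun x => ?_)
  rw [Real.norm_eq_abs, Real.norm_eq_abs, abs_mul, Real.abs_exp, abs_of_nonneg hC]
  exact h x

/-! ### Density of the Hermite polynomials in `L^p(γ_d)` -/

/-- The linear span of the Hermite polynomials, as functions. -/
def hermiteSpan (d : ℕ) : Submodule ℝ (E d → ℝ) := Submodule.span ℝ (range hermite)

lemma prodHermite_mem (ν : Fin d → ℕ) : prodHermite (d := d) ν ∈ hermiteSpan d := by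
  have : prodHermite (d := d) ν = (hermiteConst ν)⁻¹ • hermite ν := by
    funext x
    rw [Pi.smul_apply, hermite_eq, smul_eq_mul, ← mul_assoc,
      inv_mul_cancel₀ (hermiteConst_ne_zero ν), one_mul]
  rw [this]
  exact Submodule.smul_mem _ _ (Submodule.subset_span ⟨ν, rfl⟩)

lemma one_mem_hermiteSpan : (fun _ => 1 : E d → ℝ) ∈ hermiteSpan d := by
  have : (fun _ => 1 : E d → ℝ) = prodHermite 0 := by
    funext x; simp [prodHermite, hermitePoly]
  rw [this]
  exact prodHermite_mem 0

/-- By the three-term recurrence, multiplication by a coordinate preserves the span. -/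
lemma coord_mul_mem_hermiteSpan (i : Fin d) {P : E d → ℝ} (hP : P ∈ hermiteSpan d) :
    (fun x => x i * P x) ∈ hermiteSpan d := by
  induction hP using Submodule.span_induction with
  | mem P hP =>
    obtain ⟨ν, rfl⟩ := hP
    have hupd : ∀ (m : ℕ) (x : E d), prodHermite (Function.update ν i m) x =
        (hermitePoly m).eval (x i) * ∏ j ∈ Finset.univ.erase i, (hermitePoly (ν j)).eval (x j) := by
      intro m x
      rw [prodHermite, ← Finset.mul_prod_erase _ _ (Finset.mem_univ i)]
      simp only [Function.update_self]
      congr 1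
      refine Finset.prod_congr rfl fun j hj => ?_
      rw [Function.update_of_ne (Finset.ne_of_mem_erase hj)]
    have hself : ∀ x : E d, prodHermite ν x =
        (hermitePoly (ν i)).eval (x i) *
          ∏ j ∈ Finset.univ.erase i, (hermitePoly (ν j)).eval (x j) := by
      intro x
      have := hupd (ν i) x
      rwa [Function.update_eq_self] at this
    rcases hn : ν i with _ | n
    · have : (fun x : E d => x i * hermite ν x) =
          (hermiteConst ν / 2) • prodHermite (Function.update ν i 1) := by
        funext x
        rw [Pi.smul_apply, smul_eq_mul, hupd, hermite_eq, hself, hn]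
        simp [hermitePoly]; ring
      rw [this]
      exact Submodule.smul_mem _ _ (prodHermite_mem _)
    · have : (fun x : E d => x i * hermite ν x) =
          (hermiteConst ν / 2) • prodHermite (Function.update ν i (n + 2)) +
          (hermiteConst ν * (n + 1)) • prodHermite (Function.update ν i n) := by
        funext x
        rw [Pi.add_apply, Pi.smul_apply, Pi.smul_apply, smul_eq_mul, smul_eq_mul, hupd, hupd,
          hermite_eq, hself, hn, hermitePoly_succ_succ]
        ring
      rw [this]
      exact Submodule.add_mem _ (Submodule.smul_mem _ _ (prodHermite_mem _))
        (Submodule.smul_mem _ _ (prodHermite_mem _))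
  | zero =>
    have : (fun x : E d => x i * (0 : E d → ℝ) x) = 0 := by funext x; simp
    rw [this]
    exact (hermiteSpan d).zero_mem
  | add P Q _ _ h1 h2 =>
    have : (fun x : E d => x i * (P + Q) x) = (fun x => x i * P x) + fun x => x i * Q x := by
      funext x; simp [mul_add]
    rw [this]
    exact Submodule.add_mem _ h1 h2
  | smul a P _ h1 =>
    have : (fun x : E d => x i * (a • P) x) = a • fun x => x i * P x := by
      funext x; simp; ring
    rw [this]
    exact Submodule.smul_mem _ _ h1

lemma coord_pow_mul_mem_hermiteSpan (i : Fin d) (n : ℕ) {P : E d → ℝ} (hP : P ∈ hermiteSpan d) :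
    (fun x => x i ^ n * P x) ∈ hermiteSpan d := by
  induction n with
  | zero => simpa using hP
  | succ n ih =>
    have := coord_mul_mem_hermiteSpan i ih
    refine (congrArg (· ∈ hermiteSpan d) (funext fun x => ?_)).mp this
    ring

lemma subGaussian_of_mem {P : E d → ℝ} (hP : P ∈ hermiteSpan d) :
    SubGaussian P ∧ Continuous P := by
  induction hP using Submodule.span_induction with
  | mem P hP =>
    obtain ⟨ν, rfl⟩ := hP
    exact ⟨subGaussian_hermite ν, continuous_hermite ν⟩
  | zero => exact ⟨subGaussian_of_bounded (M := 0) fun _ => by simp, continuous_zero⟩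
  | add P Q _ _ h1 h2 => exact ⟨h1.1.add h2.1, h1.2.add h2.2⟩
  | smul a P _ h1 =>
    exact ⟨(subGaussian_of_bounded (M := |a|) fun _ => le_rfl).mul h1.1, h1.2.const_smul a⟩

section Dense

variable {p : ℝ≥0∞} (V : Submodule ℝ (Lp ℝ p (gaussian d)))

/-- The class of `g` is an element of `V`. -/
def ClassMem (g : E d → ℝ) : Prop := ∃ h : MemLp g p (gaussian d), h.toLp g ∈ V

variable {V}

lemma ClassMem.add {f g : E d → ℝ} (hf : ClassMem V f) (hg : ClassMem V g) :
    ClassMem V (f + g) := by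
  obtain ⟨h1, h2⟩ := hf
  obtain ⟨h3, h4⟩ := hg
  refine ⟨h1.add h3, ?_⟩
  rw [MemLp.toLp_add h1 h3]
  exact V.add_mem h2 h4

lemma ClassMem.smul {f : E d → ℝ} (hf : ClassMem V f) (c : ℝ) : ClassMem V (c • f) := by
  obtain ⟨h1, h2⟩ := hf
  refine ⟨h1.const_smul c, ?_⟩
  rw [MemLp.toLp_const_smul c h1]
  exact V.smul_mem c h2

lemma classMem_zero : ClassMem V (0 : E d → ℝ) :=
  ⟨MemLp.zero, by rw [MemLp.toLp_zero]; exact V.zero_mem⟩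

lemma classMem_of_mem_hermiteSpan
    (hV1 : ∀ ν : Fin d → ℕ, ClassMem V (hermite ν)) {P : E d → ℝ} (hP : P ∈ hermiteSpan d) :
    ClassMem V P := by
  induction hP using Submodule.span_induction with
  | mem P hP => obtain ⟨ν, rfl⟩ := hP; exact hV1 ν
  | zero => exact classMem_zero
  | add P Q _ _ h1 h2 => exact h1.add h2
  | smul a P _ h1 => exact h1.smul a

/-- The bounded continuous functions `g` such that `g P` belongs to `V` for all polynomials `P`. -/
def BoundedMultiplier (V : Submodule ℝ (Lp ℝ p (gaussian d))) (g : E d → ℝ) : Prop :=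
  Continuous g ∧ (∃ M, ∀ x, |g x| ≤ M) ∧ ∀ P ∈ hermiteSpan d, ClassMem V fun x => g x * P x

lemma BoundedMultiplier.add {f g : E d → ℝ} (hf : BoundedMultiplier V f)
    (hg : BoundedMultiplier V g) : BoundedMultiplier V fun x => f x + g x := by
  obtain ⟨h1, ⟨M, hM⟩, h2⟩ := hf
  obtain ⟨h3, ⟨N, hN⟩, h4⟩ := hg
  refine ⟨h1.add h3, ⟨M + N, fun x => (abs_add_le _ _).trans (add_le_add (hM x) (hN x))⟩,
    fun P hP => ?_⟩
  refine (congrArg (ClassMem V) (funext fun x => ?_)).mp ((h2 P hP).add (h4 P hP))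
  simp [add_mul]

variable [Fact (1 ≤ p)]

/-- Dominated convergence in `L^p`. -/
lemma tendsto_toLp_of_dominated {Ω : Type*} [MeasurableSpace Ω] {μ : Measure Ω}
    (hp : p ≠ ∞) {g : ℕ → Ω → ℝ} {f B : Ω → ℝ}
    (hg : ∀ n, MemLp (g n) p μ) (hf : MemLp f p μ) (hB : MemLp B p μ)
    (hgB : ∀ n x, |g n x| ≤ B x)
    (hlim : ∀ x, Filter.Tendsto (fun n => g n x) Filter.atTop (nhds (f x))) :
    Filter.Tendsto (fun n => (hg n).toLp (g n)) Filter.atTop (nhds (hf.toLp f)) := by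
  have hp0 : p ≠ 0 := (lt_of_lt_of_le one_pos (Fact.out : 1 ≤ p)).ne'
  have hp1 : 0 < p.toReal := ENNReal.toReal_pos hp0 hp
  rw [Lp.tendsto_Lp_iff_tendsto_eLpNorm'']
  have hfB : ∀ x, |f x| ≤ B x := fun x =>
    le_of_tendsto ((hlim x).abs) (Filter.Eventually.of_forall fun n => hgB n x)
  simp_rw [eLpNorm_eq_lintegral_rpow_enorm_toReal hp0 hp]
  have h0 : (0 : ℝ≥0∞) = 0 ^ (1 / p.toReal) := by rw [ENNReal.zero_rpow_of_pos (by positivity)]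
  rw [h0]
  refine Filter.Tendsto.ennrpow_const (1 / p.toReal) ?_
  have h1 := tendsto_lintegral_of_dominated_convergence' (μ := μ)
    (F := fun n x => ‖(g n - f) x‖ₑ ^ p.toReal) (f := fun _ => 0)
    (fun x => ‖2 * B x‖ₑ ^ p.toReal) ?_ ?_ ?_ ?_
  · simpa using h1
  · intro n
    exact (((hg n).sub hf).1.enorm).pow_const _
  · intro n
    refine ae_of_all _ fun x => ?_
    refine ENNReal.rpow_le_rpow ?_ hp1.le
    rw [Real.enorm_eq_ofReal_abs, Real.enorm_eq_ofReal_abs]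
    refine ENNReal.ofReal_le_ofReal ?_
    have h2 : 0 ≤ B x := (abs_nonneg _).trans (hfB x)
    rw [abs_of_nonneg (by positivity : 0 ≤ 2 * B x), Pi.sub_apply]
    have := abs_sub (g n x) (f x)
    linarith [hgB n x, hfB x]
  · have := (hB.const_mul 2).2
    rw [eLpNorm_lt_top_iff_lintegral_rpow_enorm_lt_top hp0 hp] at this
    exact this.ne
  · refine ae_of_all _ fun x => ?_
    have h2 : Filter.Tendsto (fun n => ‖(g n - f) x‖ₑ) Filter.atTop (nhds 0) := by
      have h3 := ((hlim x).sub_const (f x))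
      rw [sub_self] at h3
      have := h3.enorm
      simpa using this
    have := h2.ennrpow_const p.toReal
    rwa [ENNReal.zero_rpow_of_pos hp1] at this

lemma classMem_of_tendsto (hp : p ≠ ∞) (hV : IsClosed (V : Set (Lp ℝ p (gaussian d))))
    {g : ℕ → E d → ℝ} {f B : E d → ℝ} (hg : ∀ n, ClassMem V (g n)) (hf : Continuous f)
    (hB : SubGaussian B) (hBc : Continuous B) (hgB : ∀ n x, |g n x| ≤ B x)
    (hlim : ∀ x, Filter.Tendsto (fun n => g n x) Filter.atTop (nhds (f x))) :
    ClassMem V f := by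
  have hp0 : p ≠ 0 := (lt_of_lt_of_le one_pos (Fact.out : 1 ≤ p)).ne'
  have hBp := hB.memLp hBc hp0 hp
  have hfp : MemLp f p (gaussian d) := by
    refine hBp.of_le hf.aestronglyMeasurable (ae_of_all _ fun x => ?_)
    refine le_trans ?_ (le_abs_self _)
    exact le_of_tendsto ((hlim x).norm) (Filter.Eventually.of_forall fun n => hgB n x)
  exact ⟨hfp, hV.mem_of_tendsto (tendsto_toLp_of_dominated hp (fun n => (hg n).1) hfp hBp hgB hlim)
    (Filter.Eventually.of_forall fun n => (hg n).2)⟩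

/-- The Taylor series of the sine shows that bounded multipliers are stable under multiplication
by `sin (c xᵢ)`. -/
lemma BoundedMultiplier.mul_sin (hp : p ≠ ∞) (hV : IsClosed (V : Set (Lp ℝ p (gaussian d))))
    {g : E d → ℝ} (hg : BoundedMultiplier V g) (c : ℝ) (i : Fin d) :
    BoundedMultiplier V fun x => g x * Real.sin (c * x i) := by
  obtain ⟨h1, ⟨M, hM⟩, h2⟩ := hg
  refine ⟨by fun_prop, ⟨M, fun x => ?_⟩, fun P hP => ?_⟩
  · rw [abs_mul]
    have := Real.abs_sin_le_one (c * x i)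
    nlinarith [hM x, abs_nonneg (g x)]
  obtain ⟨hPs, hPc⟩ := subGaussian_of_mem hP
  have hPabs : SubGaussian fun x => |P x| := fun ε hε => by
    obtain ⟨C, hC, h⟩ := hPs ε hε
    exact ⟨C, hC, fun x => by rw [abs_abs]; exact h x⟩
  -- The partial sums of the sine series at `y` are dominated by `exp |y|`, which is of slower
  -- growth than any Gaussian exponential.
  have hlim : ∀ y : ℝ, Filter.Tendsto (fun n => ∑ k ∈ Finset.range n,
      (-1) ^ k * y ^ (2 * k + 1) / ((2 * k + 1).factorial : ℝ)) Filter.atTop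
      (nhds (Real.sin y)) := fun y => (Real.hasSum_sin y).tendsto_sum_nat
  have hbd : ∀ (y : ℝ) (n : ℕ), |∑ k ∈ Finset.range n,
      (-1) ^ k * y ^ (2 * k + 1) / ((2 * k + 1).factorial : ℝ)| ≤ Real.exp |y| := by
    intro y n
    refine (Finset.abs_sum_le_sum_abs _ _).trans ?_
    have h3 : ∀ k, |(-1) ^ k * y ^ (2 * k + 1) / ((2 * k + 1).factorial : ℝ)| =
        |y| ^ (2 * k + 1) / ((2 * k + 1).factorial : ℝ) := by
      intro k
      rw [abs_div, abs_mul, abs_pow, abs_pow]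
      simp
    simp_rw [h3]
    refine (sum_le_hasSum _ (fun k _ => by positivity) (Real.hasSum_sinh |y|)).trans ?_
    rw [Real.sinh_eq]
    have := Real.exp_pos |y|
    have := Real.exp_pos (-|y|)
    linarith
  refine classMem_of_tendsto hp hV (g := fun n x => g x * (∑ k ∈ Finset.range n,
      (-1) ^ k * (c * x i) ^ (2 * k + 1) / ((2 * k + 1).factorial : ℝ)) * P x)
    (B := fun x => M * (Real.exp (|c| * |x i|) * |P x|)) (fun n => ?_) (by fun_prop) ?_
    (by fun_prop) (fun n x => ?_) fun x => ?_
  · have h3 : (fun x : E d => (∑ k ∈ Finset.range n,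
        (-1) ^ k * (c * x i) ^ (2 * k + 1) / ((2 * k + 1).factorial : ℝ)) * P x) ∈
        hermiteSpan d := by
      have : (fun x : E d => (∑ k ∈ Finset.range n,
        (-1) ^ k * (c * x i) ^ (2 * k + 1) / ((2 * k + 1).factorial : ℝ)) * P x) =
        ∑ k ∈ Finset.range n, ((-1) ^ k * c ^ (2 * k + 1) / ((2 * k + 1).factorial : ℝ)) •
          fun x : E d => x i ^ (2 * k + 1) * P x := by
        funext x
        rw [Finset.sum_mul, Finset.sum_apply]
        refine Finset.sum_congr rfl fun k _ => ?_
        rw [Pi.smul_apply, smul_eq_mul, mul_pow]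
        ring
      rw [this]
      exact Submodule.sum_mem _ fun k _ =>
        Submodule.smul_mem _ _ (coord_pow_mul_mem_hermiteSpan i _ hP)
    refine (congrArg (ClassMem V) (funext fun x => ?_)).mp (h2 _ h3)
    ring
  · exact (subGaussian_of_bounded (M := |M|) fun _ => le_rfl).mul
      ((subGaussian_exp_coord _ i).mul hPabs)
  · rw [abs_mul, abs_mul, mul_assoc]
    have := hbd (c * x i) n
    rw [abs_mul] at this
    exact mul_le_mul (hM x) (mul_le_mul_of_nonneg_right this (abs_nonneg _)) (by positivity)
      ((abs_nonneg _).trans (hM x))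
  · exact ((hlim _).const_mul _).mul_const _

lemma boundedMultiplier_const (hV1 : ∀ ν : Fin d → ℕ, ClassMem V (hermite ν))
    (a : ℝ) : BoundedMultiplier V fun _ : E d => a :=
  ⟨continuous_const, ⟨|a|, fun _ => le_rfl⟩, fun _ hP =>
    classMem_of_mem_hermiteSpan hV1 ((hermiteSpan d).smul_mem a hP)⟩

/-- The point of the cube `[-1, 1]^d` with coordinates `sin (c xᵢ)`. -/
def sinPoint (c : ℝ) (x : E d) : Fin d → Icc (-1 : ℝ) 1 := fun i =>
  ⟨Real.sin (c * x i), Real.neg_one_le_sin _, Real.sin_le_one _⟩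

/-- The coordinate functions on the cube. -/
def cubeCoord (i : Fin d) : C(Fin d → Icc (-1 : ℝ) 1, ℝ) := ⟨fun y => y i, by fun_prop⟩

/-- A polynomial in the functions `sin (c xᵢ)` is a bounded multiplier. -/
lemma boundedMultiplier_of_cube (hp : p ≠ ∞) (hV : IsClosed (V : Set (Lp ℝ p (gaussian d))))
    (hV1 : ∀ ν : Fin d → ℕ, ClassMem V (hermite ν)) (c : ℝ) (q : MvPolynomial (Fin d) ℝ) :
    BoundedMultiplier V fun x : E d => MvPolynomial.aeval cubeCoord q (sinPoint c x) := by
  induction q using MvPolynomial.induction_on with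
  | C a => simpa using boundedMultiplier_const hV1 a
  | add f g hf hg => simpa using hf.add hg
  | mul_X f i hf =>
    simp only [map_mul, MvPolynomial.aeval_X, ContinuousMap.mul_apply]
    exact hf.mul_sin hp hV c i

/-- By Stone–Weierstrass, `G` is a uniform limit of polynomials on the cube. -/
lemma classMem_of_continuousMap_cube (hp : p ≠ ∞)
    (hV : IsClosed (V : Set (Lp ℝ p (gaussian d))))
    (hV1 : ∀ ν : Fin d → ℕ, ClassMem V (hermite ν)) (c : ℝ)
    (G : C(Fin d → Icc (-1 : ℝ) 1, ℝ)) : ClassMem V fun x : E d => G (sinPoint c x) := by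
  have hsep : (MvPolynomial.aeval (R := ℝ) (cubeCoord (d := d))).range.SeparatesPoints := by
    intro y z hyz
    obtain ⟨i, hi⟩ := Function.ne_iff.1 hyz
    refine ⟨cubeCoord i, ⟨cubeCoord i, ⟨MvPolynomial.X i, by simp⟩, rfl⟩, ?_⟩
    simpa [cubeCoord, Subtype.ext_iff] using hi
  have happ : ∀ n : ℕ, ∃ q : MvPolynomial (Fin d) ℝ,
      ‖MvPolynomial.aeval cubeCoord q - G‖ < 1 / ((n : ℝ) + 1) := by
    intro n
    obtain ⟨⟨g, q, rfl⟩, hg⟩ :=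
      ContinuousMap.exists_mem_subalgebra_near_continuousMap_of_separatesPoints _ hsep G
        (1 / ((n : ℝ) + 1)) (by positivity)
    exact ⟨q, hg⟩
  choose q hq using happ
  have hdiff : ∀ n (x : E d), |MvPolynomial.aeval cubeCoord (q n) (sinPoint c x) -
      G (sinPoint c x)| ≤ 1 / ((n : ℝ) + 1) := fun n x =>
    ((MvPolynomial.aeval cubeCoord (q n) - G).norm_coe_le_norm (sinPoint c x)).trans (hq n).le
  have hcont : Continuous (sinPoint (d := d) c) := by
    refine continuous_pi fun i => ?_
    exact Continuous.subtype_mk (by fun_prop) _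
  refine classMem_of_tendsto hp hV
    (g := fun n x => MvPolynomial.aeval cubeCoord (q n) (sinPoint c x))
    (B := fun _ => ‖G‖ + 1) (fun n => ?_) (G.continuous.comp hcont)
    (subGaussian_of_bounded (M := |‖G‖ + 1|) fun _ => le_rfl) continuous_const (fun n x => ?_)
    fun x => ?_
  · have := (boundedMultiplier_of_cube hp hV hV1 c (q n)).2.2 _ one_mem_hermiteSpan
    simpa using this
  · have h1 := hdiff n x
    have h2 := G.norm_coe_le_norm (sinPoint c x)
    rw [Real.norm_eq_abs] at h2
    have h3 : 1 / ((n : ℝ) + 1) ≤ 1 := by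
      rw [div_le_one (by positivity)]; linarith [(Nat.cast_nonneg n : (0:ℝ) ≤ n)]
    have h4 := abs_sub_abs_le_abs_sub (MvPolynomial.aeval cubeCoord (q n) (sinPoint c x))
      (G (sinPoint c x))
    linarith
  · rw [tendsto_iff_norm_sub_tendsto_zero]
    exact squeeze_zero (fun _ => norm_nonneg _) (fun n => hdiff n x)
      tendsto_one_div_add_atTop_nhds_zero_nat

/-- A bounded continuous `f` is the bounded pointwise limit of the functions
`x ↦ f (N arcsin (sin (x₁ / N)), …, N arcsin (sin (x_d / N)))`, which are continuous functions of
the point `sinPoint N⁻¹ x`. -/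
lemma classMem_of_boundedContinuous (hp : p ≠ ∞)
    (hV : IsClosed (V : Set (Lp ℝ p (gaussian d))))
    (hV1 : ∀ ν : Fin d → ℕ, ClassMem V (hermite ν)) (f : BoundedContinuousFunction (E d) ℝ) :
    ClassMem V (f : E d → ℝ) := by
  set G : ℕ → C(Fin d → Icc (-1 : ℝ) 1, ℝ) := fun n =>
    ⟨fun y => f (WithLp.toLp 2 fun i => ((n : ℝ) + 1) * Real.arcsin (y i)), by fun_prop⟩ with hG
  refine classMem_of_tendsto hp hV (g := fun n x => G n (sinPoint ((n : ℝ) + 1)⁻¹ x))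
    (B := fun _ => ‖f‖) (fun n => classMem_of_continuousMap_cube hp hV hV1 _ _) f.continuous
    (subGaussian_of_bounded (M := |‖f‖|) fun _ => le_rfl) continuous_const
    (fun n x => f.norm_coe_le_norm _) fun x => ?_
  -- For `n ≥ ‖x‖` the approximating function agrees with `f` at `x`.
  refine tendsto_const_nhds.congr' ?_
  obtain ⟨N, hN⟩ := exists_nat_gt (‖x‖)
  filter_upwards [Filter.eventually_ge_atTop N] with n hn
  have hn' : (N : ℝ) ≤ n := by exact_mod_cast hn
  have hn0 : (0 : ℝ) < n + 1 := by positivity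
  simp only [hG, ContinuousMap.coe_mk, sinPoint]
  congr 1
  ext i
  simp only
  have h1 : |x i| ≤ ‖x‖ := PiLp.norm_apply_le x i
  have h2 : |((n : ℝ) + 1)⁻¹ * x i| ≤ 1 := by
    rw [abs_mul, abs_of_pos (inv_pos.2 hn0), inv_mul_le_iff₀ hn0]
    linarith
  have h3 := Real.pi_gt_three
  rw [abs_le] at h2
  rw [Real.arcsin_sin (by linarith) (by linarith), ← mul_assoc, mul_inv_cancel₀ hn0.ne', one_mul]

/-- A closed subspace of `L^p(γ_d)`, `p < ∞`, which contains the Hermite polynomials is the whole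
space. -/
theorem eq_top_of_hermite_mem (hp : p ≠ ∞) (hV : IsClosed (V : Set (Lp ℝ p (gaussian d))))
    (hV1 : ∀ ν : Fin d → ℕ, ClassMem V (hermite ν)) : V = ⊤ := by
  have hd := BoundedContinuousFunction.toLp_denseRange ℝ (gaussian d) ℝ hp (p := p)
  rw [eq_top_iff]
  intro f _
  have hsub : range (BoundedContinuousFunction.toLp p (gaussian d) ℝ) ⊆
      (V : Set (Lp ℝ p (gaussian d))) := by
    rintro _ ⟨g, rfl⟩
    obtain ⟨h1, h2⟩ := classMem_of_boundedContinuous hp hV hV1 g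
    have : BoundedContinuousFunction.toLp p (gaussian d) ℝ g = h1.toLp g := by
      ext1
      exact (BoundedContinuousFunction.coeFn_toLp p (gaussian d) ℝ g).trans h1.coeFn_toLp.symm
    rw [this]
    exact h2
  exact closure_minimal hsub hV (hd f)

end Dense

/-! ### Averages of the Ornstein–Uhlenbeck semigroup as operators on `L^p(γ_d)` -/

/-- The average `∫ w(s) T_s f(x) dm(s)`, written as one integral over time and space. -/
def ouAvg (m : Measure ℝ) (w : ℝ → ℝ) (f : E d → ℝ) (x : E d) : ℝ :=
  ∫ z : ℝ × E d, w z.1 * f (mehlerPoint z.1 z.2 x) ∂(m.prod (gaussian d))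

section Avg

variable {m : Measure ℝ} [SFinite m]

lemma lintegral_prod_mehler {W : ℝ → ℝ≥0∞} (hW : Measurable W) {F : E d → ℝ≥0∞}
    (hF : Measurable F) (x : E d) :
    ∫⁻ z : ℝ × E d, W z.1 * F (mehlerPoint z.1 z.2 x) ∂(m.prod (gaussian d)) =
      ∫⁻ s, W s * ouL s F x ∂m := by
  have hm : Measurable fun z : ℝ × E d => W z.1 * F (mehlerPoint z.1 z.2 x) :=
    Measurable.mul (f := fun z : ℝ × E d => W z.1)
      (g := fun z : ℝ × E d => F (mehlerPoint z.1 z.2 x)) (hW.comp measurable_fst)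
      (hF.comp (measurable_mehlerPoint measurable_fst measurable_snd measurable_const))
  rw [lintegral_prod _ hm.aemeasurable]
  refine lintegral_congr fun s => ?_
  exact lintegral_const_mul (W s) (f := fun u => F (mehlerPoint s u x))
    (hF.comp (measurable_mehlerPoint measurable_const measurable_id measurable_const))

lemma lintegral_mul_ouL_avg (hm : ∀ᵐ s ∂m, 0 ≤ s) {W : ℝ → ℝ≥0∞} (hW : Measurable W)
    {F : E d → ℝ≥0∞} (hF : Measurable F) :
    ∫⁻ x, ∫⁻ s, W s * ouL s F x ∂m ∂(gaussian d) = (∫⁻ s, W s ∂m) * ∫⁻ x, F x ∂(gaussian d) := by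
  have hmeas : Measurable (Function.uncurry fun (x : E d) (s : ℝ) => W s * ouL s F x) :=
    Measurable.mul (f := fun z : E d × ℝ => W z.2) (g := fun z : E d × ℝ => ouL z.2 F z.1)
      (hW.comp measurable_snd) (measurable_ouL_comp measurable_snd hF measurable_fst)
  rw [lintegral_lintegral_swap hmeas.aemeasurable, ← lintegral_mul_const _ hW]
  refine lintegral_congr_ae ?_
  filter_upwards [hm] with s hs
  rw [lintegral_const_mul _ ((isMarkov_ouL hs).meas _ hF), lintegral_ouL hs hF]

/-- Functions which agree almost everywhere have the same averages almost everywhere. -/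
lemma ae_ae_mehler (hm : ∀ᵐ s ∂m, 0 ≤ s) {P : E d → Prop} (hP : ∀ᵐ x ∂(gaussian d), P x) :
    ∀ᵐ x ∂(gaussian d), ∀ᵐ z ∂(m.prod (gaussian d)), P (mehlerPoint z.1 z.2 x) := by
  obtain ⟨G, hG, hG0, hGP⟩ : ∃ G : E d → ℝ≥0∞, Measurable G ∧ ∫⁻ x, G x ∂(gaussian d) = 0 ∧
      ∀ x, G x = 0 → P x := by
    set N := toMeasurable (gaussian d) {x | ¬ P x} with hN
    have hNm : MeasurableSet N := measurableSet_toMeasurable _ _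
    have hN0 : gaussian d N = 0 := by rw [hN, measure_toMeasurable]; exact hP
    refine ⟨N.indicator fun _ => 1, measurable_const.indicator hNm, ?_, fun x hx => ?_⟩
    · rw [lintegral_indicator hNm, setLIntegral_const, hN0, mul_zero]
    · by_contra hcon
      have : x ∈ N := subset_toMeasurable _ _ hcon
      simp [this] at hx
  have h1 := lintegral_mul_ouL_avg hm (measurable_const (a := (1 : ℝ≥0∞))) hG
  rw [hG0, mul_zero] at h1
  have hmeas : Measurable fun x : E d => ∫⁻ s, 1 * ouL s G x ∂m :=
    Measurable.lintegral_prod_right' (f := fun z : E d × ℝ => 1 * ouL z.2 G z.1)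
      ((measurable_ouL_comp measurable_snd hG measurable_fst).const_mul 1)
  rw [lintegral_eq_zero_iff hmeas] at h1
  filter_upwards [h1] with x hx
  rw [← lintegral_prod_mehler (m := m) (measurable_const (a := (1 : ℝ≥0∞))) hG] at hx
  have hm3 : Measurable fun z : ℝ × E d => (1 : ℝ≥0∞) * G (mehlerPoint z.1 z.2 x) :=
    (hG.comp (measurable_mehlerPoint measurable_fst measurable_snd measurable_const)).const_mul 1
  filter_upwards [(lintegral_eq_zero_iff hm3).1 hx] with z hz
  exact hGP _ (by simpa using hz)

variable {w : ℝ → ℝ}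

lemma measurable_mehler_integrand (hw : Measurable w) {f : E d → ℝ} (hf : Measurable f) :
    Measurable fun y : E d × (ℝ × E d) => w y.2.1 * f (mehlerPoint y.2.1 y.2.2 y.1) :=
  Measurable.mul (f := fun y : E d × (ℝ × E d) => w y.2.1)
    (g := fun y : E d × (ℝ × E d) => f (mehlerPoint y.2.1 y.2.2 y.1))
    (hw.comp (measurable_fst.comp measurable_snd))
    (hf.comp (measurable_mehlerPoint (measurable_fst.comp measurable_snd)
      (measurable_snd.comp measurable_snd) measurable_fst))

lemma measurable_mehler_integrand_left (hw : Measurable w) {f : E d → ℝ} (hf : Measurable f)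
    (x : E d) : Measurable fun z : ℝ × E d => w z.1 * f (mehlerPoint z.1 z.2 x) :=
  (measurable_mehler_integrand hw hf).comp (measurable_const (a := x) |>.prodMk measurable_id)

lemma measurable_ouAvg (hw : Measurable w) {f : E d → ℝ} (hf : Measurable f) :
    StronglyMeasurable (ouAvg m w f) :=
  (measurable_mehler_integrand hw hf).stronglyMeasurable.integral_prod_right'

lemma lintegral_enorm_mehler (hw : Measurable w) {f : E d → ℝ} (hf : Measurable f) (x : E d) :
    ∫⁻ z : ℝ × E d, ‖w z.1 * f (mehlerPoint z.1 z.2 x)‖ₑ ∂(m.prod (gaussian d)) =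
      ∫⁻ s, ‖w s‖ₑ * ouL s (fun y => ‖f y‖ₑ) x ∂m := by
  simp_rw [enorm_mul]
  exact lintegral_prod_mehler hw.enorm hf.enorm x

lemma ae_integrable_mehler (hm : ∀ᵐ s ∂m, 0 ≤ s) (hw : Measurable w) (hwi : Integrable w m)
    {f : E d → ℝ} (hf : Measurable f) (hfi : Integrable f (gaussian d)) :
    ∀ᵐ x ∂(gaussian d), Integrable (fun z : ℝ × E d => w z.1 * f (mehlerPoint z.1 z.2 x))
      (m.prod (gaussian d)) := by
  have h1 := lintegral_mul_ouL_avg hm hw.enorm hf.enorm (d := d)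
  have h2 : ∫⁻ x, ∫⁻ s, ‖w s‖ₑ * ouL s (fun y => ‖f y‖ₑ) x ∂m ∂(gaussian d) ≠ ∞ := by
    rw [h1]
    exact ENNReal.mul_ne_top hwi.2.ne hfi.2.ne
  have hmeas : Measurable fun x : E d => ∫⁻ s, ‖w s‖ₑ * ouL s (fun y => ‖f y‖ₑ) x ∂m :=
    Measurable.lintegral_prod_right' (f := fun z : E d × ℝ => ‖w z.2‖ₑ * ouL z.2 (fun y => ‖f y‖ₑ) z.1)
      (Measurable.mul (f := fun z : E d × ℝ => ‖w z.2‖ₑ)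
        (g := fun z : E d × ℝ => ouL z.2 (fun y => ‖f y‖ₑ) z.1) (hw.enorm.comp measurable_snd)
        (measurable_ouL_comp measurable_snd hf.enorm measurable_fst))
  filter_upwards [ae_lt_top hmeas h2] with x hx
  refine ⟨(measurable_mehler_integrand_left hw hf x).aestronglyMeasurable, ?_⟩
  rw [hasFiniteIntegral_iff_enorm, lintegral_enorm_mehler hw hf]
  exact hx

lemma enorm_ouAvg_le (hw : Measurable w) {f : E d → ℝ} (hf : Measurable f) (x : E d) :
    ‖ouAvg m w f x‖ₑ ≤ ∫⁻ s, ‖w s‖ₑ * ouL s (fun y => ‖f y‖ₑ) x ∂m := by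
  rw [← lintegral_enorm_mehler hw hf]
  exact enorm_integral_le_lintegral_enorm _

lemma eLpNorm_ouAvg_le (hm : ∀ᵐ s ∂m, 0 ≤ s) (hw : Measurable w)
    {f : E d → ℝ} (hf : Measurable f) {p : ℝ≥0∞} (hp1 : 1 ≤ p) (hp : p ≠ ∞) :
    eLpNorm (ouAvg m w f) p (gaussian d) ≤ (∫⁻ s, ‖w s‖ₑ ∂m) * eLpNorm f p (gaussian d) := by
  have hp0 : p ≠ 0 := (lt_of_lt_of_le one_pos hp1).ne'
  have hP : 1 ≤ p.toReal := by
    rw [← ENNReal.toReal_one]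
    exact (ENNReal.toReal_le_toReal (by simp) hp).2 hp1
  have hP0 : 0 < p.toReal := by linarith
  rw [eLpNorm_eq_lintegral_rpow_enorm_toReal hp0 hp, eLpNorm_eq_lintegral_rpow_enorm_toReal hp0 hp]
  set P := p.toReal
  set I := ∫⁻ s, ‖w s‖ₑ ∂m with hI
  have hfp : Measurable fun y => ‖f y‖ₑ ^ P := hf.enorm.pow_const _
  have h1 : ∀ x, ‖ouAvg m w f x‖ₑ ^ P ≤
      I ^ (P - 1) * ∫⁻ s, ‖w s‖ₑ * ouL s (fun y => ‖f y‖ₑ ^ P) x ∂m := by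
    intro x
    refine (ENNReal.rpow_le_rpow (enorm_ouAvg_le hw hf x) hP0.le).trans ?_
    refine (rpow_lintegral_mul_le hw.enorm.aemeasurable
      (measurable_ouL_time hf.enorm x).aemeasurable hP).trans ?_
    gcongr with s
    exact rpow_ouL_le hP s hf.enorm x
  have h2 : ∫⁻ x, ‖ouAvg m w f x‖ₑ ^ P ∂(gaussian d) ≤ I ^ P * ∫⁻ x, ‖f x‖ₑ ^ P ∂(gaussian d) := by
    refine (lintegral_mono h1).trans (le_of_eq ?_)
    have hmeas : Measurable fun x : E d => ∫⁻ s, ‖w s‖ₑ * ouL s (fun y => ‖f y‖ₑ ^ P) x ∂m :=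
      Measurable.lintegral_prod_right'
        (f := fun z : E d × ℝ => ‖w z.2‖ₑ * ouL z.2 (fun y => ‖f y‖ₑ ^ P) z.1)
        (Measurable.mul (f := fun z : E d × ℝ => ‖w z.2‖ₑ)
          (g := fun z : E d × ℝ => ouL z.2 (fun y => ‖f y‖ₑ ^ P) z.1) (hw.enorm.comp measurable_snd)
          (measurable_ouL_comp measurable_snd hfp measurable_fst))
    rw [lintegral_const_mul _ hmeas, lintegral_mul_ouL_avg hm hw.enorm hfp, ← mul_assoc]
    congr 1
    have := ENNReal.rpow_add_of_nonneg (x := I) (P - 1) 1 (by linarith) zero_le_one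
    rw [ENNReal.rpow_one] at this
    rw [← this]; congr 1; ring
  refine (ENNReal.rpow_le_rpow h2 (by positivity)).trans (le_of_eq ?_)
  rw [ENNReal.mul_rpow_of_nonneg _ _ (by positivity), ← ENNReal.rpow_mul,
    mul_one_div_cancel hP0.ne', ENNReal.rpow_one]

lemma ouAvg_congr (hm : ∀ᵐ s ∂m, 0 ≤ s) {f g : E d → ℝ} (h : f =ᵐ[gaussian d] g) :
    ouAvg m w f =ᵐ[gaussian d] ouAvg m w g := by
  filter_upwards [ae_ae_mehler hm h] with x hx
  refine integral_congr_ae ?_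
  filter_upwards [hx] with z hz
  rw [hz]

variable {p : ℝ≥0∞}

lemma measurable_coeFn_Lp (f : Lp ℝ p (gaussian d)) : Measurable (f : E d → ℝ) :=
  (Lp.stronglyMeasurable f).measurable

variable [Fact (1 ≤ p)]

lemma integrable_coeFn_Lp (f : Lp ℝ p (gaussian d)) : Integrable (f : E d → ℝ) (gaussian d) :=
  (Lp.memLp f).integrable Fact.out

/-- The averages are bounded operators on `L^p(γ_d)`. -/
theorem exists_clm_ouAvg (hp : p ≠ ∞) (hm : ∀ᵐ s ∂m, 0 ≤ s) (hw : Measurable w)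
    (hwi : Integrable w m) : ∃ A : Lp ℝ p (gaussian d) →L[ℝ] Lp ℝ p (gaussian d),
      (∀ f : Lp ℝ p (gaussian d), (A f : E d → ℝ) =ᵐ[gaussian d] ouAvg m w f) ∧
      ‖A‖ ≤ ∫ s, |w s| ∂m := by
  have hnorm : ∫⁻ s, ‖w s‖ₑ ∂m = ENNReal.ofReal (∫ s, |w s| ∂m) := by
    rw [ofReal_integral_eq_lintegral_ofReal hwi.abs (ae_of_all _ fun s => abs_nonneg _)]
    simp_rw [Real.enorm_eq_ofReal_abs]
  have hbd : ∀ f : Lp ℝ p (gaussian d), eLpNorm (ouAvg m w f) p (gaussian d) ≤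
      ENNReal.ofReal (∫ s, |w s| ∂m) * eLpNorm f p (gaussian d) := fun f => by
    rw [← hnorm]
    exact eLpNorm_ouAvg_le hm hw (measurable_coeFn_Lp f) Fact.out hp
  have hmem : ∀ f : Lp ℝ p (gaussian d), MemLp (ouAvg m w f) p (gaussian d) := fun f =>
    ⟨(measurable_ouAvg hw (measurable_coeFn_Lp f)).aestronglyMeasurable,
      (hbd f).trans_lt (ENNReal.mul_lt_top ENNReal.ofReal_lt_top (Lp.memLp f).2)⟩
  let A₀ : Lp ℝ p (gaussian d) →ₗ[ℝ] Lp ℝ p (gaussian d) :=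
    { toFun := fun f => (hmem f).toLp _
      map_add' := fun f g => by
        rw [← MemLp.toLp_add, MemLp.toLp_eq_toLp_iff]
        filter_upwards [ouAvg_congr (w := w) hm (Lp.coeFn_add f g),
          ae_integrable_mehler hm hw hwi (measurable_coeFn_Lp f) (integrable_coeFn_Lp f),
          ae_integrable_mehler hm hw hwi (measurable_coeFn_Lp g) (integrable_coeFn_Lp g)]
          with x h1 h2 h3
        rw [h1, Pi.add_apply]
        unfold ouAvg
        rw [← integral_add h2 h3]
        congr with z
        rw [Pi.add_apply, mul_add]
      map_smul' := fun c f => by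
        rw [RingHom.id_apply, ← MemLp.toLp_const_smul, MemLp.toLp_eq_toLp_iff]
        filter_upwards [ouAvg_congr (w := w) hm (Lp.coeFn_smul c f)] with x h1
        rw [h1, Pi.smul_apply]
        unfold ouAvg
        rw [smul_eq_mul, ← integral_const_mul]
        congr with z
        rw [Pi.smul_apply, smul_eq_mul]
        ring }
  have hA : ∀ f, ‖A₀ f‖ ≤ (∫ s, |w s| ∂m) * ‖f‖ := by
    intro f
    have h1 : ‖A₀ f‖ = (eLpNorm (ouAvg m w f) p (gaussian d)).toReal := Lp.norm_toLp _ (hmem f)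
    have h0 : 0 ≤ ∫ s, |w s| ∂m := integral_nonneg fun s => abs_nonneg _
    rw [h1, Lp.norm_def]
    have := ENNReal.toReal_mono (ENNReal.mul_ne_top ENNReal.ofReal_ne_top (Lp.memLp f).2.ne) (hbd f)
    rwa [ENNReal.toReal_mul, ENNReal.toReal_ofReal h0] at this
  refine ⟨A₀.mkContinuous _ hA, fun f => (hmem f).coeFn_toLp, ?_⟩
  exact LinearMap.mkContinuous_norm_le _ (integral_nonneg fun s => abs_nonneg _) hA

end Avg

/-! ### Operators which are diagonal on the Hermite polynomials -/

section Symbol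

variable {p : ℝ≥0∞}

/-- The operator `A` multiplies every Hermite polynomial of degree `n` by `σ n`. -/
def HasSymbol [Fact (1 ≤ p)] (A : Lp ℝ p (gaussian d) →L[ℝ] Lp ℝ p (gaussian d))
    (σ : ℕ → ℝ) : Prop :=
  ∀ (ν : Fin d → ℕ) (h : Lp ℝ p (gaussian d)), (h : E d → ℝ) =ᵐ[gaussian d] hermite ν →
    A h = σ (∑ i, ν i) • h

variable [Fact (1 ≤ p)] {A B : Lp ℝ p (gaussian d) →L[ℝ] Lp ℝ p (gaussian d)} {σ τ : ℕ → ℝ}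

lemma memLp_hermite (hp : p ≠ ∞) (ν : Fin d → ℕ) : MemLp (hermite ν) p (gaussian d) :=
  (subGaussian_hermite ν).memLp (continuous_hermite ν)
    (lt_of_lt_of_le one_pos (Fact.out : 1 ≤ p)).ne' hp

lemma HasSymbol.comp (hA : HasSymbol A σ) (hB : HasSymbol B τ) :
    HasSymbol (A.comp B) fun n => σ n * τ n := by
  intro ν h hh
  rw [ContinuousLinearMap.comp_apply, hB ν h hh, map_smul, hA ν h hh, smul_smul, mul_comm]

lemma HasSymbol.smul (hA : HasSymbol A σ) (c : ℝ) : HasSymbol (c • A) fun n => c * σ n := by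
  intro ν h hh
  rw [smul_apply, hA ν h hh, smul_smul]

lemma HasSymbol.sub (hA : HasSymbol A σ) (hB : HasSymbol B τ) :
    HasSymbol (A - B) fun n => σ n - τ n := by
  intro ν h hh
  rw [sub_apply, hA ν h hh, hB ν h hh, sub_smul]

lemma hasSymbol_id : HasSymbol (ContinuousLinearMap.id ℝ (Lp ℝ p (gaussian d))) fun _ => 1 := by
  intro ν h _
  simp

lemma HasSymbol.pow (hA : HasSymbol A σ) (n : ℕ) : HasSymbol (A ^ n) fun k => σ k ^ n := by
  induction n with
  | zero =>
    intro ν h _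
    simp
  | succ n ih =>
    simp_rw [pow_succ]
    exact ih.comp hA

/-- A bounded operator is determined by its action on the Hermite polynomials. -/
theorem HasSymbol.unique (hp : p ≠ ∞) (hA : HasSymbol A σ) (hB : HasSymbol B σ) : A = B := by
  have hcl : IsClosed ((LinearMap.ker (A - B).toLinearMap : Submodule ℝ (Lp ℝ p (gaussian d))) :
      Set (Lp ℝ p (gaussian d))) := (A - B).isClosed_ker
  have htop := eq_top_of_hermite_mem hp hcl fun ν => ⟨memLp_hermite hp ν, by
    have h1 := (memLp_hermite (d := d) hp ν).coeFn_toLp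
    rw [LinearMap.mem_ker]
    simp [hA ν _ h1, hB ν _ h1]⟩
  ext1 f
  have : f ∈ LinearMap.ker (A - B).toLinearMap := by rw [htop]; trivial
  rw [LinearMap.mem_ker] at this
  exact sub_eq_zero.1 this

/-- The symbol of the Riesz potential. -/
def rieszSymbol (β : ℝ) (n : ℕ) : ℝ := if n = 0 then 0 else (n : ℝ) ^ (-(β / 2))

lemma isRieszPotential_iff (hp : p ≠ ∞) (β : ℝ) :
    IsRieszPotential β A ↔ HasSymbol A (rieszSymbol β) := by
  have hν : ∀ ν : Fin d → ℕ, (if ν = 0 then (0 : ℝ) else ((∑ i, ν i : ℕ) : ℝ) ^ (-(β / 2))) =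
      rieszSymbol β (∑ i, ν i) := by
    intro ν
    rw [rieszSymbol]
    refine if_congr ?_ rfl rfl
    rw [Finset.sum_eq_zero_iff, funext_iff]
    simp
  constructor
  · intro hA ν h hh
    obtain ⟨g, hg, hAg⟩ := hA ν
    have : h = g := by ext1; exact hh.trans hg.symm
    rw [this, hAg, hν]
  · intro hA ν
    refine ⟨(memLp_hermite hp ν).toLp _, (memLp_hermite hp ν).coeFn_toLp, ?_⟩
    rw [hA ν _ (memLp_hermite hp ν).coeFn_toLp, hν]

/-- Since `T_s h_ν = e^{-|ν|s} h_ν`, the symbol of `∫ w(s) T_s dm(s)` is a Laplace transform. -/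
lemma hasSymbol_of_ouAvg (hp : p ≠ ∞) {m : Measure ℝ} [SFinite m] (hm : ∀ᵐ s ∂m, 0 ≤ s) {w : ℝ → ℝ}
    (hw : Measurable w) (hwi : Integrable w m)
    (hA : ∀ f : Lp ℝ p (gaussian d), (A f : E d → ℝ) =ᵐ[gaussian d] ouAvg m w f) :
    HasSymbol A fun n => ∫ s, w s * Real.exp (-(n : ℝ) * s) ∂m := by
  intro ν h hh
  ext1
  have hmeas : Measurable (hermite (d := d) ν) := (continuous_hermite ν).measurable
  filter_upwards [hA h, ouAvg_congr (w := w) hm hh, Lp.coeFn_smul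
    (∫ s, w s * Real.exp (-((∑ i, ν i : ℕ) : ℝ) * s) ∂m) h, hh,
    ae_integrable_mehler hm hw hwi hmeas ((memLp_hermite hp ν).integrable Fact.out)]
    with x h1 h2 h3 h4 h5
  rw [h1, h2, h3, Pi.smul_apply, h4, ouAvg, integral_prod _ h5, smul_eq_mul, ← integral_mul_const]
  refine integral_congr_ae ?_
  filter_upwards [hm] with s hs
  have := ornsteinUhlenbeck_hermite hs ν x
  unfold ornsteinUhlenbeck at this
  simp only [mehlerPoint]
  rw [integral_const_mul, this]
  ring

end Symbol

/-! ### Mehler's kernel and the spectral gap in `L^p(γ_d)` -/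

/-- The density of the law of `σ u + r x` with respect to the Gaussian measure. -/
def mehlerKernel (r σ : ℝ) (x y : E d) : ℝ :=
  σ⁻¹ ^ d * Real.exp (‖y‖ ^ 2 - ‖y - r • x‖ ^ 2 / σ ^ 2)

lemma integral_mehlerKernel {r σ : ℝ} (hσ : 0 < σ) (f : E d → ℝ) (x : E d) :
    ∫ u, f (σ • u + r • x) ∂(gaussian d) = ∫ y, mehlerKernel r σ x y * f y ∂(gaussian d) := by
  rw [integral_gaussian, integral_gaussian]
  set g : E d → ℝ := fun y =>
    (Real.exp (-(‖y - r • x‖ ^ 2 / σ ^ 2)) / Real.pi ^ ((d : ℝ) / 2)) * f y with hg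
  have h1 : ∀ u : E d, (Real.exp (-‖u‖ ^ 2) / Real.pi ^ ((d : ℝ) / 2)) • f (σ • u + r • x) =
      g (σ • u + r • x) := by
    intro u
    simp only [hg, add_sub_cancel_right, norm_smul, mul_pow, Real.norm_eq_abs, sq_abs, smul_eq_mul]
    rw [mul_div_cancel_left₀ _ (by positivity)]
  simp_rw [h1]
  rw [Measure.integral_comp_smul volume (fun y => g (y + r • x)) σ, integral_add_right_eq_self g,
    smul_eq_mul, ← integral_const_mul, finrank_euclideanSpace_fin, abs_of_pos (by positivity)]
  congr with y
  simp only [hg, mehlerKernel, smul_eq_mul]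
  have h3 : Real.exp (‖y‖ ^ 2 - ‖y - r • x‖ ^ 2 / σ ^ 2) =
      Real.exp (‖y‖ ^ 2) * Real.exp (-(‖y - r • x‖ ^ 2 / σ ^ 2)) := by
    rw [← Real.exp_add, sub_eq_add_neg]
  rw [h3, inv_pow]
  have h2 : Real.exp (-‖y‖ ^ 2) * Real.exp (‖y‖ ^ 2) = 1 := by rw [← Real.exp_add]; simp
  linear_combination (-(σ ^ d)⁻¹ * Real.exp (-(‖y - r • x‖ ^ 2 / σ ^ 2)) * f y /
    Real.pi ^ ((d : ℝ) / 2)) * h2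

lemma abs_exp_sub_one_le_mul_exp (a : ℝ) : |Real.exp a - 1| ≤ |a| * Real.exp |a| := by
  rcases le_total 0 a with h | h
  · rw [abs_of_nonneg h, abs_of_nonneg (by linarith [Real.one_le_exp h])]
    have h1 := Real.add_one_le_exp (-a)
    have h2 : Real.exp (-a) * Real.exp a = 1 := by rw [← Real.exp_add]; simp
    nlinarith [Real.exp_pos a]
  · have h3 : Real.exp a ≤ 1 := Real.exp_le_one_iff.2 h
    rw [abs_of_nonpos h, abs_of_nonpos (by linarith)]
    have h1 := Real.add_one_le_exp a
    have h2 := Real.one_le_exp (neg_nonneg.2 h)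
    nlinarith

/-- For small `r` the kernel is close to `1`, up to a factor of slow Gaussian growth. -/
lemma abs_mehlerKernel_sub_one_le {r δ : ℝ} (hδ : 0 < δ) (hr0 : 0 ≤ r) (hr1 : r ≤ 1 / 2)
    (hrδ : 4 * r ≤ δ) (x y : E d) :
    |mehlerKernel r (Real.sqrt (1 - r ^ 2)) x y - 1| ≤
      ((Real.sqrt (1 - r ^ 2))⁻¹ ^ d * (4 * r / δ) + ((Real.sqrt (1 - r ^ 2))⁻¹ ^ d - 1)) *
        (Real.exp (δ * ‖x‖ ^ 2) * Real.exp (δ * ‖y‖ ^ 2)) := by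
  have hr2 : 0 < 1 - r ^ 2 := by nlinarith
  set σ := Real.sqrt (1 - r ^ 2) with hσ
  have hσ2 : σ ^ 2 = 1 - r ^ 2 := Real.sq_sqrt hr2.le
  have hσ0 : 0 < σ := Real.sqrt_pos.2 hr2
  have hσ1 : σ ≤ 1 := Real.sqrt_le_iff.2 ⟨zero_le_one, by nlinarith⟩
  have hc : 1 ≤ σ⁻¹ ^ d := one_le_pow₀ ((one_le_inv₀ hσ0).2 hσ1)
  set N := ‖x‖ ^ 2 + ‖y‖ ^ 2 with hN
  have hN0 : 0 ≤ N := by positivity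
  set a := ‖y‖ ^ 2 - ‖y - r • x‖ ^ 2 / σ ^ 2 with ha
  have hae : a = (2 * r * inner ℝ y x - r ^ 2 * N) / (1 - r ^ 2) := by
    rw [ha, hσ2, norm_sub_sq_real, norm_smul, inner_smul_right, Real.norm_eq_abs, mul_pow, sq_abs, hN]
    field_simp
    ring
  -- The exponent `a` of the kernel is at most `2 r N ≤ (δ / 2) N`, and `|e^a - 1| ≤ |a| e^{|a|}`.
  have habs : |a| ≤ 2 * r * N := by
    have hin : |inner ℝ y x| ≤ N / 2 := by
      refine (abs_real_inner_le_norm y x).trans ?_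
      nlinarith [sq_nonneg (‖x‖ - ‖y‖)]
    rw [abs_le] at hin
    rw [hae, abs_le, le_div_iff₀ hr2, div_le_iff₀ hr2]
    have h1 : 0 ≤ r * N := by positivity
    have h2 : r * (r * N) ≤ 1 / 2 * (r * N) := mul_le_mul_of_nonneg_right hr1 h1
    have h3 : r * (r * (r * N)) ≤ 1 / 2 * (r * (r * N)) :=
      mul_le_mul_of_nonneg_right hr1 (by positivity)
    have h4 : 2 * r * inner ℝ y x ≤ r * N := by nlinarith
    have h5 : -(r * N) ≤ 2 * r * inner ℝ y x := by nlinarith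
    have h6 : 0 ≤ r * (r * N) := by positivity
    constructor <;> nlinarith
  have hexp : |Real.exp a - 1| ≤ 4 * r / δ * Real.exp (δ * N) := by
    refine (abs_exp_sub_one_le_mul_exp a).trans ?_
    have h1 : |a| ≤ δ / 2 * N := habs.trans (by nlinarith)
    have h2 : δ / 2 * N ≤ Real.exp (δ / 2 * N) := by
      have := Real.add_one_le_exp (δ / 2 * N); linarith
    have h3 : 2 * r * N = 4 * r / δ * (δ / 2 * N) := by field_simp; ring
    calc |a| * Real.exp |a| ≤ (4 * r / δ * Real.exp (δ / 2 * N)) * Real.exp (δ / 2 * N) := by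
          gcongr
          rw [h3] at habs
          exact habs.trans (by gcongr)
      _ = _ := by rw [mul_assoc, ← Real.exp_add]; ring_nf
  have h1 : 1 ≤ Real.exp (δ * N) := Real.one_le_exp (by positivity)
  rw [← Real.exp_add, ← mul_add, ← hN, mehlerKernel, ← ha]
  have e : σ⁻¹ ^ d * Real.exp a - 1 = σ⁻¹ ^ d * (Real.exp a - 1) + (σ⁻¹ ^ d - 1) := by ring
  rw [e]
  refine (abs_add_le _ _).trans ?_
  rw [abs_mul, abs_of_nonneg (by linarith : 0 ≤ σ⁻¹ ^ d), abs_of_nonneg (by linarith : 0 ≤ σ⁻¹ ^ d - 1),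
    add_mul]
  refine add_le_add ?_ ?_
  · rw [mul_assoc]
    gcongr
  · nlinarith

section Gap

variable {p : ℝ≥0∞} [Fact (1 ≤ p)]

/-- The projection of `L^p(γ_d)` onto constants. -/
lemma exists_clm_mean (d : ℕ) :
    ∃ A : Lp ℝ p (gaussian d) →L[ℝ] Lp ℝ p (gaussian d),
      (∀ f : Lp ℝ p (gaussian d), (A f : E d → ℝ) =ᵐ[gaussian d] fun _ => ∫ y, f y ∂(gaussian d)) ∧
      HasSymbol A fun n => if n = 0 then 1 else 0 := by
  let L₀ : Lp ℝ p (gaussian d) →ₗ[ℝ] ℝ :=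
    { toFun := fun f => ∫ y, f y ∂(gaussian d)
      map_add' := fun f g => by
        rw [← integral_add (integrable_coeFn_Lp f) (integrable_coeFn_Lp g)]
        exact integral_congr_ae (Lp.coeFn_add f g)
      map_smul' := fun c f => by
        rw [RingHom.id_apply, smul_eq_mul, ← integral_const_mul]
        exact integral_congr_ae (Lp.coeFn_smul c f) }
  have hL : ∀ f, ‖L₀ f‖ ≤ 1 * ‖f‖ := by
    intro f
    rw [one_mul, Lp.norm_def]
    have h1 : ‖L₀ f‖ ≤ (eLpNorm f 1 (gaussian d)).toReal := by
      rw [eLpNorm_one_eq_lintegral_enorm, ← integral_norm_eq_lintegral_enorm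
        (integrable_coeFn_Lp f).1]
      exact norm_integral_le_integral_norm _
    exact h1.trans (ENNReal.toReal_mono (Lp.memLp f).2.ne
      (eLpNorm_le_eLpNorm_of_exponent_le Fact.out (Lp.memLp f).1))
  have h1 : MemLp (fun _ : E d => (1 : ℝ)) p (gaussian d) := memLp_const 1
  refine ⟨(L₀.mkContinuous 1 hL).smulRight (h1.toLp _), fun f => ?_, fun ν h hh => ?_⟩
  · rw [ContinuousLinearMap.smulRight_apply]
    filter_upwards [Lp.coeFn_smul (L₀.mkContinuous 1 hL f) (h1.toLp _), h1.coeFn_toLp] with x h2 h3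
    rw [h2, Pi.smul_apply, h3, smul_eq_mul, mul_one]
    rfl
  · have h2 : L₀ h = ∫ y, hermite ν y ∂(gaussian d) := integral_congr_ae hh
    have h3 : ∫ y : E d, hermite ν y ∂(gaussian d) =
        hermiteConst ν * ∏ i, (0 : ℝ) ^ ν i := by
      simp_rw [hermite_eq, prodHermite]
      rw [integral_const_mul, integral_gaussian_prod fun i u => (hermitePoly (ν i)).eval u]
      congr 1
      refine Finset.prod_congr rfl fun i _ => ?_
      have h4 := integral_hermitePoly (r := 0) (s := 1) (by norm_num) (ν i) 0
      simp only [one_mul, zero_mul, add_zero] at h4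
      rw [h4, mul_div_assoc, div_self (by positivity), mul_one]
      rcases Nat.eq_zero_or_pos (ν i) with h0 | h0
      · rw [h0]; simp [hermitePoly]
      · rw [zero_pow h0.ne', zero_mul]
    rw [ContinuousLinearMap.smulRight_apply, LinearMap.mkContinuous_apply, h2, h3]
    by_cases hν : ∑ i, ν i = 0
    · have hν0 : ν = 0 := by
        funext i
        exact (Finset.sum_eq_zero_iff.1 hν) i (Finset.mem_univ i)
      have hone : h = h1.toLp _ := by
        ext1
        filter_upwards [hh, h1.coeFn_toLp] with x h5 h6
        rw [h5, h6, hermite_eq, hν0]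
        simp [hermiteConst, prodHermite, hermitePoly]
      beta_reduce
      rw [if_pos hν, hν0, hone]
      simp [hermiteConst]
    · beta_reduce
      rw [if_neg hν]
      obtain ⟨i, hi⟩ : ∃ i, ν i ≠ 0 := by
        by_contra hcon
        push Not at hcon
        exact hν (Finset.sum_eq_zero fun i _ => hcon i)
      rw [Finset.prod_eq_zero (Finset.mem_univ i) (zero_pow hi), mul_zero, zero_smul, zero_smul]

/-- For large times, `T_s - ∫ · dγ` is a strict contraction of `L^p(γ_d)`, because Mehler's kernel
is close to `1`. -/
theorem exists_contraction (d : ℕ) (hp1 : 1 < p) (hp : p ≠ ∞) :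
    ∃ s : ℝ, 0 < s ∧ ∃ S : Lp ℝ p (gaussian d) →L[ℝ] Lp ℝ p (gaussian d), ‖S‖ ≤ 1 / 2 ∧
      HasSymbol S fun n => Real.exp (-(n : ℝ) * s) - if n = 0 then 1 else 0 := by
  have hp0 : p ≠ 0 := (one_pos.trans hp1).ne'
  have hP : 1 < p.toReal := by
    rw [← ENNReal.toReal_one]
    exact (ENNReal.toReal_lt_toReal (by simp) hp).2 hp1
  set P := p.toReal with hPdef
  have hP0 : 0 < P := by linarith
  have hconj := Real.HolderConjugate.conjExponent hP
  set Q := P.conjExponent with hQ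
  have hQ0 : 0 < Q := hconj.symm.pos
  -- With this `δ` the weight `e^{δ|x|²}` belongs to `L^P` and to `L^Q`.
  set δ := 1 / (2 * max P Q) with hδ
  have hmax : 0 < max P Q := lt_max_of_lt_left hP0
  have hδ0 : 0 < δ := by positivity
  have hδP : δ * P < 1 := by
    have : P ≤ max P Q := le_max_left _ _
    rw [hδ, one_div_mul_eq_div, div_lt_one (by positivity)]; linarith
  have hδQ : δ * Q < 1 := by
    have : Q ≤ max P Q := le_max_right _ _
    rw [hδ, one_div_mul_eq_div, div_lt_one (by positivity)]; linarith
  set e : E d → ℝ≥0∞ := fun x => ENNReal.ofReal (Real.exp (δ * ‖x‖ ^ 2)) with he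
  have hem : Measurable e := by fun_prop
  have hefin : ∀ R : ℝ, 0 < R → δ * R < 1 → gnorm R e ≠ ∞ := by
    intro R hR hδR
    refine ENNReal.rpow_ne_top_of_nonneg (by positivity) ?_
    have h1 := (integrable_exp_mul_sq_norm (d := d) hδR).lintegral_lt_top
    refine ne_top_of_le_ne_top h1.ne (le_of_eq (lintegral_congr fun x => ?_))
    simp only [he]
    rw [ENNReal.ofReal_rpow_of_nonneg (by positivity) hR.le, ← Real.exp_mul]
    ring_nf
  set K := (gnorm P e).toReal * (gnorm Q e).toReal with hK
  -- `η r` bounds the deviation of the kernel from `1`.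
  set η : ℝ → ℝ := fun r => (Real.sqrt (1 - r ^ 2))⁻¹ ^ d * (4 * r / δ) +
    ((Real.sqrt (1 - r ^ 2))⁻¹ ^ d - 1) with hη
  have hη0 : Filter.Tendsto (fun s : ℝ => η (Real.exp (-s)) * K) Filter.atTop (nhds 0) := by
    have h1 : ContinuousAt (fun r => η r * K) 0 := by
      have h2 : Real.sqrt (1 - (0 : ℝ) ^ 2) ≠ 0 := by simp
      simp only [hη]
      fun_prop (disch := assumption)
    have h3 : η 0 * K = 0 := by simp [hη]
    have h4 := h1.tendsto
    rw [h3] at h4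
    exact h4.comp Real.tendsto_exp_neg_atTop_nhds_zero
  have hev1 := hη0.eventually (ge_mem_nhds (show (0 : ℝ) < 1 / 2 by norm_num))
  have hev2 := Real.tendsto_exp_neg_atTop_nhds_zero.eventually
    (ge_mem_nhds (show (0 : ℝ) < min (1 / 2) (δ / 4) by positivity))
  obtain ⟨s, ⟨h1, h2⟩, h3⟩ := ((hev1.and hev2).and (Filter.eventually_gt_atTop 0)).exists
  set r := Real.exp (-s) with hr
  have hr0 : 0 ≤ r := by positivity
  have hr1 : r ≤ 1 / 2 := h2.trans (min_le_left _ _)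
  have hrδ : 4 * r ≤ δ := by have := h2.trans (min_le_right _ _); linarith
  have hrr : Real.exp (-2 * s) = r ^ 2 := by rw [hr, ← Real.exp_nat_mul]; push_cast; ring_nf
  set σ := Real.sqrt (1 - r ^ 2) with hσ
  have hσ0 : 0 < σ := Real.sqrt_pos.2 (by nlinarith)
  have hη1 : 0 ≤ η r := by
    have hσ1 : σ ≤ 1 := Real.sqrt_le_iff.2 ⟨zero_le_one, by nlinarith⟩
    have hc : 1 ≤ σ⁻¹ ^ d := one_le_pow₀ ((one_le_inv₀ hσ0).2 hσ1)
    have : 0 ≤ σ⁻¹ ^ d * (4 * r / δ) := by positivity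
    simp only [hη]
    linarith
  have hm : ∀ᵐ t ∂(Measure.dirac s), (0 : ℝ) ≤ t := by
    rw [ae_dirac_eq]; exact h3.le
  have hwi : Integrable (fun _ : ℝ => (1 : ℝ)) (Measure.dirac s) := integrable_const _
  -- `T_s` is the average of the semigroup against the Dirac mass at `s`.
  obtain ⟨T, hT, -⟩ := exists_clm_ouAvg (d := d) (p := p) hp hm measurable_const hwi
  have hTs := hasSymbol_of_ouAvg hp hm measurable_const hwi hT
  obtain ⟨M, hM, hMs⟩ := exists_clm_mean (p := p) d
  refine ⟨s, h3, T - M, ?_, ?_⟩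
  swap
  · have := hTs.sub hMs
    simpa using this
  refine ContinuousLinearMap.opNorm_le_bound _ (by norm_num) fun f => ?_
  have hf := measurable_coeFn_Lp f
  -- the pointwise bound
  set J := ∫⁻ y, ‖f y‖ₑ * e y ∂(gaussian d) with hJ
  have hJle : J ≤ eLpNorm f p (gaussian d) * gnorm Q e := by
    rw [eLpNorm_eq_lintegral_rpow_enorm_toReal hp0 hp]
    exact ENNReal.lintegral_mul_le_Lp_mul_Lq _ hconj hf.enorm.aemeasurable hem.aemeasurable
  have hJt : J ≠ ∞ := ne_top_of_le_ne_top
    (ENNReal.mul_ne_top (Lp.memLp f).2.ne (hefin Q hQ0 hδQ)) hJle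
  have hpt : ∀ᵐ x ∂(gaussian d), ‖(T - M) f x‖ₑ ≤ ENNReal.ofReal (η r) * J * e x := by
    have hTM : ((T - M) f : E d → ℝ) =ᵐ[gaussian d] fun x => T f x - M f x := Lp.coeFn_sub _ _
    filter_upwards [hT f, hM f, hTM, ae_integrable_mehler hm measurable_const hwi hf
      (integrable_coeFn_Lp f)] with x h5 h6 h7 h8
    have hTx : T f x = ∫ y, mehlerKernel r σ x y * f y ∂(gaussian d) := by
      rw [h5, ouAvg, integral_prod _ h8, integral_dirac, ← integral_mehlerKernel hσ0]
      simp only [mehlerPoint, one_mul, hrr, ← hr, ← hσ]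
    have hbound : ∀ y, ‖(mehlerKernel r σ x y - 1) * f y‖ₑ ≤
        ENNReal.ofReal (η r) * e x * (‖f y‖ₑ * e y) := by
      intro y
      rw [enorm_mul, Real.enorm_eq_ofReal_abs]
      have h9 := abs_mehlerKernel_sub_one_le hδ0 hr0 hr1 hrδ x y
      refine (mul_le_mul_left (ENNReal.ofReal_le_ofReal h9) _).trans (le_of_eq ?_)
      rw [ENNReal.ofReal_mul hη1, ENNReal.ofReal_mul (by positivity)]
      simp only [he, hη]
      ring
    have hkm : Measurable fun y => mehlerKernel r σ x y := by
      unfold mehlerKernel; fun_prop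
    have hlint : ∫⁻ y, ‖(mehlerKernel r σ x y - 1) * f y‖ₑ ∂(gaussian d) ≤
        ENNReal.ofReal (η r) * e x * J := by
      refine (lintegral_mono hbound).trans (le_of_eq ?_)
      exact lintegral_const_mul (f := fun y => ‖f y‖ₑ * e y) _ (hf.enorm.mul hem)
    have hint : Integrable (fun y => (mehlerKernel r σ x y - 1) * f y) (gaussian d) := by
      refine ⟨((hkm.sub_const 1).mul hf).aestronglyMeasurable, ?_⟩
      rw [hasFiniteIntegral_iff_enorm]
      exact hlint.trans_lt (ENNReal.mul_lt_top (ENNReal.mul_lt_top ENNReal.ofReal_lt_top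
        ENNReal.ofReal_lt_top) hJt.lt_top)
    have hdiff : T f x - M f x = ∫ y, (mehlerKernel r σ x y - 1) * f y ∂(gaussian d) := by
      have h9 : ∀ y, mehlerKernel r σ x y * f y = (mehlerKernel r σ x y - 1) * f y + f y := by
        intro y; ring
      rw [hTx, h6]
      simp_rw [h9]
      rw [integral_add hint (integrable_coeFn_Lp f), add_sub_cancel_right]
    rw [h7, hdiff]
    refine (enorm_integral_le_lintegral_enorm _).trans (hlint.trans (le_of_eq ?_))
    ring
  have hnorm : eLpNorm ((T - M) f) p (gaussian d) ≤
      ENNReal.ofReal (η r) * gnorm Q e * gnorm P e * eLpNorm f p (gaussian d) := by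
    have h5 : eLpNorm ((T - M) f) p (gaussian d) = gnorm P fun x => ‖(T - M) f x‖ₑ :=
      eLpNorm_eq_lintegral_rpow_enorm_toReal hp0 hp
    rw [h5]
    refine (gnorm_mono hP0 hpt).trans ?_
    rw [gnorm_const_mul hP0 _ (ENNReal.mul_ne_top ENNReal.ofReal_ne_top hJt)]
    calc _ ≤ ENNReal.ofReal (η r) * (eLpNorm f p (gaussian d) * gnorm Q e) * gnorm P e := by gcongr
      _ = _ := by ring
  rw [Lp.norm_def, Lp.norm_def]
  have h5 := ENNReal.toReal_mono (ENNReal.mul_ne_top (ENNReal.mul_ne_top (ENNReal.mul_ne_top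
    ENNReal.ofReal_ne_top (hefin Q hQ0 hδQ)) (hefin P hP0 hδP)) (Lp.memLp f).2.ne) hnorm
  refine h5.trans ?_
  rw [ENNReal.toReal_mul, ENNReal.toReal_mul, ENNReal.toReal_mul, ENNReal.toReal_ofReal hη1]
  refine mul_le_mul_of_nonneg_right ?_ ENNReal.toReal_nonneg
  refine le_trans (le_of_eq ?_) h1
  rw [hK]; ring

/-! ### Existence and uniqueness of the Riesz potential -/

/-- The pieces `∫_{ns}^{(n+1)s} y^{b-1} e^{-ky} dy` sum up to `Γ(b) k^{-b}`. -/
lemma hasSum_gamma_pieces {b s k : ℝ} (hb : 0 < b) (hs : 0 < s) (hk : 0 < k) :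
    HasSum (fun n : ℕ => Real.exp (-k * s) ^ n *
      ∫ y in Ioc 0 s, (y + n * s) ^ (b - 1) * Real.exp (-k * y)) (k ^ (-b) * Real.Gamma b) := by
  have hint : IntegrableOn (fun y : ℝ => y ^ (b - 1) * Real.exp (-k * y)) (Ioi 0) := by
    simpa using integrableOn_rpow_mul_exp_neg_mul_rpow (p := 1) (s := b - 1) (b := k)
      (by linarith) one_pos hk
  have hval : ∫ y in Ioi (0:ℝ), y ^ (b - 1) * Real.exp (-k * y) = k ^ (-b) * Real.Gamma b := by
    have := Real.integral_rpow_mul_exp_neg_mul_Ioi hb hk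
    simp only [← neg_mul] at this
    rw [this, one_div, Real.inv_rpow hk.le, ← Real.rpow_neg hk.le]
  have hpiece : ∀ n : ℕ, Real.exp (-k * s) ^ n *
      ∫ y in Ioc 0 s, (y + n * s) ^ (b - 1) * Real.exp (-k * y) =
      ∫ y in (n * s)..((n + 1 : ℕ) * s), y ^ (b - 1) * Real.exp (-k * y) := by
    intro n
    rw [← intervalIntegral.integral_of_le hs.le, ← intervalIntegral.integral_const_mul]
    have h1 : ∀ y : ℝ, Real.exp (-k * s) ^ n * ((y + n * s) ^ (b - 1) * Real.exp (-k * y)) =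
        (fun y : ℝ => y ^ (b - 1) * Real.exp (-k * y)) (y + n * s) := by
      intro y
      simp only
      rw [← Real.exp_nat_mul, mul_left_comm, ← Real.exp_add]
      ring_nf
    simp_rw [h1]
    rw [intervalIntegral.integral_comp_add_right (fun y : ℝ => y ^ (b - 1) * Real.exp (-k * y)) (n * s)]
    congr 1
    · ring
    · push_cast; ring
  simp_rw [hpiece]
  rw [hasSum_iff_tendsto_nat_of_nonneg]
  · have h1 : ∀ N : ℕ, ∑ n ∈ Finset.range N,
        ∫ y in (n * s)..((n + 1 : ℕ) * s), y ^ (b - 1) * Real.exp (-k * y) =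
        ∫ y in (0:ℝ)..(N * s), y ^ (b - 1) * Real.exp (-k * y) := by
      intro N
      have := intervalIntegral.sum_integral_adjacent_intervals (μ := volume)
        (f := fun y : ℝ => y ^ (b - 1) * Real.exp (-k * y)) (a := fun n : ℕ => (n : ℝ) * s) (n := N)
        (fun n _ => by
          rw [intervalIntegrable_iff_integrableOn_Ioc_of_le (by push_cast; nlinarith)]
          exact hint.mono_set fun y hy => lt_of_le_of_lt (by positivity : 0 ≤ (n : ℝ) * s) hy.1)
      simpa using this
    simp_rw [h1]
    rw [← hval]
    refine intervalIntegral_tendsto_integral_Ioi 0 hint ?_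
    exact tendsto_natCast_atTop_atTop.atTop_mul_const hs
  · intro n
    refine intervalIntegral.integral_nonneg (by push_cast; nlinarith) fun y hy => ?_
    have : 0 ≤ y := le_trans (by positivity) hy.1
    positivity

/-- The Riesz potential is obtained from `λ^{-b} Γ(b) = ∑ₙ e^{-nsλ} ∫_0^s (y + ns)^{b-1} e^{-λy} dy`
with `b = β / 2`: the series of operators converges because `e^{-nsλ}` is the symbol of the `n`-th
power of a strict contraction. -/
theorem exists_riesz (d : ℕ) (hp1 : 1 < p) (hp : p ≠ ∞) {β : ℝ} (hβ : 0 < β) :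
    ∃ A : Lp ℝ p (gaussian d) →L[ℝ] Lp ℝ p (gaussian d), HasSymbol A (rieszSymbol β) := by
  obtain ⟨s, hs, S, hSn, hSs⟩ := exists_contraction (p := p) d hp1 hp
  obtain ⟨M, -, hMs⟩ := exists_clm_mean (p := p) d
  set b := β / 2 with hb
  have hb0 : 0 < b := by positivity
  have hm : ∀ᵐ y ∂(volume.restrict (Ioc 0 s)), (0 : ℝ) ≤ y := by
    filter_upwards [self_mem_ae_restrict measurableSet_Ioc] with y hy using hy.1.le
  have hw : ∀ n : ℕ, Measurable fun y : ℝ => (y + n * s) ^ (b - 1) := fun n => by fun_prop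
  have hii : ∀ n : ℕ, IntervalIntegrable (fun y : ℝ => (y + n * s) ^ (b - 1)) volume 0 s := by
    intro n
    have := (intervalIntegral.intervalIntegrable_rpow' (a := 0 + n * s) (b := s + n * s)
      (by linarith : -1 < b - 1)).comp_add_right (n * s)
    simpa using this
  have hwi : ∀ n : ℕ, Integrable (fun y : ℝ => (y + n * s) ^ (b - 1))
      (volume.restrict (Ioc 0 s)) := fun n => (hii n).1
  choose A hA hAn using fun n : ℕ => exists_clm_ouAvg (d := d) (p := p) hp hm (hw n) (hwi n)
  have hAs := fun n : ℕ => hasSymbol_of_ouAvg hp hm (hw n) (hwi n) (hA n)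
  have hAb : ∀ n : ℕ, ‖A n‖ ≤ (((n + 1 : ℕ) : ℝ) * s) ^ b / b := by
    intro n
    refine (hAn n).trans ?_
    have h1 : ∫ y in Ioc 0 s, |(y + n * s) ^ (b - 1)| = ∫ y in (0:ℝ)..s, (y + n * s) ^ (b - 1) := by
      rw [intervalIntegral.integral_of_le hs.le]
      refine setIntegral_congr_fun measurableSet_Ioc fun y hy => ?_
      have : 0 ≤ y + n * s := by have := hy.1; positivity
      exact abs_of_nonneg (Real.rpow_nonneg this _)
    rw [h1, intervalIntegral.integral_comp_add_right fun y => y ^ (b - 1),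
      integral_rpow (Or.inl (by linarith))]
    simp only [sub_add_cancel, zero_add]
    gcongr
    have : 0 ≤ ((n : ℝ) * s) ^ b := by positivity
    have e : s + n * s = ((n + 1 : ℕ) : ℝ) * s := by push_cast; ring
    rw [e]; linarith
  set B : ℕ → Lp ℝ p (gaussian d) →L[ℝ] Lp ℝ p (gaussian d) := fun n =>
    (S ^ n).comp ((A n).comp (ContinuousLinearMap.id ℝ _ - M)) with hB
  have hBs : ∀ n, HasSymbol (B n) fun k => (Real.exp (-(k : ℝ) * s) - if k = 0 then 1 else 0) ^ n *
      ((∫ y in Ioc 0 s, (y + n * s) ^ (b - 1) * Real.exp (-(k : ℝ) * y)) *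
        (1 - if k = 0 then 1 else 0)) := fun n =>
    (hSs.pow n).comp ((hAs n).comp (hasSymbol_id.sub hMs))
  -- `‖A n‖` grows polynomially in `n`, while `‖S ^ n‖ ≤ 2^{-n}`.
  have hsum : Summable B := by
    obtain ⟨k, hk⟩ := exists_nat_ge b
    have h1 : Summable fun n : ℕ => ((n : ℝ)) ^ k * (1 / 2 : ℝ) ^ n :=
      summable_pow_mul_geometric_of_norm_lt_one k (by norm_num)
    have h2 := ((summable_nat_add_iff 1).2 h1).mul_left
      (2 * (s ^ b / b * ‖ContinuousLinearMap.id ℝ (Lp ℝ p (gaussian d)) - M‖))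
    refine Summable.of_norm_bounded h2 fun n => ?_
    have h3 : ‖B n‖ ≤ (1 / 2) ^ n * ((((n + 1 : ℕ) : ℝ) * s) ^ b / b *
        ‖ContinuousLinearMap.id ℝ (Lp ℝ p (gaussian d)) - M‖) := by
      refine (ContinuousLinearMap.opNorm_comp_le _ _).trans (mul_le_mul ?_ ?_ (norm_nonneg _)
        (by positivity))
      · rcases Nat.eq_zero_or_pos n with rfl | hn
        · rw [pow_zero, pow_zero]
          exact ContinuousLinearMap.norm_id_le
        · exact (norm_pow_le' S hn).trans (by gcongr)
      · refine (ContinuousLinearMap.opNorm_comp_le _ _).trans ?_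
        gcongr
        exact hAb n
    refine h3.trans ?_
    have h4 : (((n + 1 : ℕ) : ℝ) * s) ^ b ≤ ((n + 1 : ℕ) : ℝ) ^ k * s ^ b := by
      rw [Real.mul_rpow (by positivity) hs.le]
      gcongr
      rw [← Real.rpow_natCast]
      exact Real.rpow_le_rpow_of_exponent_le (by push_cast; linarith [(Nat.cast_nonneg n : (0:ℝ) ≤ n)]) hk
    have h5 : (1 / 2 : ℝ) ^ n = 2 * (1 / 2) ^ (n + 1) := by rw [pow_succ]; ring
    rw [h5]
    calc _ ≤ 2 * (1 / 2) ^ (n + 1) * ((((n + 1 : ℕ) : ℝ) ^ k * s ^ b) / b *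
        ‖ContinuousLinearMap.id ℝ (Lp ℝ p (gaussian d)) - M‖) := by gcongr
      _ = _ := by ring
  refine ⟨(Real.Gamma b)⁻¹ • ∑' n, B n, ?_⟩
  have hΓ : Real.Gamma b ≠ 0 := (Real.Gamma_pos_of_pos hb0).ne'
  intro ν h hh
  have h1 : HasSum (fun n => B n h) ((∑' n, B n) h) :=
    hsum.hasSum.mapL (ContinuousLinearMap.apply ℝ (Lp ℝ p (gaussian d)) h)
  have h2 : HasSum (fun n => B n h) ((rieszSymbol β (∑ i, ν i) * Real.Gamma b) • h) := by
    have h3 : ∀ n, B n h = _ := fun n => hBs n ν h hh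
    simp_rw [h3]
    refine HasSum.smul_const ?_ h
    by_cases h0 : ∑ i, ν i = 0
    · simp [h0, rieszSymbol]
    · simp only [h0, if_false, sub_zero, mul_one, rieszSymbol]
      exact hasSum_gamma_pieces hb0 hs (by exact_mod_cast Nat.pos_of_ne_zero h0)
  rw [smul_apply, h1.unique h2, smul_smul, mul_comm, mul_assoc, mul_inv_cancel₀ hΓ, mul_one]

end Gap

/-! ### The subordination kernel and its time derivatives -/

/-- The polynomials `p_k` with `∂_t^k (t s^{-3/2} e^{-t²/4s}) = s^{-1-k/2} p_k(t/√s) e^{-t²/4s}`. -/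
def poissonPoly : ℕ → Polynomial ℝ
  | 0 => Polynomial.X
  | k + 1 => Polynomial.derivative (poissonPoly k) -
      Polynomial.C (1 / 2) * Polynomial.X * poissonPoly k

/-- The `k`-th derivative in `t` of the density `(2√π)⁻¹ t s^{-3/2} e^{-t²/4s}` which subordinates
the Poisson–Hermite semigroup to the Ornstein–Uhlenbeck semigroup. -/
def poissonKernel (k : ℕ) (t s : ℝ) : ℝ :=
  (2 * Real.sqrt Real.pi)⁻¹ * (Real.sqrt s)⁻¹ ^ (k + 2) *
    ((poissonPoly k).eval (t * (Real.sqrt s)⁻¹) * Real.exp (-(t * (Real.sqrt s)⁻¹) ^ 2 / 4))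

lemma hasDerivAt_poissonKernel (k : ℕ) (t s : ℝ) :
    HasDerivAt (fun t => poissonKernel k t s) (poissonKernel (k + 1) t s) t := by
  unfold poissonKernel
  set a := (Real.sqrt s)⁻¹
  have h1 : HasDerivAt (fun t : ℝ => t * a) a t := by
    simpa using (hasDerivAt_id t).mul_const a
  have h2 := ((poissonPoly k).hasDerivAt (t * a)).comp t h1
  have h3 : HasDerivAt (fun t : ℝ => Real.exp (-(t * a) ^ 2 / 4))
      (Real.exp (-(t * a) ^ 2 / 4) * (-(2 * (t * a) * a) / 4)) t := by
    refine HasDerivAt.exp ?_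
    have := ((h1.pow 2).neg).div_const 4
    refine this.congr_deriv ?_
    norm_num
  refine ((h2.mul h3).const_mul ((2 * Real.sqrt Real.pi)⁻¹ * a ^ (k + 2))).congr_deriv ?_
  simp only [poissonPoly, Polynomial.eval_sub, Polynomial.eval_mul, Polynomial.eval_C,
    Polynomial.eval_X, Function.comp_apply]
  ring

@[fun_prop]
lemma measurable_poissonKernel (k : ℕ) : Measurable fun z : ℝ × ℝ => poissonKernel k z.1 z.2 := by
  unfold poissonKernel
  have h1 : Measurable fun z : ℝ × ℝ => z.1 * (Real.sqrt z.2)⁻¹ := by fun_prop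
  have h2 : Measurable fun z : ℝ × ℝ => (poissonPoly k).eval (z.1 * (Real.sqrt z.2)⁻¹) :=
    (poissonPoly k).continuous.measurable.comp h1
  fun_prop

lemma measurable_poissonKernel_right (k : ℕ) (t : ℝ) : Measurable (poissonKernel k t) :=
  (measurable_poissonKernel k).comp (measurable_const.prodMk measurable_id)

lemma poissonKernel_zero (t : ℝ) {s : ℝ} (hs : 0 < s) :
    poissonKernel 0 t s =
      (2 * Real.sqrt Real.pi)⁻¹ * (t / (s * Real.sqrt s)) * Real.exp (-(t ^ 2 / (4 * s))) := by
  have h1 : Real.sqrt s * Real.sqrt s = s := Real.mul_self_sqrt hs.le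
  have h2 := Real.sqrt_pos.2 hs
  simp only [poissonKernel, poissonPoly, Polynomial.eval_X]
  have e1 : (t * (Real.sqrt s)⁻¹) ^ 2 = t ^ 2 / s := by
    rw [mul_pow, inv_pow, Real.sq_sqrt hs.le, div_eq_mul_inv]
  have e2 : -(t ^ 2 / s) / 4 = -(t ^ 2 / (4 * s)) := by field_simp
  rw [e1, e2]
  have e3 : (Real.sqrt s)⁻¹ ^ (0 + 2) * (t * (Real.sqrt s)⁻¹) = t / (s * Real.sqrt s) := by
    rw [zero_add, inv_pow, Real.sq_sqrt hs.le, div_eq_mul_inv, mul_inv]; ring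
  rw [← e3]; ring

lemma kap_eq {t s : ℝ} (hs : 0 < s) : kap t s = (Real.sqrt s)⁻¹ ^ 2 *
    (t * (Real.sqrt s)⁻¹) * (1 + (t * (Real.sqrt s)⁻¹) ^ 2) ^ (-(3 / 2) : ℝ) := by
  have h2 := Real.sqrt_pos.2 hs
  have e1 : s + t ^ 2 = Real.sqrt s ^ 2 * (1 + (t * (Real.sqrt s)⁻¹) ^ 2) := by
    nth_rewrite 1 [← Real.sq_sqrt hs.le]
    field_simp
  have e2 : (Real.sqrt s ^ 2) ^ (-(3 / 2) : ℝ) = (Real.sqrt s)⁻¹ ^ 3 := by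
    rw [← Real.rpow_natCast (Real.sqrt s), ← Real.rpow_mul h2.le, inv_pow, ← Real.rpow_natCast,
      ← Real.rpow_neg h2.le]
    norm_num
  rw [kap, e1, Real.mul_rpow (by positivity) (by positivity), e2]
  ring

/-- Time derivatives of the subordination kernel are dominated by the algebraic kernel `kap`. -/
lemma exists_abs_poissonKernel_le (k : ℕ) : ∃ C : ℝ, 0 ≤ C ∧ ∀ t s : ℝ, 0 < t → 0 < s →
    t ^ k * |poissonKernel k t s| ≤ C * kap t s := by
  -- `X` divides `X ^ k * poissonPoly k` also when `k = 0`.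
  obtain ⟨r, hr⟩ : ∃ r : Polynomial ℝ, Polynomial.X ^ k * poissonPoly k = Polynomial.X * r := by
    rcases k with _ | k
    · exact ⟨1, by simp [poissonPoly]⟩
    · exact ⟨Polynomial.X ^ k * poissonPoly (k + 1), by ring⟩
  obtain ⟨C, hC, hCle⟩ := exists_abs_eval_le (r * (1 + Polynomial.X ^ 2) ^ 2)
    (show (0 : ℝ) < 1 / 4 by norm_num)
  refine ⟨(2 * Real.sqrt Real.pi)⁻¹ * C, by positivity, fun t s ht hs => ?_⟩
  have h2 := Real.sqrt_pos.2 hs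
  rw [kap_eq hs, poissonKernel]
  set a := (Real.sqrt s)⁻¹ with ha
  have ha0 : 0 < a := by positivity
  set y := t * a with hy
  have hy0 : 0 < y := by positivity
  have hre : y ^ k * (poissonPoly k).eval y = y * r.eval y := by
    have := congrArg (Polynomial.eval y) hr
    simpa using this
  have hb := hCle y
  simp only [Polynomial.eval_mul, Polynomial.eval_pow, Polynomial.eval_add, Polynomial.eval_one,
    Polynomial.eval_X] at hb
  rw [abs_mul, abs_of_pos (by positivity : 0 < (1 + y ^ 2) ^ 2)] at hb
  have h3 : (1 + y ^ 2) ^ (-(2 : ℝ)) ≤ (1 + y ^ 2) ^ (-(3 / 2) : ℝ) :=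
    Real.rpow_le_rpow_of_exponent_le (by nlinarith [sq_nonneg y]) (by norm_num)
  have h4 : (1 + y ^ 2) ^ (-(2 : ℝ)) = ((1 + y ^ 2) ^ 2)⁻¹ := by
    rw [Real.rpow_neg (by positivity), Real.rpow_ofNat]
  have h5 : |r.eval y| * Real.exp (-y ^ 2 / 4) ≤ C * (1 + y ^ 2) ^ (-(3 / 2) : ℝ) := by
    refine le_trans ?_ (mul_le_mul_of_nonneg_left (h4 ▸ h3) hC)
    rw [← div_eq_mul_inv, le_div_iff₀ (by positivity)]
    have e : C = C * Real.exp (1 / 4 * y ^ 2) * Real.exp (-y ^ 2 / 4) := by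
      rw [mul_assoc, ← Real.exp_add]; ring_nf; simp
    rw [e, mul_right_comm]
    gcongr
  calc t ^ k * |(2 * Real.sqrt Real.pi)⁻¹ * a ^ (k + 2) *
        ((poissonPoly k).eval y * Real.exp (-y ^ 2 / 4))|
      = (2 * Real.sqrt Real.pi)⁻¹ * a ^ 2 * |y ^ k * (poissonPoly k).eval y| *
          Real.exp (-y ^ 2 / 4) := by
        rw [abs_mul, abs_mul, abs_mul, abs_mul, abs_of_pos (Real.exp_pos _),
          abs_of_pos (by positivity : 0 < (2 * Real.sqrt Real.pi)⁻¹),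
          abs_of_pos (by positivity : 0 < a ^ (k + 2)), abs_of_pos (by positivity : 0 < y ^ k), hy,
          mul_pow, pow_add]
        ring
    _ = (2 * Real.sqrt Real.pi)⁻¹ * a ^ 2 * y * (|r.eval y| * Real.exp (-y ^ 2 / 4)) := by
        rw [hre, abs_mul, abs_of_pos hy0]; ring
    _ ≤ (2 * Real.sqrt Real.pi)⁻¹ * a ^ 2 * y * (C * (1 + y ^ 2) ^ (-(3 / 2) : ℝ)) := by gcongr
    _ = _ := by ring

/-- Up to constants the kernels `kap t` with `t` in a compact set are comparable. -/
lemma kap_le_mul_kap {t u a b s : ℝ} (hs : 0 ≤ s) (hu : 0 < u) (ha : 0 < a) (ha1 : a ≤ 1)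
    (hb : t ≤ b * u) (hau : a * u ≤ t) : kap t s ≤ b * (a ^ 2) ^ (-(3 / 2) : ℝ) * kap u s := by
  have hau0 : 0 < a * u := by positivity
  have ht : 0 < t := hau0.trans_le hau
  have h1 : a ^ 2 * (s + u ^ 2) ≤ s + t ^ 2 := by
    have h2 : (a * u) ^ 2 ≤ t ^ 2 := by gcongr
    have h3 : a ^ 2 ≤ 1 := by nlinarith
    nlinarith
  unfold kap
  calc t * (s + t ^ 2) ^ (-(3 / 2) : ℝ) ≤ (b * u) * (a ^ 2 * (s + u ^ 2)) ^ (-(3 / 2) : ℝ) := by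
        refine mul_le_mul hb (Real.rpow_le_rpow_of_nonpos (by positivity) h1 (by norm_num))
          (by positivity) (by linarith)
    _ = _ := by rw [Real.mul_rpow (by positivity) (by positivity)]; ring

/-- Integrability against one of the kernels `kap t` amounts to integrability against all. -/
lemma integrable_kap_mul {g : ℝ → ℝ}
    (hg : Integrable (fun s => kap 1 s * g s) (volume.restrict (Ioi 0)))
    (hgm : AEStronglyMeasurable g (volume.restrict (Ioi 0))) {t : ℝ} (ht : 0 < t) :
    Integrable (fun s => kap t s * g s) (volume.restrict (Ioi 0)) := by
  have hk : AEStronglyMeasurable (fun s => kap t s) (volume.restrict (Ioi 0)) :=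
    (measurable_kap.comp (measurable_const.prodMk measurable_id)).aestronglyMeasurable
  refine (hg.norm.const_mul (t * (min 1 t ^ 2) ^ (-(3 / 2) : ℝ))).mono' (hk.mul hgm) ?_
  filter_upwards [self_mem_ae_restrict measurableSet_Ioi] with s hs
  have hs0 : (0 : ℝ) < s := hs
  rw [norm_mul, norm_mul, ← mul_assoc, Real.norm_of_nonneg (kap_nonneg ht.le hs0.le),
    Real.norm_of_nonneg (kap_nonneg zero_le_one hs0.le)]
  gcongr
  exact kap_le_mul_kap hs0.le one_pos (lt_min one_pos ht) (min_le_left _ _) (by simp)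
    (by simp)

lemma integrable_poissonKernel_mul {g : ℝ → ℝ}
    (hg : ∀ t : ℝ, 0 < t → Integrable (fun s => kap t s * g s) (volume.restrict (Ioi 0)))
    (hgm : AEStronglyMeasurable g (volume.restrict (Ioi 0))) (k : ℕ) {t : ℝ} (ht : 0 < t) :
    Integrable (fun s => poissonKernel k t s * g s) (volume.restrict (Ioi 0)) := by
  obtain ⟨C, hC, hCle⟩ := exists_abs_poissonKernel_le k
  refine (((hg t ht).norm).const_mul ((t ^ k)⁻¹ * C)).mono'
    ((measurable_poissonKernel_right k t).aestronglyMeasurable.mul hgm) ?_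
  filter_upwards [self_mem_ae_restrict measurableSet_Ioi] with s hs
  have hs0 : (0 : ℝ) < s := hs
  have h1 := hCle t s ht hs0
  rw [norm_mul, norm_mul, Real.norm_of_nonneg (kap_nonneg ht.le hs0.le), ← mul_assoc,
    Real.norm_eq_abs]
  gcongr
  rw [mul_assoc, ← div_eq_inv_mul, le_div_iff₀ (by positivity), mul_comm]
  exact h1

lemma hasDerivAt_integral_poissonKernel {g : ℝ → ℝ}
    (hg : ∀ t : ℝ, 0 < t → Integrable (fun s => kap t s * g s) (volume.restrict (Ioi 0)))
    (hgm : AEStronglyMeasurable g (volume.restrict (Ioi 0))) (k : ℕ) {t : ℝ} (ht : 0 < t) :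
    HasDerivAt (fun t => ∫ s in Ioi (0:ℝ), poissonKernel k t s * g s)
      (∫ s in Ioi (0:ℝ), poissonKernel (k + 1) t s * g s) t := by
  obtain ⟨C, hC, hCle⟩ := exists_abs_poissonKernel_le (k + 1)
  set D := ((t / 2) ^ (k + 1))⁻¹ * C * (2 * ((1 / 2) ^ 2) ^ (-(3 / 2) : ℝ)) with hD
  refine (hasDerivAt_integral_of_dominated_loc_of_deriv_le (F := fun t s => poissonKernel k t s * g s)
    (F' := fun t s => poissonKernel (k + 1) t s * g s)
    (bound := fun s => D * ‖kap t s * g s‖)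
    (Ioo_mem_nhds (by linarith : t / 2 < t) (by linarith : t < 2 * t)) ?_
    (integrable_poissonKernel_mul hg hgm k ht)
    (integrable_poissonKernel_mul hg hgm (k + 1) ht).1 ?_ ((hg t ht).norm.const_mul D) ?_).2
  · exact Filter.Eventually.of_forall fun u =>
      (measurable_poissonKernel_right k u).aestronglyMeasurable.mul hgm
  · filter_upwards [self_mem_ae_restrict measurableSet_Ioi] with s hs u hu
    have hs0 : (0 : ℝ) < s := hs
    have hu0 : 0 < u := lt_trans (by positivity) hu.1
    have h1 := hCle u s hu0 hs0
    rw [norm_mul, norm_mul, Real.norm_of_nonneg (kap_nonneg ht.le hs0.le), ← mul_assoc,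
      Real.norm_eq_abs]
    gcongr
    have h2 : kap u s ≤ 2 * ((1 / 2) ^ 2) ^ (-(3 / 2) : ℝ) * kap t s :=
      kap_le_mul_kap hs0.le ht (by norm_num) (by norm_num) hu.2.le (by linarith [hu.1])
    have h3 : |poissonKernel (k + 1) u s| ≤ (u ^ (k + 1))⁻¹ * (C * kap u s) := by
      rw [← div_eq_inv_mul, le_div_iff₀ (by positivity), mul_comm]; exact h1
    calc _ ≤ (u ^ (k + 1))⁻¹ * (C * kap u s) := h3
      _ ≤ ((t / 2) ^ (k + 1))⁻¹ * (C * (2 * ((1 / 2) ^ 2) ^ (-(3 / 2) : ℝ) * kap t s)) := by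
          have := kap_nonneg ht.le hs0.le
          have := hu.1
          gcongr
          exact mul_nonneg hC (kap_nonneg hu0.le hs0.le)
      _ = _ := by rw [hD]; ring
  · exact Filter.Eventually.of_forall fun s u _ => (hasDerivAt_poissonKernel k u s).mul_const (g s)

lemma iteratedDeriv_integral_poissonKernel {g : ℝ → ℝ}
    (hg : ∀ t : ℝ, 0 < t → Integrable (fun s => kap t s * g s) (volume.restrict (Ioi 0)))
    (hgm : AEStronglyMeasurable g (volume.restrict (Ioi 0))) (k : ℕ) : ∀ {t : ℝ}, 0 < t →
    iteratedDeriv k (fun t => ∫ s in Ioi (0:ℝ), poissonKernel 0 t s * g s) t =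
      ∫ s in Ioi (0:ℝ), poissonKernel k t s * g s := by
  induction k with
  | zero => intro t _; rw [iteratedDeriv_zero]
  | succ k ih =>
    intro t ht
    rw [iteratedDeriv_succ, ← (hasDerivAt_integral_poissonKernel hg hgm k ht).deriv]
    refine Filter.EventuallyEq.deriv_eq ?_
    filter_upwards [Ioi_mem_nhds ht] with u hu using ih hu

lemma integrable_kap {t : ℝ} (ht : 0 < t) : Integrable (kap t) (volume.restrict (Ioi 0)) := by
  refine ⟨(measurable_kap.comp (measurable_const.prodMk measurable_id)).aestronglyMeasurable, ?_⟩
  rw [hasFiniteIntegral_iff_enorm]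
  have h1 : ∫⁻ s in Ioi (0:ℝ), ‖kap t s‖ₑ = 2 := by
    rw [← lintegral_kap ht]
    refine setLIntegral_congr_fun measurableSet_Ioi fun s hs => ?_
    exact Real.enorm_of_nonneg (kap_nonneg ht.le (le_of_lt hs))
  rw [h1]; simp

lemma integrable_poissonKernel (k : ℕ) {t : ℝ} (ht : 0 < t) :
    Integrable (poissonKernel k t) (volume.restrict (Ioi 0)) := by
  have := integrable_poissonKernel_mul (g := fun _ => 1)
    (fun t ht => by simpa using integrable_kap ht) aestronglyMeasurable_const k ht
  simpa using this

/-! ### The Laplace transform of the subordination kernel -/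

/-- The primitive of the Gaussian vanishing at the origin. -/
def gaussPrim (z : ℝ) : ℝ := ∫ v in (0:ℝ)..z, Real.exp (-v ^ 2)

lemma hasDerivAt_gaussPrim (z : ℝ) : HasDerivAt gaussPrim (Real.exp (-z ^ 2)) z :=
  (Continuous.integral_hasStrictDerivAt (f := fun v : ℝ => Real.exp (-v ^ 2)) (by fun_prop)
    0 z).hasDerivAt

lemma gaussPrim_neg (z : ℝ) : gaussPrim (-z) = -gaussPrim z := by
  unfold gaussPrim
  have := intervalIntegral.integral_comp_neg (a := 0) (b := z) fun v : ℝ => Real.exp (-v ^ 2)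
  simp only [neg_sq, neg_zero] at this
  rw [this, ← intervalIntegral.integral_symm]

lemma gaussPrim_tendsto_atTop :
    Filter.Tendsto gaussPrim Filter.atTop (nhds (Real.sqrt Real.pi / 2)) := by
  have h1 := integral_gaussian_Ioi 1
  simp only [neg_mul, one_mul, div_one] at h1
  rw [← h1]
  refine intervalIntegral_tendsto_integral_Ioi 0 ?_ Filter.tendsto_id
  have := (integrable_exp_neg_mul_sq (b := 1) one_pos)
  simp only [neg_mul, one_mul] at this
  exact this.integrableOn

lemma gaussPrim_tendsto_atBot :
    Filter.Tendsto gaussPrim Filter.atBot (nhds (-(Real.sqrt Real.pi / 2))) := by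
  have h1 : gaussPrim = fun z => -gaussPrim (-z) := by funext z; rw [gaussPrim_neg, neg_neg]
  rw [h1]
  exact (gaussPrim_tendsto_atTop.comp Filter.tendsto_neg_atBot_atTop).neg

/-- A primitive in `s` of `e^{-c²s}` times the subordination kernel. -/
def subordPrim (c t s : ℝ) : ℝ :=
  (Real.sqrt Real.pi)⁻¹ *
    (Real.exp (-(c * t)) * gaussPrim (c * Real.sqrt s - t / 2 * (Real.sqrt s)⁻¹) +
      Real.exp (c * t) * gaussPrim (-(c * Real.sqrt s) - t / 2 * (Real.sqrt s)⁻¹))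

lemma hasDerivAt_subordPrim (c t : ℝ) {s : ℝ} (hs : 0 < s) :
    HasDerivAt (subordPrim c t) (poissonKernel 0 t s * Real.exp (-c ^ 2 * s)) s := by
  have h2 := Real.sqrt_pos.2 hs
  have hsq : Real.sqrt s ^ 2 = s := Real.sq_sqrt hs.le
  have d1 := Real.hasDerivAt_sqrt hs.ne'
  have d2 := d1.inv h2.ne'
  have d3 := (d1.const_mul c).sub (d2.const_mul (t / 2))
  have d4 := (d1.const_mul c).neg.sub (d2.const_mul (t / 2))
  have d5 := (((hasDerivAt_gaussPrim _).comp s d3).const_mul (Real.exp (-(c * t)))).add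
    (((hasDerivAt_gaussPrim _).comp s d4).const_mul (Real.exp (c * t)))
  refine (d5.const_mul (Real.sqrt Real.pi)⁻¹).congr_deriv ?_
  rw [poissonKernel_zero t hs]
  simp only [Pi.sub_apply, Pi.neg_apply, Pi.inv_apply]
  have e0 : Real.exp (-(t ^ 2 / (4 * s))) * Real.exp (-c ^ 2 * s) =
      Real.exp (-(c * t)) * Real.exp (-(c * Real.sqrt s - t / 2 * (Real.sqrt s)⁻¹) ^ 2) := by
    rw [← Real.exp_add, ← Real.exp_add]
    congr 1
    field_simp
    rw [hsq]
    ring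
  have e1 : Real.exp (-(t ^ 2 / (4 * s))) * Real.exp (-c ^ 2 * s) =
      Real.exp (c * t) * Real.exp (-(-(c * Real.sqrt s) - t / 2 * (Real.sqrt s)⁻¹) ^ 2) := by
    rw [← Real.exp_add, ← Real.exp_add]
    congr 1
    field_simp
    rw [hsq]
    ring
  have e2 : ∀ A B : ℝ, Real.exp (-(c * t)) *
        (Real.exp (-(c * Real.sqrt s - t / 2 * (Real.sqrt s)⁻¹) ^ 2) * A) +
      Real.exp (c * t) *
        (Real.exp (-(-(c * Real.sqrt s) - t / 2 * (Real.sqrt s)⁻¹) ^ 2) * B) =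
      Real.exp (-(t ^ 2 / (4 * s))) * Real.exp (-c ^ 2 * s) * (A + B) := by
    intro A B
    rw [mul_add]
    nth_rewrite 1 [e0]
    rw [e1]
    ring
  rw [e2]
  have hpi : 0 < Real.sqrt Real.pi := Real.sqrt_pos.2 Real.pi_pos
  rw [hsq]
  field_simp
  ring

lemma subordPrim_tendsto_zero (c : ℝ) {t : ℝ} (ht : 0 < t) :
    Filter.Tendsto (subordPrim c t) (nhdsWithin 0 (Ioi 0))
      (nhds (-((Real.exp (-(c * t)) + Real.exp (c * t)) / 2))) := by
  have h1 : Filter.Tendsto Real.sqrt (nhdsWithin 0 (Ioi 0)) (nhds 0) := by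
    have := (Real.continuous_sqrt.tendsto 0)
    rw [Real.sqrt_zero] at this
    exact this.mono_left nhdsWithin_le_nhds
  have h1' : Filter.Tendsto Real.sqrt (nhdsWithin 0 (Ioi 0)) (nhdsWithin 0 (Ioi 0)) := by
    refine tendsto_nhdsWithin_iff.2 ⟨h1, ?_⟩
    filter_upwards [self_mem_nhdsWithin] with s hs using Real.sqrt_pos.2 hs
  have h2 : Filter.Tendsto (fun s => -(t / 2 * (Real.sqrt s)⁻¹)) (nhdsWithin 0 (Ioi 0))
      Filter.atBot :=
    Filter.tendsto_neg_atTop_atBot.comp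
      ((tendsto_inv_nhdsGT_zero.comp h1').const_mul_atTop (by positivity))
  have h3 : ∀ c : ℝ, Filter.Tendsto (fun s => c * Real.sqrt s - t / 2 * (Real.sqrt s)⁻¹)
      (nhdsWithin 0 (Ioi 0)) Filter.atBot := by
    intro c
    simp_rw [sub_eq_add_neg]
    exact (h1.const_mul c).add_atBot h2
  have h4 := h3 (-c)
  simp only [neg_mul] at h4
  have hpi : Real.sqrt Real.pi ≠ 0 := (Real.sqrt_pos.2 Real.pi_pos).ne'
  have := (((gaussPrim_tendsto_atBot.comp (h3 c)).const_mul (Real.exp (-(c * t)))).add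
    ((gaussPrim_tendsto_atBot.comp h4).const_mul (Real.exp (c * t)))).const_mul
      (Real.sqrt Real.pi)⁻¹
  have e : (Real.sqrt Real.pi)⁻¹ * (Real.exp (-(c * t)) * -(Real.sqrt Real.pi / 2) +
      Real.exp (c * t) * -(Real.sqrt Real.pi / 2)) =
      -((Real.exp (-(c * t)) + Real.exp (c * t)) / 2) := by
    field_simp
    ring
  rw [e] at this
  exact this

lemma subordPrim_tendsto_atTop {c : ℝ} (hc : 0 ≤ c) (t : ℝ) :
    Filter.Tendsto (subordPrim c t) Filter.atTop
      (nhds ((Real.exp (-(c * t)) - Real.exp (c * t)) / 2)) := by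
  have h2 : Filter.Tendsto (fun s => t / 2 * (Real.sqrt s)⁻¹) Filter.atTop (nhds 0) := by
    have := (tendsto_inv_atTop_zero.comp Real.tendsto_sqrt_atTop).const_mul (t / 2)
    simpa using this
  have hpi : Real.sqrt Real.pi ≠ 0 := (Real.sqrt_pos.2 Real.pi_pos).ne'
  rcases hc.eq_or_lt with rfl | hc
  · have h0 : gaussPrim 0 = 0 := by simp [gaussPrim]
    have h3 : Filter.Tendsto (fun s => gaussPrim (0 - t / 2 * (Real.sqrt s)⁻¹)) Filter.atTop
        (nhds 0) := by
      have h4 := (hasDerivAt_gaussPrim 0).continuousAt.tendsto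
      rw [h0] at h4
      refine h4.comp ?_
      simpa using h2.const_sub 0
    have := (h3.add h3).const_mul (Real.sqrt Real.pi)⁻¹
    have e : subordPrim 0 t = fun s => (Real.sqrt Real.pi)⁻¹ *
        (gaussPrim (0 - t / 2 * (Real.sqrt s)⁻¹) + gaussPrim (0 - t / 2 * (Real.sqrt s)⁻¹)) := by
      funext s; simp [subordPrim]
    rw [e]
    simpa using this
  · have h3 : Filter.Tendsto (fun s => c * Real.sqrt s - t / 2 * (Real.sqrt s)⁻¹)
        Filter.atTop Filter.atTop := by
      simp_rw [sub_eq_add_neg]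
      exact (Real.tendsto_sqrt_atTop.const_mul_atTop hc).atTop_add h2.neg
    have h4 : Filter.Tendsto (fun s => -(c * Real.sqrt s) - t / 2 * (Real.sqrt s)⁻¹)
        Filter.atTop Filter.atBot := by
      simp_rw [sub_eq_add_neg]
      exact (Filter.tendsto_neg_atTop_atBot.comp
        (Real.tendsto_sqrt_atTop.const_mul_atTop hc)).atBot_add h2.neg
    have := (((gaussPrim_tendsto_atTop.comp h3).const_mul (Real.exp (-(c * t)))).add
      ((gaussPrim_tendsto_atBot.comp h4).const_mul (Real.exp (c * t)))).const_mul
        (Real.sqrt Real.pi)⁻¹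
    have e : (Real.sqrt Real.pi)⁻¹ * (Real.exp (-(c * t)) * (Real.sqrt Real.pi / 2) +
        Real.exp (c * t) * -(Real.sqrt Real.pi / 2)) =
        (Real.exp (-(c * t)) - Real.exp (c * t)) / 2 := by
      field_simp
      ring
    rw [e] at this
    exact this

lemma laplace_poissonKernel_zero {c t : ℝ} (hc : 0 ≤ c) (ht : 0 < t) :
    ∫ s in Ioi (0:ℝ), poissonKernel 0 t s * Real.exp (-c ^ 2 * s) = Real.exp (-(c * t)) := by
  set m := -((Real.exp (-(c * t)) + Real.exp (c * t)) / 2) with hm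
  have h1 := integral_Ioi_of_hasDerivAt_of_nonneg (a := 0)
    (g := Function.update (subordPrim c t) 0 m)
    (g' := fun s => poissonKernel 0 t s * Real.exp (-c ^ 2 * s))
    (l := (Real.exp (-(c * t)) - Real.exp (c * t)) / 2) ?_ ?_ ?_ ?_
  · rw [h1, Function.update_self, hm]; ring
  · rw [continuousWithinAt_update_same, show Ici (0 : ℝ) \ {0} = Ioi 0 from Ici_sdiff_left]
    exact subordPrim_tendsto_zero c ht
  · intro s hs
    refine (hasDerivAt_subordPrim c t hs).congr_of_eventuallyEq ?_
    filter_upwards [Ioi_mem_nhds hs] with u hu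
    exact Function.update_of_ne (ne_of_gt hu) _ _
  · intro s hs
    have hs0 : (0 : ℝ) < s := hs
    rw [poissonKernel_zero t hs0]
    positivity
  · refine (subordPrim_tendsto_atTop hc t).congr' ?_
    filter_upwards [Filter.Ioi_mem_atTop 0] with u hu
    exact (Function.update_of_ne (ne_of_gt hu) _ _).symm

/-- The Laplace transform of `∂_t^k` of the subordination kernel, taken at `c²`, is
`∂_t^k e^{-ct}`. -/
theorem laplace_poissonKernel (k : ℕ) {c : ℝ} (hc : 0 ≤ c) : ∀ {t : ℝ}, 0 < t →
    ∫ s in Ioi (0:ℝ), poissonKernel k t s * Real.exp (-c ^ 2 * s) =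
      (-c) ^ k * Real.exp (-(c * t)) := by
  have hm : AEStronglyMeasurable (fun s : ℝ => Real.exp (-c ^ 2 * s)) (volume.restrict (Ioi 0)) :=
    (by fun_prop : Measurable fun s : ℝ => Real.exp (-c ^ 2 * s)).aestronglyMeasurable
  have hg : ∀ t : ℝ, 0 < t →
      Integrable (fun s => kap t s * Real.exp (-c ^ 2 * s)) (volume.restrict (Ioi 0)) := by
    intro t ht
    refine (integrable_kap ht).mono ((integrable_kap ht).1.mul hm) ?_
    filter_upwards [self_mem_ae_restrict measurableSet_Ioi] with s hs
    have hs0 : (0 : ℝ) < s := hs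
    rw [norm_mul, Real.norm_of_nonneg (Real.exp_pos _).le]
    refine mul_le_of_le_one_right (norm_nonneg _) (Real.exp_le_one_iff.2 ?_)
    have : 0 ≤ c ^ 2 * s := by positivity
    linarith
  induction k with
  | zero => intro t ht; rw [laplace_poissonKernel_zero hc ht]; simp
  | succ k ih =>
    intro t ht
    have h1 := hasDerivAt_integral_poissonKernel hg hm k ht
    have h2 : HasDerivAt (fun t => (-c) ^ k * Real.exp (-(c * t)))
        ((-c) ^ k * (Real.exp (-(c * t)) * (-(c * 1)))) t :=
      (((hasDerivAt_id t).const_mul c).neg.exp).const_mul _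
    have h3 : (fun t => (-c) ^ k * Real.exp (-(c * t))) =ᶠ[nhds t]
        fun t => ∫ s in Ioi (0:ℝ), poissonKernel k t s * Real.exp (-c ^ 2 * s) := by
      filter_upwards [Ioi_mem_nhds ht] with u hu using (ih hu).symm
    rw [(h1.congr_of_eventuallyEq h3).unique h2]
    ring

/-! ### Time derivatives of the Poisson–Hermite semigroup -/

/-- The `k`-th time derivative of the Poisson–Hermite semigroup, written as an average of the
Ornstein–Uhlenbeck semigroup. -/
def poissonDeriv (k : ℕ) (t : ℝ) (f : E d → ℝ) (x : E d) : ℝ :=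
  ∫ s in Ioi (0 : ℝ), poissonKernel k t s * ornsteinUhlenbeck s f x

/-- The change of variables `s = t² / (4u)` in the definition of the Poisson–Hermite semigroup. -/
lemma poissonHermite_eq {t : ℝ} (ht : 0 < t) (f : E d → ℝ) (x : E d) :
    poissonHermite t f x = poissonDeriv 0 t f x := by
  have himg : (fun u : ℝ => t ^ 2 / (4 * u)) '' Ioi 0 = Ioi 0 := by
    ext s
    constructor
    · rintro ⟨u, hu, rfl⟩
      have hu0 : (0 : ℝ) < u := hu
      exact (by positivity : (0 : ℝ) < t ^ 2 / (4 * u))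
    · intro hs
      have hs0 : (0 : ℝ) < s := hs
      exact ⟨t ^ 2 / (4 * s), (by positivity : (0 : ℝ) < t ^ 2 / (4 * s)), by
        simp only; field_simp⟩
  have hder : ∀ u ∈ Ioi (0 : ℝ), HasDerivWithinAt (fun u : ℝ => t ^ 2 / (4 * u))
      (-(t ^ 2 / (4 * u ^ 2))) (Ioi 0) u := by
    intro u hu
    have hu0 : (0 : ℝ) < u := hu
    have := ((hasDerivAt_inv hu0.ne').const_mul (t ^ 2 / 4)).hasDerivWithinAt (s := Ioi 0)
    refine (this.congr_deriv ?_).congr (fun v _ => ?_) ?_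
    · field_simp
    · rw [← div_eq_mul_inv, div_div]
    · rw [← div_eq_mul_inv, div_div]
  have hinj : InjOn (fun u : ℝ => t ^ 2 / (4 * u)) (Ioi 0) := by
    intro u hu v hv h
    have hu0 : (0 : ℝ) < u := hu
    have hv0 : (0 : ℝ) < v := hv
    simp only at h
    field_simp at h
    linarith
  have h1 := integral_image_eq_integral_abs_deriv_smul measurableSet_Ioi hder hinj
    fun s => poissonKernel 0 t s * ornsteinUhlenbeck s f x
  rw [himg] at h1
  rw [poissonDeriv, h1, poissonHermite, ← integral_const_mul]
  refine setIntegral_congr_fun measurableSet_Ioi fun u hu => ?_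
  have hu0 : (0 : ℝ) < u := hu
  have hsu : Real.sqrt u ^ 2 = u := Real.sq_sqrt hu0.le
  have hsu0 := Real.sqrt_pos.2 hu0
  have hpi : 0 < Real.sqrt Real.pi := Real.sqrt_pos.2 Real.pi_pos
  have e1 : Real.sqrt (t ^ 2 / (4 * u)) = t / (2 * Real.sqrt u) := by
    rw [Real.sqrt_eq_iff_mul_self_eq (by positivity) (by positivity)]
    field_simp
    rw [hsu]; ring
  have e2 : t ^ 2 / (4 * (t ^ 2 / (4 * u))) = u := by field_simp
  simp only [smul_eq_mul]
  rw [poissonKernel_zero t (by positivity), e1, e2, abs_neg, abs_of_pos (by positivity)]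
  field_simp
  rw [hsu]

lemma measurable_ornsteinUhlenbeck {X : Type*} [MeasurableSpace X] {a : X → ℝ} {x : X → E d}
    {f : E d → ℝ} (ha : Measurable a) (hf : Measurable f) (hx : Measurable x) :
    Measurable fun z => ornsteinUhlenbeck (a z) f (x z) := by
  have h1 : Measurable fun w : X × E d => f (mehlerPoint (a w.1) w.2 (x w.1)) :=
    hf.comp (measurable_mehlerPoint (ha.comp measurable_fst) measurable_snd
      (hx.comp measurable_fst))
  exact (h1.stronglyMeasurable.integral_prod_right' (ν := gaussian d)).measurable

lemma measurable_poissonDeriv (k : ℕ) {X : Type*} [MeasurableSpace X] {a : X → ℝ} {x : X → E d}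
    {f : E d → ℝ} (ha : Measurable a) (hf : Measurable f) (hx : Measurable x) :
    Measurable fun z => poissonDeriv k (a z) f (x z) := by
  have h1 : Measurable fun w : X × ℝ => poissonKernel k (a w.1) w.2 :=
    (measurable_poissonKernel k).comp ((ha.comp measurable_fst).prodMk measurable_snd)
  have h2 : Measurable fun w : X × ℝ => ornsteinUhlenbeck w.2 f (x w.1) :=
    measurable_ornsteinUhlenbeck measurable_snd hf (hx.comp measurable_fst)
  have h3 : Measurable fun w : X × ℝ =>
      poissonKernel k (a w.1) w.2 * ornsteinUhlenbeck w.2 f (x w.1) := h1.mul h2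
  exact (h3.stronglyMeasurable.integral_prod_right' (ν := volume.restrict (Ioi (0:ℝ)))).measurable

lemma measurable_poissonDeriv_right (k : ℕ) (t : ℝ) {f : E d → ℝ} (hf : Measurable f) :
    Measurable (poissonDeriv k t f) :=
  measurable_poissonDeriv k measurable_const hf measurable_id

lemma enorm_ornsteinUhlenbeck_le (s : ℝ) (f : E d → ℝ) (x : E d) :
    ‖ornsteinUhlenbeck s f x‖ₑ ≤ ouL s (fun y => ‖f y‖ₑ) x :=
  enorm_integral_le_lintegral_enorm _

/-- The time derivatives of the subordination kernel are bounded by multiples of the kernel of the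
smoothing operator `smoothL`. -/
lemma exists_lintegral_poissonKernel_le (k : ℕ) : ∃ C : ℝ, 0 ≤ C ∧
    ∀ {d : ℕ} {t : ℝ}, 0 < t → ∀ (F : E d → ℝ≥0∞) (x : E d),
      ∫⁻ s in Ioi (0:ℝ), ‖poissonKernel k t s‖ₑ * ouL s F x ≤
        ENNReal.ofReal (C * (t ^ k)⁻¹) * smoothL t F x := by
  obtain ⟨C, hC, hCle⟩ := exists_abs_poissonKernel_le k
  refine ⟨C, hC, fun {d t} ht F x => ?_⟩
  rw [smoothL, ← lintegral_const_mul' _ _ ENNReal.ofReal_ne_top]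
  refine setLIntegral_mono' measurableSet_Ioi fun s hs => ?_
  rw [← mul_assoc, ← ENNReal.ofReal_mul (by positivity), Real.enorm_eq_ofReal_abs]
  refine mul_le_mul_left (ENNReal.ofReal_le_ofReal ?_) _
  have := hCle t s ht hs
  rw [mul_right_comm, ← div_eq_mul_inv, le_div_iff₀ (by positivity), mul_comm]
  exact this

lemma enorm_poissonDeriv_le_lintegral (k : ℕ) (t : ℝ) (f : E d → ℝ) (x : E d) :
    ‖poissonDeriv k t f x‖ₑ ≤
      ∫⁻ s in Ioi (0:ℝ), ‖poissonKernel k t s‖ₑ * ouL s (fun y => ‖f y‖ₑ) x := by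
  refine (enorm_integral_le_lintegral_enorm _).trans (lintegral_mono fun s => ?_)
  rw [enorm_mul]
  exact mul_le_mul_right (enorm_ornsteinUhlenbeck_le s f x) _

lemma exists_enorm_poissonDeriv_le (k : ℕ) : ∃ C : ℝ, 0 ≤ C ∧
    ∀ {d : ℕ} {t : ℝ}, 0 < t → ∀ (f : E d → ℝ) (x : E d),
      ‖poissonDeriv k t f x‖ₑ ≤
        ENNReal.ofReal (C * (t ^ k)⁻¹) * smoothL t (fun y => ‖f y‖ₑ) x := by
  obtain ⟨C, hC, hCle⟩ := exists_lintegral_poissonKernel_le k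
  exact ⟨C, hC, fun ht f x => (enorm_poissonDeriv_le_lintegral k _ f x).trans (hCle ht _ x)⟩

lemma ae_smoothL_lt_top {f : E d → ℝ} (hf : Measurable f) (hfi : Integrable f (gaussian d)) :
    ∀ᵐ x ∂(gaussian d), smoothL 1 (fun y => ‖f y‖ₑ) x < ∞ := by
  refine ae_lt_top (measurable_smoothL_comp measurable_const hf.enorm measurable_id) ?_
  rw [lintegral_smoothL one_pos hf.enorm]
  exact ENNReal.mul_ne_top (by simp) hfi.2.ne

lemma measurable_ornsteinUhlenbeck_time {f : E d → ℝ} (hf : Measurable f) (x : E d) :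
    Measurable fun s => ornsteinUhlenbeck s f x :=
  measurable_ornsteinUhlenbeck measurable_id hf measurable_const

lemma integrable_kap_mul_ornsteinUhlenbeck {f : E d → ℝ} (hf : Measurable f) {x : E d}
    (hx : smoothL 1 (fun y => ‖f y‖ₑ) x < ∞) {t : ℝ} (ht : 0 < t) :
    Integrable (fun s => kap t s * ornsteinUhlenbeck s f x) (volume.restrict (Ioi 0)) := by
  have hm := measurable_ornsteinUhlenbeck_time hf x
  refine integrable_kap_mul ?_ hm.aestronglyMeasurable ht
  have hk : Measurable (kap 1) := measurable_kap.comp (measurable_const.prodMk measurable_id)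
  refine ⟨(hk.mul hm).aestronglyMeasurable, ?_⟩
  rw [hasFiniteIntegral_iff_enorm]
  refine lt_of_le_of_lt (setLIntegral_mono' measurableSet_Ioi fun s hs => ?_) hx
  rw [enorm_mul, Real.enorm_of_nonneg (kap_nonneg zero_le_one (le_of_lt hs))]
  exact mul_le_mul_right (enorm_ornsteinUhlenbeck_le s f x) _

/-- Differentiation under the integral, at every point where the average of `|f|` is finite. -/
lemma iteratedDeriv_poissonHermite (k : ℕ) {f : E d → ℝ} (hf : Measurable f) {x : E d}
    (hx : smoothL 1 (fun y => ‖f y‖ₑ) x < ∞) {t : ℝ} (ht : 0 < t) :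
    iteratedDeriv k (fun s => poissonHermite s f x) t = poissonDeriv k t f x := by
  rw [poissonDeriv, ← iteratedDeriv_integral_poissonKernel
    (fun u hu => integrable_kap_mul_ornsteinUhlenbeck hf hx hu)
    (measurable_ornsteinUhlenbeck_time hf x).aestronglyMeasurable k ht]
  refine Filter.EventuallyEq.iteratedDeriv_eq k ?_
  filter_upwards [Ioi_mem_nhds ht] with s hs using poissonHermite_eq hs f x

lemma ae_Ioi_nonneg : ∀ᵐ s ∂(volume.restrict (Ioi (0:ℝ))), (0 : ℝ) ≤ s := by
  filter_upwards [self_mem_ae_restrict measurableSet_Ioi] with s hs using le_of_lt hs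

section Operators

variable {p : ℝ≥0∞} [Fact (1 ≤ p)]

lemma poissonDeriv_ae_eq_ouAvg (k : ℕ) {t : ℝ} (ht : 0 < t) {f : E d → ℝ} (hf : Measurable f)
    (hfi : Integrable f (gaussian d)) : poissonDeriv k t f =ᵐ[gaussian d]
      ouAvg (volume.restrict (Ioi 0)) (poissonKernel k t) f := by
  filter_upwards [ae_integrable_mehler ae_Ioi_nonneg (measurable_poissonKernel_right k t)
    (integrable_poissonKernel k ht) hf hfi] with x hx
  rw [ouAvg, integral_prod _ hx, poissonDeriv]
  congr with s
  exact (integral_const_mul _ _).symm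

/-- `∂_t^k P_t` as an operator: its symbol is `∂_t^k e^{-t√n}`. -/
lemma exists_clm_poissonDeriv (hp : p ≠ ∞) (k : ℕ) {t : ℝ} (ht : 0 < t) :
    ∃ A : Lp ℝ p (gaussian d) →L[ℝ] Lp ℝ p (gaussian d),
      (∀ f : Lp ℝ p (gaussian d), (A f : E d → ℝ) =ᵐ[gaussian d] poissonDeriv k t f) ∧
      HasSymbol A fun n => (-Real.sqrt n) ^ k * Real.exp (-(Real.sqrt n * t)) := by
  obtain ⟨A, hA, -⟩ := exists_clm_ouAvg (d := d) (p := p) hp ae_Ioi_nonneg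
    (measurable_poissonKernel_right k t) (integrable_poissonKernel k ht)
  have hs := hasSymbol_of_ouAvg hp ae_Ioi_nonneg (measurable_poissonKernel_right k t)
    (integrable_poissonKernel k ht) hA
  refine ⟨A, fun f => (hA f).trans (poissonDeriv_ae_eq_ouAvg k ht (measurable_coeFn_Lp f)
    (integrable_coeFn_Lp f)).symm, ?_⟩
  have e : (fun n : ℕ => (-Real.sqrt n) ^ k * Real.exp (-(Real.sqrt n * t))) =
      fun n : ℕ => ∫ s in Ioi (0:ℝ), poissonKernel k t s * Real.exp (-(n : ℝ) * s) := by
    funext n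
    rw [← laplace_poissonKernel k (Real.sqrt_nonneg n) ht]
    simp_rw [Real.sq_sqrt (Nat.cast_nonneg n : (0 : ℝ) ≤ n)]
  rw [e]
  exact hs

lemma poissonDeriv_congr (k : ℕ) {t : ℝ} (ht : 0 < t) {f g : E d → ℝ} (hf : Measurable f)
    (hg : Measurable g) (hfi : Integrable f (gaussian d)) (h : f =ᵐ[gaussian d] g) :
    poissonDeriv k t f =ᵐ[gaussian d] poissonDeriv k t g :=
  ((poissonDeriv_ae_eq_ouAvg k ht hf hfi).trans (ouAvg_congr ae_Ioi_nonneg h)).trans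
    (poissonDeriv_ae_eq_ouAvg k ht hg (hfi.congr h)).symm

/-- The semigroup property, differentiated. -/
lemma poissonDeriv_add (hp : p ≠ ∞) (k m : ℕ) {t : ℝ} (ht : 0 < t) (f : Lp ℝ p (gaussian d)) :
    poissonDeriv (k + m) (2 * t) f =ᵐ[gaussian d] poissonDeriv m t (poissonDeriv k t f) := by
  obtain ⟨A, hA, hAs⟩ := exists_clm_poissonDeriv (d := d) hp (k + m) (by positivity : 0 < 2 * t)
  obtain ⟨B, hB, hBs⟩ := exists_clm_poissonDeriv (d := d) hp k ht
  obtain ⟨C, hC, hCs⟩ := exists_clm_poissonDeriv (d := d) hp m ht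
  have h1 : HasSymbol (C.comp B) fun n : ℕ =>
      (-Real.sqrt n) ^ (k + m) * Real.exp (-(Real.sqrt n * (2 * t))) := by
    have e : (fun n : ℕ => (-Real.sqrt n) ^ (k + m) * Real.exp (-(Real.sqrt n * (2 * t)))) =
        fun n : ℕ => (-Real.sqrt n) ^ m * Real.exp (-(Real.sqrt n * t)) *
          ((-Real.sqrt n) ^ k * Real.exp (-(Real.sqrt n * t))) := by
      funext n
      have : -(Real.sqrt n * (2 * t)) = -(Real.sqrt n * t) + -(Real.sqrt n * t) := by ring
      rw [this, Real.exp_add, pow_add]; ring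
    rw [e]
    exact hCs.comp hBs
  have h2 := hAs.unique hp h1
  have h3 : (A f : E d → ℝ) =ᵐ[gaussian d] C (B f) := by rw [h2]; rfl
  exact (hA f).symm.trans (h3.trans ((hC (B f)).trans (poissonDeriv_congr m ht
    (measurable_coeFn_Lp _) (measurable_poissonDeriv_right k t (measurable_coeFn_Lp f))
    (integrable_coeFn_Lp _) (hB f))))

/-- Higher derivatives at time `2t` are smoothings of lower derivatives at time `t`. -/
lemma exists_enorm_poissonDeriv_add_le (hp : p ≠ ∞) (k m : ℕ) : ∃ C : ℝ, 0 ≤ C ∧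
    ∀ {t : ℝ}, 0 < t → ∀ f : Lp ℝ p (gaussian d), ∀ᵐ x ∂(gaussian d),
      ‖poissonDeriv (k + m) (2 * t) f x‖ₑ ≤
        ENNReal.ofReal (C * (t ^ m)⁻¹) * smoothL t (fun y => ‖poissonDeriv k t f y‖ₑ) x := by
  obtain ⟨C, hC, hCle⟩ := exists_enorm_poissonDeriv_le m
  refine ⟨C, hC, fun {t} ht f => ?_⟩
  filter_upwards [poissonDeriv_add hp k m ht f] with x hx
  rw [hx]
  exact hCle ht _ x

end Operators

/-! ### Time derivatives of the Riesz potential -/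

/-- Integrability at zero holds since `b > 0`, and at infinity since `c > b`. -/
lemma lintegral_rpow_mul_add_rpow_lt_top {b c t : ℝ} (hb : 0 < b) (hbc : b < c) (ht : 0 < t) :
    ∫⁻ s in Ioi (0:ℝ), ENNReal.ofReal (s ^ (b - 1) * (t + s) ^ (-c)) < ∞ := by
  rw [← Ioc_union_Ioi_eq_Ioi ht.le,
    lintegral_union measurableSet_Ioi (Ioc_disjoint_Ioi le_rfl)]
  refine ENNReal.add_lt_top.2 ⟨?_, ?_⟩
  · have h1 : IntegrableOn (fun s : ℝ => s ^ (b - 1) * t ^ (-c)) (Ioc 0 t) :=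
      ((intervalIntegral.intervalIntegrable_rpow' (a := 0) (b := t)
        (by linarith : -1 < b - 1)).1).mul_const _
    refine lt_of_le_of_lt (setLIntegral_mono' measurableSet_Ioc fun s hs =>
      ENNReal.ofReal_le_ofReal ?_) h1.lintegral_lt_top
    have hs0 := hs.1
    refine mul_le_mul_of_nonneg_left ?_ (by positivity)
    exact Real.rpow_le_rpow_of_nonpos ht (by linarith) (by linarith)
  · have h1 : IntegrableOn (fun s : ℝ => s ^ (b - 1 - c)) (Ioi t) :=
      integrableOn_Ioi_rpow_of_lt (by linarith) ht
    refine lt_of_le_of_lt (setLIntegral_mono' measurableSet_Ioi fun s hs =>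
      ENNReal.ofReal_le_ofReal ?_) h1.lintegral_lt_top
    have hs0 : 0 < s := ht.trans hs
    rw [sub_eq_add_neg _ c, Real.rpow_add hs0]
    refine mul_le_mul_of_nonneg_left ?_ (by positivity)
    exact Real.rpow_le_rpow_of_nonpos hs0 (by linarith) (by linarith)

/-- The density, in the two time variables, of `∫₀^∞ s^{β-1} ∂_t^K P_{t+s} ds`. -/
def rieszDensity (K : ℕ) (β t : ℝ) (z : ℝ × ℝ) : ℝ :=
  z.1 ^ (β - 1) * poissonKernel K (t + z.1) z.2

lemma measurable_rieszDensity (K : ℕ) (β t : ℝ) : Measurable (rieszDensity K β t) := by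
  unfold rieszDensity
  have : Measurable fun z : ℝ × ℝ => poissonKernel K (t + z.1) z.2 :=
    (measurable_poissonKernel K).comp ((measurable_fst.const_add t).prodMk measurable_snd)
  fun_prop

lemma lintegral_rieszDensity (K : ℕ) (β t : ℝ) {F : E d → ℝ≥0∞} (hF : Measurable F) (x : E d) :
    ∫⁻ z, ‖rieszDensity K β t z‖ₑ * ouL z.2 F x
        ∂((volume.restrict (Ioi (0:ℝ))).prod (volume.restrict (Ioi (0:ℝ)))) =
      ∫⁻ s in Ioi (0:ℝ), ENNReal.ofReal (s ^ (β - 1)) *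
        ∫⁻ σ in Ioi (0:ℝ), ‖poissonKernel K (t + s) σ‖ₑ * ouL σ F x := by
  have hm : Measurable fun z : ℝ × ℝ => ‖rieszDensity K β t z‖ₑ * ouL z.2 F x :=
    (measurable_rieszDensity K β t).enorm.mul
      (measurable_ouL_comp measurable_snd hF measurable_const)
  rw [lintegral_prod _ hm.aemeasurable]
  refine setLIntegral_congr_fun measurableSet_Ioi fun s hs => ?_
  have hs0 : (0 : ℝ) < s := hs
  simp only [rieszDensity, enorm_mul, mul_assoc]
  rw [lintegral_const_mul' _ _ (by simp), Real.enorm_of_nonneg (by positivity)]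

lemma ae_lintegral_rieszDensity_lt_top {K : ℕ} {β t : ℝ} (hβ : 0 < β) (hK : β < K) (ht : 0 < t)
    {F : E d → ℝ≥0∞} (hF : Measurable F) (hFi : ∫⁻ x, F x ∂(gaussian d) ≠ ∞) :
    ∀ᵐ x ∂(gaussian d), ∫⁻ z, ‖rieszDensity K β t z‖ₑ * ouL z.2 F x
        ∂((volume.restrict (Ioi (0:ℝ))).prod (volume.restrict (Ioi (0:ℝ)))) < ∞ := by
  obtain ⟨C, hC, hCle⟩ := exists_lintegral_poissonKernel_le K
  have hm1 : Measurable fun w : E d × ℝ => ENNReal.ofReal (C * (w.2 ^ (β - 1) *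
      (t + w.2) ^ (-(K : ℝ)))) := by fun_prop
  have hm : Measurable fun w : E d × ℝ => ENNReal.ofReal (C * (w.2 ^ (β - 1) *
      (t + w.2) ^ (-(K : ℝ)))) * smoothL (t + w.2) F w.1 :=
    hm1.mul (measurable_smoothL_comp (measurable_snd.const_add t) hF measurable_fst)
  have hbound : ∀ x : E d, ∫⁻ z, ‖rieszDensity K β t z‖ₑ * ouL z.2 F x
      ∂((volume.restrict (Ioi (0:ℝ))).prod (volume.restrict (Ioi (0:ℝ)))) ≤
      ∫⁻ s in Ioi (0:ℝ), ENNReal.ofReal (C * (s ^ (β - 1) * (t + s) ^ (-(K : ℝ)))) *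
        smoothL (t + s) F x := by
    intro x
    rw [lintegral_rieszDensity K β t hF x]
    refine setLIntegral_mono' measurableSet_Ioi fun s hs => ?_
    have hs0 : (0 : ℝ) < s := hs
    have hts : 0 < t + s := by positivity
    refine (mul_le_mul_right (hCle hts F x) _).trans (le_of_eq ?_)
    rw [← mul_assoc, ← ENNReal.ofReal_mul (by positivity), Real.rpow_neg hts.le, Real.rpow_natCast]
    ring_nf
  have hfin : ∫⁻ x, (∫⁻ s in Ioi (0:ℝ), ENNReal.ofReal (C * (s ^ (β - 1) *
      (t + s) ^ (-(K : ℝ)))) * smoothL (t + s) F x) ∂(gaussian d) ≠ ∞ := by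
    rw [lintegral_lintegral_swap hm.aemeasurable]
    have h1 : ∀ s ∈ Ioi (0:ℝ), ∫⁻ x, ENNReal.ofReal (C * (s ^ (β - 1) *
        (t + s) ^ (-(K : ℝ)))) * smoothL (t + s) F x ∂(gaussian d) =
        ENNReal.ofReal (s ^ (β - 1) * (t + s) ^ (-(K : ℝ))) *
          (ENNReal.ofReal C * (2 * ∫⁻ x, F x ∂(gaussian d))) := by
      intro s hs
      have hs0 : (0 : ℝ) < s := hs
      rw [lintegral_const_mul' _ _ ENNReal.ofReal_ne_top,
        lintegral_smoothL (by positivity : 0 < t + s) hF, ENNReal.ofReal_mul hC]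
      ring
    rw [setLIntegral_congr_fun measurableSet_Ioi h1, lintegral_mul_const _ (by fun_prop)]
    exact ENNReal.mul_ne_top (lintegral_rpow_mul_add_rpow_lt_top hβ hK ht).ne
      (ENNReal.mul_ne_top ENNReal.ofReal_ne_top (ENNReal.mul_ne_top (by simp) hFi))
  filter_upwards [ae_lt_top (Measurable.lintegral_prod_right' hm) hfin] with x hx
  exact (hbound x).trans_lt hx

lemma integrable_rieszDensity {K : ℕ} {β t : ℝ} (hβ : 0 < β) (hK : β < K) (ht : 0 < t) :
    Integrable (rieszDensity K β t)
      ((volume.restrict (Ioi (0:ℝ))).prod (volume.restrict (Ioi (0:ℝ)))) := by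
  refine ⟨(measurable_rieszDensity K β t).aestronglyMeasurable, ?_⟩
  rw [hasFiniteIntegral_iff_enorm]
  have h1 := ae_lintegral_rieszDensity_lt_top (d := 0) hβ hK ht (F := fun _ => 1) measurable_const
    (by simp)
  obtain ⟨x, hx⟩ := h1.exists
  simpa using hx

section Commutation

variable {p : ℝ≥0∞} [Fact (1 ≤ p)]

/-- The subordination formula `Γ(β) ∂_t^K P_t I_β f = ∫₀^∞ s^{β-1} ∂_t^K P_{t+s} f ds`, read off
from `Γ(β) λ^{-β/2} = ∫₀^∞ s^{β-1} e^{-s√λ} ds` by comparing symbols. -/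
theorem poissonDeriv_riesz (hp : p ≠ ∞) {K : ℕ} {β t : ℝ} (hβ : 0 < β) (hK : β < K) (ht : 0 < t)
    {T : Lp ℝ p (gaussian d) →L[ℝ] Lp ℝ p (gaussian d)} (hT : HasSymbol T (rieszSymbol β))
    (f : Lp ℝ p (gaussian d)) : ∀ᵐ x ∂(gaussian d), poissonDeriv K t (T f) x =
      (Real.Gamma β)⁻¹ * ∫ s in Ioi (0:ℝ), s ^ (β - 1) * poissonDeriv K (t + s) f x := by
  have hD := integrable_rieszDensity hβ hK ht
  set ν := volume.restrict (Ioi (0:ℝ)) with hν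
  -- Integrating out `s` leaves an average of the semigroup with the weight `w`.
  set w : ℝ → ℝ := fun σ => ∫ s, rieszDensity K β t (s, σ) ∂ν with hw
  have hwm : Measurable w :=
    ((measurable_rieszDensity K β t).stronglyMeasurable.integral_prod_left' (μ := ν)).measurable
  have hwi : Integrable w ν := hD.integral_prod_right
  obtain ⟨B, hB, -⟩ := exists_clm_ouAvg (d := d) (p := p) hp ae_Ioi_nonneg hwm hwi
  have hBs := hasSymbol_of_ouAvg hp ae_Ioi_nonneg hwm hwi hB
  obtain ⟨A, hA, hAs⟩ := exists_clm_poissonDeriv (d := d) hp K ht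
  have hΓ : Real.Gamma β ≠ 0 := (Real.Gamma_pos_of_pos hβ).ne'
  have hK0 : K ≠ 0 := by
    rintro rfl
    simp only [Nat.cast_zero] at hK
    linarith
  have hsymb : ∀ n : ℕ, ∫ σ, w σ * Real.exp (-(n : ℝ) * σ) ∂ν = Real.Gamma β *
      ((-Real.sqrt n) ^ K * Real.exp (-(Real.sqrt n * t)) * rieszSymbol β n) := by
    intro n
    have h1 : Integrable (fun z : ℝ × ℝ => rieszDensity K β t z * Real.exp (-(n : ℝ) * z.2))
        (ν.prod ν) := by
      refine hD.mul_bdd (c := 1) (by fun_prop) ?_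
      have h2 : ∀ᵐ z ∂(ν.prod ν), (0 : ℝ) ≤ z.2 :=
        Measure.quasiMeasurePreserving_snd.ae ae_Ioi_nonneg
      filter_upwards [h2] with z hz
      rw [Real.norm_of_nonneg (Real.exp_pos _).le]
      refine Real.exp_le_one_iff.2 ?_
      have : 0 ≤ (n : ℝ) * z.2 := by positivity
      linarith
    have h3 : ∀ σ, w σ * Real.exp (-(n : ℝ) * σ) =
        ∫ s, rieszDensity K β t (s, σ) * Real.exp (-(n : ℝ) * σ) ∂ν := fun σ =>
      (integral_mul_const _ _).symm
    simp_rw [h3]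
    rw [← integral_integral_swap
      (f := fun s σ => rieszDensity K β t (s, σ) * Real.exp (-(n : ℝ) * σ)) h1]
    have h4 : ∀ s ∈ Ioi (0:ℝ), ∫ σ, rieszDensity K β t (s, σ) * Real.exp (-(n : ℝ) * σ) ∂ν =
        ((-Real.sqrt n) ^ K * Real.exp (-(Real.sqrt n * t))) *
          (s ^ (β - 1) * Real.exp (-(Real.sqrt n * s))) := by
      intro s hs
      have hs0 : (0 : ℝ) < s := hs
      simp only [rieszDensity, mul_assoc]
      rw [integral_const_mul]
      have h5 := laplace_poissonKernel K (Real.sqrt_nonneg n) (by positivity : 0 < t + s)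
      rw [Real.sq_sqrt (Nat.cast_nonneg n)] at h5
      rw [h5]
      have : -(Real.sqrt n * (t + s)) = -(Real.sqrt n * t) + -(Real.sqrt n * s) := by ring
      rw [this, Real.exp_add]; ring
    rw [hν, setIntegral_congr_fun measurableSet_Ioi h4, integral_const_mul]
    -- At `n = 0` both sides vanish, as at least one derivative is taken.
    rcases Nat.eq_zero_or_pos n with rfl | hn
    · simp [hK0]
    · have hn0 : (0 : ℝ) < n := by exact_mod_cast hn
      rw [Real.integral_rpow_mul_exp_neg_mul_Ioi hβ (Real.sqrt_pos.2 hn0), rieszSymbol,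
        if_neg hn.ne', one_div, Real.inv_rpow (Real.sqrt_nonneg _), Real.sqrt_eq_rpow,
        ← Real.rpow_mul hn0.le, ← Real.rpow_neg hn0.le]
      have : -(1 / 2 * β) = -(β / 2) := by ring
      rw [this]; ring
  have hAB : A.comp T = (Real.Gamma β)⁻¹ • B := by
    refine (hAs.comp hT).unique hp ?_
    have h1 := hBs.smul (Real.Gamma β)⁻¹
    have e : (fun n : ℕ => (-Real.sqrt n) ^ K * Real.exp (-(Real.sqrt n * t)) * rieszSymbol β n) =
        fun n : ℕ => (Real.Gamma β)⁻¹ * ∫ σ, w σ * Real.exp (-(n : ℝ) * σ) ∂ν := by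
      funext n
      rw [hsymb, inv_mul_cancel_left₀ hΓ]
    rw [e]
    exact h1
  have hf := measurable_coeFn_Lp f
  have hfi := integrable_coeFn_Lp f
  have h1 : A (T f) = (Real.Gamma β)⁻¹ • B f := by
    have := congrArg (fun S : Lp ℝ p (gaussian d) →L[ℝ] Lp ℝ p (gaussian d) => S f) hAB
    simpa using this
  have h2 : (A (T f) : E d → ℝ) =ᵐ[gaussian d] (Real.Gamma β)⁻¹ • (B f : E d → ℝ) := by
    rw [h1]; exact Lp.coeFn_smul _ _
  -- The operator identity `hAB` is read pointwise, and the integral over `s` is restored by Fubini.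
  filter_upwards [hA (T f), h2, hB f, ae_integrable_mehler ae_Ioi_nonneg hwm hwi hf hfi,
    ae_lintegral_rieszDensity_lt_top hβ hK ht hf.enorm hfi.2.ne] with x h3 h4 h5 h6 h7
  rw [← h3, h4, Pi.smul_apply, h5, smul_eq_mul, ouAvg, integral_prod _ h6]
  congr 1
  have h8 : ∀ σ, ∫ u, w (σ, u).1 * f (mehlerPoint (σ, u).1 (σ, u).2 x) ∂(gaussian d) =
      ∫ s, rieszDensity K β t (s, σ) * ornsteinUhlenbeck σ f x ∂ν := by
    intro σ
    exact (integral_const_mul (w σ) _).trans (integral_mul_const _ _).symm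
  simp_rw [h8]
  have h9 : Integrable (fun z : ℝ × ℝ => rieszDensity K β t z * ornsteinUhlenbeck z.2 f x)
      (ν.prod ν) := by
    refine ⟨((measurable_rieszDensity K β t).mul
      (measurable_ornsteinUhlenbeck measurable_snd hf measurable_const)).aestronglyMeasurable, ?_⟩
    rw [hasFiniteIntegral_iff_enorm]
    refine lt_of_le_of_lt (lintegral_mono fun z => ?_) h7
    rw [enorm_mul]
    exact mul_le_mul_right (enorm_ornsteinUhlenbeck_le _ _ _) _
  rw [← integral_integral_swap
    (f := fun s σ => rieszDensity K β t (s, σ) * ornsteinUhlenbeck σ f x) h9]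
  congr with s
  simp only [rieszDensity, mul_assoc]
  rw [integral_const_mul]
  rfl

lemma enorm_poissonDeriv_riesz_le (hp : p ≠ ∞) {K : ℕ} {β t : ℝ} (hβ : 0 < β) (hK : β < K)
    (ht : 0 < t) {T : Lp ℝ p (gaussian d) →L[ℝ] Lp ℝ p (gaussian d)}
    (hT : HasSymbol T (rieszSymbol β)) (f : Lp ℝ p (gaussian d)) :
    ∀ᵐ x ∂(gaussian d), ‖poissonDeriv K t (T f) x‖ₑ ≤ ENNReal.ofReal (Real.Gamma β)⁻¹ *
      ∫⁻ s in Ioi (0:ℝ), ENNReal.ofReal (s ^ (β - 1)) * ‖poissonDeriv K (t + s) f x‖ₑ := by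
  filter_upwards [poissonDeriv_riesz hp hβ hK ht hT f] with x hx
  have hΓ := Real.Gamma_pos_of_pos hβ
  rw [hx, enorm_mul, Real.enorm_of_nonneg (by positivity)]
  refine mul_le_mul_right ((enorm_integral_le_lintegral_enorm _).trans (le_of_eq ?_)) _
  refine setLIntegral_congr_fun measurableSet_Ioi fun s hs => ?_
  have hs0 : (0 : ℝ) < s := hs
  simp only [enorm_mul]
  rw [Real.enorm_of_nonneg (by positivity)]

end Commutation

/-! ### Hardy's inequality for the measure `dt / t` -/

/-- The measure `dt / t` on the half-line. -/
def logMeasure : Measure ℝ :=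
  (volume.restrict (Ioi 0)).withDensity fun t => ENNReal.ofReal t⁻¹

instance : SFinite logMeasure := by unfold logMeasure; infer_instance

lemma ae_logMeasure_pos : ∀ᵐ t ∂logMeasure, (0 : ℝ) < t :=
  (withDensity_absolutelyContinuous _ _).ae_le (self_mem_ae_restrict measurableSet_Ioi)

lemma lintegral_logMeasure {f : ℝ → ℝ≥0∞} (hf : Measurable f) :
    ∫⁻ t, f t ∂logMeasure = ∫⁻ t in Ioi (0:ℝ), ENNReal.ofReal t⁻¹ * f t := by
  rw [logMeasure, lintegral_withDensity_eq_lintegral_mul _ (by fun_prop) hf]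
  rfl

lemma lintegral_Ioi_comp_mul {c : ℝ} (hc : 0 < c) (f : ℝ → ℝ≥0∞) :
    ∫⁻ t in Ioi (0:ℝ), f t = ENNReal.ofReal c * ∫⁻ t in Ioi (0:ℝ), f (c * t) := by
  have himg : (fun t : ℝ => c * t) '' Ioi 0 = Ioi 0 := by
    rw [image_mul_left_Ioi hc, mul_zero]
  have h1 := lintegral_image_eq_lintegral_abs_deriv_mul measurableSet_Ioi
    (fun t (_ : t ∈ Ioi (0:ℝ)) => ((hasDerivAt_id t).const_mul c).hasDerivWithinAt)
    (fun t _ u _ h => mul_left_cancel₀ hc.ne' h) f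
  simp only [id, himg, mul_one, abs_of_pos hc] at h1
  rw [h1, lintegral_const_mul' _ _ ENNReal.ofReal_ne_top]

lemma lintegral_logMeasure_comp_mul {c : ℝ} (hc : 0 < c) {f : ℝ → ℝ≥0∞} (hf : Measurable f) :
    ∫⁻ t, f (c * t) ∂logMeasure = ∫⁻ t, f t ∂logMeasure := by
  have hfc : Measurable fun t => f (c * t) := hf.comp (measurable_const_mul c)
  rw [lintegral_logMeasure hf, lintegral_logMeasure hfc,
    lintegral_Ioi_comp_mul hc fun t => ENNReal.ofReal t⁻¹ * f t, ← lintegral_const_mul' _ _ ENNReal.ofReal_ne_top]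
  refine setLIntegral_congr_fun measurableSet_Ioi fun t ht => ?_
  have ht0 : (0 : ℝ) < t := ht
  rw [← mul_assoc, ← ENNReal.ofReal_mul hc.le, mul_inv, mul_inv_cancel_left₀ hc.ne']

/-- Hardy's inequality: after the substitution `s = tσ` the integral is a superposition of dilates,
which preserve `dt / t`. -/
theorem lintegral_hardy_le {b γ q : ℝ} (hb : 0 < b) (hγ : 0 < γ) (hq : 1 ≤ q) :
    ∃ D : ℝ≥0∞, D ≠ ∞ ∧ ∀ v : ℝ → ℝ≥0∞, Measurable v →
      ∫⁻ t, (ENNReal.ofReal (t ^ γ) *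
        ∫⁻ s in Ioi (0:ℝ), ENNReal.ofReal (s ^ (b - 1)) * v (t + s)) ^ q ∂logMeasure ≤
      D ^ q * ∫⁻ t, (ENNReal.ofReal (t ^ (γ + b)) * v t) ^ q ∂logMeasure := by
  have hq0 : 0 < q := by linarith
  set D := ∫⁻ σ in Ioi (0:ℝ), ENNReal.ofReal (σ ^ (b - 1) * (1 + σ) ^ (-(γ + b))) with hD
  refine ⟨D, (lintegral_rpow_mul_add_rpow_lt_top hb (by linarith) one_pos).ne, fun v hv => ?_⟩
  set g : ℝ → ℝ≥0∞ := fun t => ENNReal.ofReal (t ^ (γ + b)) * v t with hg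
  have hgm : Measurable g := by
    have : Measurable fun t : ℝ => ENNReal.ofReal (t ^ (γ + b)) := by fun_prop
    exact this.mul hv
  set κ : ℝ → ℝ≥0∞ := fun σ => ENNReal.ofReal (σ ^ (b - 1) * (1 + σ) ^ (-(γ + b))) with hκ
  have hκm : Measurable κ := by simp only [hκ]; fun_prop
  have hgσ : ∀ t, Measurable fun σ : ℝ => g ((1 + σ) * t) := fun t => hgm.comp (by fun_prop)
  have h1 : ∀ t : ℝ, 0 < t → ENNReal.ofReal (t ^ γ) *
      ∫⁻ s in Ioi (0:ℝ), ENNReal.ofReal (s ^ (b - 1)) * v (t + s) =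
      ∫⁻ σ in Ioi (0:ℝ), κ σ * g ((1 + σ) * t) := by
    intro t ht
    rw [lintegral_Ioi_comp_mul ht, ← mul_assoc, ← ENNReal.ofReal_mul (by positivity),
      ← lintegral_const_mul' _ _ ENNReal.ofReal_ne_top]
    refine setLIntegral_congr_fun measurableSet_Ioi fun σ hσ => ?_
    have hσ0 : (0 : ℝ) < σ := hσ
    simp only [hκ, hg]
    have e1 : t + t * σ = (1 + σ) * t := by ring
    rw [e1, ← mul_assoc, ← mul_assoc, ← ENNReal.ofReal_mul (by positivity),
      ← ENNReal.ofReal_mul (by positivity)]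
    congr 2
    rw [Real.mul_rpow ht.le hσ0.le, Real.mul_rpow (by positivity) ht.le, Real.rpow_neg (by positivity),
      Real.rpow_sub_one ht.ne', Real.rpow_add ht]
    have : 0 < (1 + σ) ^ (γ + b) := by positivity
    field_simp
  have h2 : ∀ᵐ t ∂logMeasure, (ENNReal.ofReal (t ^ γ) *
      ∫⁻ s in Ioi (0:ℝ), ENNReal.ofReal (s ^ (b - 1)) * v (t + s)) ^ q ≤
      D ^ (q - 1) * ∫⁻ σ in Ioi (0:ℝ), κ σ * g ((1 + σ) * t) ^ q := by
    filter_upwards [ae_logMeasure_pos] with t ht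
    rw [h1 t ht]
    exact rpow_lintegral_mul_le hκm.aemeasurable (hgσ t).aemeasurable hq
  refine (lintegral_mono_ae h2).trans (le_of_eq ?_)
  have hm : Measurable fun z : ℝ × ℝ => κ z.2 * g ((1 + z.2) * z.1) ^ q :=
    (hκm.comp measurable_snd).mul ((hgm.comp (by fun_prop)).pow_const q)
  rw [lintegral_const_mul _ (Measurable.lintegral_prod_right' hm),
    lintegral_lintegral_swap hm.aemeasurable]
  have h3 : ∀ σ ∈ Ioi (0:ℝ), ∫⁻ t, κ σ * g ((1 + σ) * t) ^ q ∂logMeasure =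
      κ σ * ∫⁻ t, g t ^ q ∂logMeasure := by
    intro σ hσ
    have hσ0 : (0 : ℝ) < 1 + σ := by have : (0 : ℝ) < σ := hσ; positivity
    rw [lintegral_const_mul' _ _ ENNReal.ofReal_ne_top,
      lintegral_logMeasure_comp_mul hσ0 (hgm.pow_const q)]
  rw [setLIntegral_congr_fun measurableSet_Ioi h3, lintegral_mul_const _ hκm, ← mul_assoc]
  congr 1
  have := ENNReal.rpow_add_of_nonneg (x := D) (q - 1) 1 (by linarith) zero_le_one
  rw [ENNReal.rpow_one, sub_add_cancel] at this
  rw [this]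

/-! ### Boundedness on Triebel–Lizorkin spaces -/

/-- The `L^q(dt/t)` norm of `t^a ∂_t^k P_t f(x)`. -/
def areaFn (k : ℕ) (a q : ℝ) (f : E d → ℝ) (x : E d) : ℝ≥0∞ :=
  (∫⁻ t, (ENNReal.ofReal (t ^ a) * ‖poissonDeriv k t f x‖ₑ) ^ q ∂logMeasure) ^ (1 / q)

/-- Wherever `smoothL 1 |f|` is finite, the derivatives of `t ↦ P_t f(x)` are given by the
differentiated kernel. -/
lemma squareFunction_eq_areaFn {α q : ℝ} (hq : 0 ≤ q) {f : E d → ℝ} (hf : Measurable f) {x : E d}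
    (hx : smoothL 1 (fun y => ‖f y‖ₑ) x < ∞) :
    squareFunction α q f x = areaFn (order α) ((order α : ℝ) - α) q f x := by
  have hm : Measurable fun t => ‖poissonDeriv (order α) t f x‖ₑ :=
    (measurable_poissonDeriv _ measurable_id hf measurable_const).enorm
  have hm2 : Measurable fun t : ℝ => ENNReal.ofReal (t ^ ((order α : ℝ) - α)) := by fun_prop
  have hm3 : Measurable fun t : ℝ => (ENNReal.ofReal (t ^ ((order α : ℝ) - α)) *
      ‖poissonDeriv (order α) t f x‖ₑ) ^ q := (hm2.mul hm).pow_const q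
  rw [squareFunction, areaFn, lintegral_logMeasure hm3]
  congr 1
  refine setLIntegral_congr_fun measurableSet_Ioi fun t ht => ?_
  have ht0 : (0 : ℝ) < t := ht
  rw [iteratedDeriv_poissonHermite _ hf hx ht0, Real.enorm_eq_ofReal_abs,
    ← ENNReal.ofReal_mul (by positivity), ENNReal.ofReal_rpow_of_nonneg (by positivity) hq,
    ← ENNReal.ofReal_mul (by positivity), div_eq_inv_mul]

lemma eLpNorm_squareFunction {p : ℝ≥0∞} [Fact (1 ≤ p)] (hp0 : p ≠ 0) (hp : p ≠ ∞) {α q : ℝ}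
    (hq : 0 ≤ q) (f : Lp ℝ p (gaussian d)) :
    eLpNorm (squareFunction α q f) p (gaussian d) =
      gnorm p.toReal (areaFn (order α) ((order α : ℝ) - α) q f) := by
  rw [eLpNorm_eq_lintegral_rpow_enorm_toReal hp0 hp, gnorm]
  congr 1
  refine lintegral_congr_ae ?_
  filter_upwards [ae_smoothL_lt_top (measurable_coeFn_Lp f) (integrable_coeFn_Lp f)] with x hx
  rw [squareFunction_eq_areaFn hq (measurable_coeFn_Lp f) hx]
  rfl

lemma lt_order (α : ℝ) : α < order α := by
  rw [order]; push_cast; exact Nat.lt_floor_add_one α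

lemma order_mono {α β : ℝ} (h : α ≤ β) : order α ≤ order β :=
  Nat.succ_le_succ (Nat.floor_mono h)

lemma rpow_lintegral_le_of_ae_le {q : ℝ} (hq : 0 < q) {c : ℝ≥0∞} (hc : c ≠ ∞) {F G : ℝ → ℝ≥0∞}
    (h : ∀ᵐ t ∂logMeasure, F t ≤ c * G t) :
    (∫⁻ t, F t ^ q ∂logMeasure) ^ (1 / q) ≤ c * (∫⁻ t, G t ^ q ∂logMeasure) ^ (1 / q) := by
  have h1 : ∫⁻ t, F t ^ q ∂logMeasure ≤ c ^ q * ∫⁻ t, G t ^ q ∂logMeasure := by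
    rw [← lintegral_const_mul' _ _ (ENNReal.rpow_ne_top_of_nonneg hq.le hc)]
    refine lintegral_mono_ae ?_
    filter_upwards [h] with t ht
    rw [← ENNReal.mul_rpow_of_nonneg _ _ hq.le]
    exact ENNReal.rpow_le_rpow ht hq.le
  refine (ENNReal.rpow_le_rpow h1 (by positivity)).trans (le_of_eq ?_)
  rw [ENNReal.mul_rpow_of_nonneg _ _ (by positivity), ← ENNReal.rpow_mul,
    mul_one_div_cancel hq.ne', ENNReal.rpow_one]

section Main

variable {p : ℝ≥0∞} [Fact (1 ≤ p)]

/-- Raising the order of differentiation: the area function with `k + m` derivatives is controlled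
by the one with `k` derivatives, by the semigroup property and the vector-valued inequality for the
smoothing operators. -/
lemma exists_gnorm_areaFn_add_le (hp1 : 1 < p) (hp : p ≠ ∞) (k m : ℕ) (a : ℝ) {q : ℝ}
    (hq : 1 ≤ q) : ∃ C : ℝ≥0∞, C ≠ ∞ ∧ ∀ f : Lp ℝ p (gaussian d),
      gnorm p.toReal (areaFn (k + m) (a + m) q f) ≤ C * gnorm p.toReal (areaFn k a q f) := by
  have hP : 1 < p.toReal := by
    rw [← ENNReal.toReal_one]
    exact (ENNReal.toReal_lt_toReal (by simp) hp).2 hp1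
  have hP0 : 0 < p.toReal := by linarith
  have hq0 : 0 < q := by linarith
  obtain ⟨C, hC, hCle⟩ := exists_enorm_poissonDeriv_add_le (d := d) hp k m
  set c := ENNReal.ofReal (C * 2 ^ (a + m)) with hc
  refine ⟨c * ENNReal.ofReal (6 * (p.toReal + p.toReal / (p.toReal - 1))),
    ENNReal.mul_ne_top ENNReal.ofReal_ne_top ENNReal.ofReal_ne_top, fun f => ?_⟩
  have hf := measurable_coeFn_Lp f
  set F : ℝ → E d → ℝ≥0∞ := fun t x => ENNReal.ofReal (t ^ a) * ‖poissonDeriv k t f x‖ₑ with hF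
  have hFm : Measurable (Function.uncurry F) := by
    have h1 : Measurable fun z : ℝ × E d => ENNReal.ofReal (z.1 ^ a) := by fun_prop
    exact h1.mul (measurable_poissonDeriv k measurable_fst hf measurable_snd).enorm
  have hS : Measurable fun z : ℝ × E d => smoothL z.1 (F z.1) z.2 :=
    measurable_smoothL (F := fun z : ℝ × E d => F z.1) measurable_fst
      (hFm.comp ((measurable_fst.comp measurable_fst).prodMk measurable_snd)) measurable_snd
  set G : ℝ → E d → ℝ≥0∞ := fun t x =>
    ENNReal.ofReal (t ^ (a + m)) * ‖poissonDeriv (k + m) t f x‖ₑ with hG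
  have hGm : Measurable fun z : ℝ × E d => G (2 * z.1) z.2 := by
    have h1 : Measurable fun z : ℝ × E d => ENNReal.ofReal ((2 * z.1) ^ (a + m)) := by fun_prop
    exact h1.mul (measurable_poissonDeriv (k + m) (measurable_fst.const_mul 2) hf
      measurable_snd).enorm
  have h1 : ∀ᵐ t ∂logMeasure, ∀ᵐ x ∂(gaussian d), G (2 * t) x ≤ c * smoothL t (F t) x := by
    filter_upwards [ae_logMeasure_pos] with t ht
    filter_upwards [hCle ht f] with x hx
    simp only [hG, hF]
    rw [smoothL_const_mul t ENNReal.ofReal_ne_top, ← mul_assoc, hc,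
      ← ENNReal.ofReal_mul (by positivity)]
    refine (mul_le_mul_right hx _).trans (le_of_eq ?_)
    rw [← mul_assoc, ← ENNReal.ofReal_mul (by positivity), Real.mul_rpow (by norm_num) ht.le,
      Real.rpow_add ht, Real.rpow_natCast]
    congr 2
    field_simp
  -- The estimate holds for each `t` off a null set depending on `t`; Fubini interchanges the
  -- quantifiers.
  have h2 : ∀ᵐ x ∂(gaussian d), ∀ᵐ t ∂logMeasure, G (2 * t) x ≤ c * smoothL t (F t) x :=
    (Measure.ae_ae_comm (p := fun t x => G (2 * t) x ≤ c * smoothL t (F t) x)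
      (measurableSet_le hGm (hS.const_mul c))).1 h1
  have h3 : ∀ᵐ x ∂(gaussian d), areaFn (k + m) (a + m) q f x ≤
      c * (∫⁻ t, smoothL t (F t) x ^ q ∂logMeasure) ^ (1 / q) := by
    filter_upwards [h2] with x hx
    have hGx : Measurable fun t => G t x := by
      have h4 : Measurable fun t : ℝ => ENNReal.ofReal (t ^ (a + m)) := by fun_prop
      exact h4.mul (measurable_poissonDeriv (k + m) measurable_id hf measurable_const).enorm
    -- Scale invariance of `dt/t` replaces `t` by `2 t`.
    rw [areaFn, ← lintegral_logMeasure_comp_mul two_pos (hGx.pow_const q)]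
    exact rpow_lintegral_le_of_ae_le hq0 ENNReal.ofReal_ne_top hx
  refine (gnorm_mono hP0 h3).trans ?_
  rw [gnorm_const_mul hP0 _ ENNReal.ofReal_ne_top, mul_assoc]
  exact mul_le_mul_right (gnorm_smoothL_le hP hq ae_logMeasure_pos hFm) _

/-- The Riesz potential turns into Hardy's operator in the time variable. -/
lemma exists_areaFn_riesz_le (hp : p ≠ ∞) {K : ℕ} {β γ q : ℝ} (hβ : 0 < β) (hγ : 0 < γ)
    (hK : β < K) (hq : 1 ≤ q) {T : Lp ℝ p (gaussian d) →L[ℝ] Lp ℝ p (gaussian d)}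
    (hT : HasSymbol T (rieszSymbol β)) : ∃ C : ℝ≥0∞, C ≠ ∞ ∧ ∀ f : Lp ℝ p (gaussian d),
      ∀ᵐ x ∂(gaussian d), areaFn K γ q (T f) x ≤ C * areaFn K (γ + β) q f x := by
  have hq0 : 0 < q := by linarith
  obtain ⟨D, hD, hDle⟩ := lintegral_hardy_le hβ hγ hq
  set c := ENNReal.ofReal (Real.Gamma β)⁻¹ with hc
  refine ⟨c * D, ENNReal.mul_ne_top ENNReal.ofReal_ne_top hD, fun f => ?_⟩
  have hf := measurable_coeFn_Lp f
  have hTf := measurable_coeFn_Lp (T f)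
  have hm1 : Measurable fun z : ℝ × E d => ‖poissonDeriv K z.1 (T f) z.2‖ₑ :=
    (measurable_poissonDeriv K measurable_fst hTf measurable_snd).enorm
  have hm2 : Measurable fun w : (ℝ × E d) × ℝ =>
      ENNReal.ofReal (w.2 ^ (β - 1)) * ‖poissonDeriv K (w.1.1 + w.2) f w.1.2‖ₑ := by
    have h1 : Measurable fun w : (ℝ × E d) × ℝ => ENNReal.ofReal (w.2 ^ (β - 1)) := by fun_prop
    exact h1.mul (measurable_poissonDeriv K ((measurable_fst.comp measurable_fst).add
      measurable_snd) hf (measurable_snd.comp measurable_fst)).enorm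
  have hm3 : Measurable fun z : ℝ × E d => ∫⁻ s in Ioi (0:ℝ),
      ENNReal.ofReal (s ^ (β - 1)) * ‖poissonDeriv K (z.1 + s) f z.2‖ₑ :=
    Measurable.lintegral_prod_right' hm2
  have h1 : ∀ᵐ t ∂logMeasure, ∀ᵐ x ∂(gaussian d), ‖poissonDeriv K t (T f) x‖ₑ ≤ c *
      ∫⁻ s in Ioi (0:ℝ), ENNReal.ofReal (s ^ (β - 1)) * ‖poissonDeriv K (t + s) f x‖ₑ := by
    filter_upwards [ae_logMeasure_pos] with t ht
    exact enorm_poissonDeriv_riesz_le hp hβ hK ht hT f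
  have h2 : ∀ᵐ x ∂(gaussian d), ∀ᵐ t ∂logMeasure, ‖poissonDeriv K t (T f) x‖ₑ ≤ c *
      ∫⁻ s in Ioi (0:ℝ), ENNReal.ofReal (s ^ (β - 1)) * ‖poissonDeriv K (t + s) f x‖ₑ :=
    (Measure.ae_ae_comm (p := fun t x => ‖poissonDeriv K t (T f) x‖ₑ ≤ c *
      ∫⁻ s in Ioi (0:ℝ), ENNReal.ofReal (s ^ (β - 1)) * ‖poissonDeriv K (t + s) f x‖ₑ)
      (measurableSet_le hm1 (hm3.const_mul c))).1 h1
  filter_upwards [h2] with x hx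
  have h3 : areaFn K γ q (T f) x ≤ c * (∫⁻ t, (ENNReal.ofReal (t ^ γ) *
      ∫⁻ s in Ioi (0:ℝ), ENNReal.ofReal (s ^ (β - 1)) * ‖poissonDeriv K (t + s) f x‖ₑ) ^ q
        ∂logMeasure) ^ (1 / q) := by
    refine rpow_lintegral_le_of_ae_le hq0 ENNReal.ofReal_ne_top ?_
    filter_upwards [hx] with t ht
    rw [mul_left_comm]
    exact mul_le_mul_right ht _
  refine h3.trans ?_
  rw [mul_assoc]
  refine mul_le_mul_right ?_ _
  have hv : Measurable fun t => ‖poissonDeriv K t f x‖ₑ :=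
    (measurable_poissonDeriv K measurable_id hf measurable_const).enorm
  refine (ENNReal.rpow_le_rpow (hDle _ hv) (by positivity)).trans (le_of_eq ?_)
  rw [ENNReal.mul_rpow_of_nonneg _ _ (by positivity), ← ENNReal.rpow_mul,
    mul_one_div_cancel hq0.ne', ENNReal.rpow_one]
  rfl

/-- Hardy's inequality handles the potential with `order (α + β)` derivatives on both sides; the
smoothing operators then bring their number down to `order α`. -/
theorem exists_eLpNorm_squareFunction_riesz_le (hp1 : 1 < p) (hp : p ≠ ∞) {α β q : ℝ}
    (hα : 0 ≤ α) (hβ : 0 < β) (hq : 1 ≤ q) {T : Lp ℝ p (gaussian d) →L[ℝ] Lp ℝ p (gaussian d)}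
    (hT : HasSymbol T (rieszSymbol β)) : ∃ C : ℝ≥0∞, C ≠ ∞ ∧ ∀ f : Lp ℝ p (gaussian d),
      eLpNorm (squareFunction (α + β) q (T f)) p (gaussian d) ≤
        C * eLpNorm (squareFunction α q f) p (gaussian d) := by
  have hp0 : p ≠ 0 := (one_pos.trans hp1).ne'
  have hP0 : 0 < p.toReal := ENNReal.toReal_pos hp0 hp
  have hq0 : 0 ≤ q := by linarith
  obtain ⟨m, hm⟩ := Nat.exists_eq_add_of_le (order_mono (by linarith : α ≤ α + β))
  have hK := lt_order (α + β)
  obtain ⟨C₁, hC₁, h1⟩ := exists_areaFn_riesz_le hp (K := order (α + β)) hβ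
    (sub_pos.2 hK) (by linarith) hq hT
  obtain ⟨C₂, hC₂, h2⟩ := exists_gnorm_areaFn_add_le (d := d) hp1 hp (order α) m
    ((order α : ℝ) - α) hq
  refine ⟨C₁ * C₂, ENNReal.mul_ne_top hC₁ hC₂, fun f => ?_⟩
  rw [eLpNorm_squareFunction hp0 hp hq0, eLpNorm_squareFunction hp0 hp hq0]
  refine (gnorm_mono hP0 (h1 f)).trans ?_
  rw [gnorm_const_mul hP0 _ hC₁, mul_assoc]
  refine mul_le_mul_right (le_trans (le_of_eq ?_) (h2 f)) _
  have e : ((order (α + β) : ℕ) : ℝ) - (α + β) + β = (order α : ℝ) - α + m := by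
    rw [hm]; push_cast; ring
  rw [e, hm]

end Main

end GaussianTL

end

theorem mainTheorem1 (d : ℕ) (p : ENNReal) [Fact (1 ≤ p)] (hp1 : 1 < p) (hp : p ≠ ⊤)
    (α β q : ℝ) (hα : 0 ≤ α) (hβ : 0 < β) (hq : 1 ≤ q) :
    (∃! T : Lp ℝ p (GaussianTL.gaussian d) →L[ℝ] Lp ℝ p (GaussianTL.gaussian d),
      GaussianTL.IsRieszPotential β T) ∧
    ∀ T : Lp ℝ p (GaussianTL.gaussian d) →L[ℝ] Lp ℝ p (GaussianTL.gaussian d),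
      GaussianTL.IsRieszPotential β T →
        ∃ C : NNReal, ∀ f ∈ GaussianTL.TriebelLizorkin d p α q,
          T f ∈ GaussianTL.TriebelLizorkin d p (α + β) q ∧
          GaussianTL.triebelLizorkinNorm (α + β) q (T f) ≤
            (C : ENNReal) * GaussianTL.triebelLizorkinNorm α q f := by
  refine ⟨?_, fun T hT => ?_⟩
  · obtain ⟨A, hA⟩ := GaussianTL.exists_riesz (p := p) d hp1 hp hβ
    exact ⟨A, (GaussianTL.isRieszPotential_iff hp β).2 hA, fun B hB =>
      ((GaussianTL.isRieszPotential_iff hp β).1 hB).unique hp hA⟩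
  · obtain ⟨C, hC, hle⟩ := GaussianTL.exists_eLpNorm_squareFunction_riesz_le hp1 hp hα hβ hq
      ((GaussianTL.isRieszPotential_iff hp β).1 hT)
    refine ⟨‖T‖₊ + C.toNNReal, fun f hf => ⟨(hle f).trans_lt
      (ENNReal.mul_lt_top hC.lt_top hf), ?_⟩⟩
    have h1 : eLpNorm (T f) p (GaussianTL.gaussian d) ≤
        (‖T‖₊ : ENNReal) * eLpNorm f p (GaussianTL.gaussian d) := by
      rw [← Lp.enorm_def, ← Lp.enorm_def]
      exact T.le_opENorm f
    rw [ENNReal.coe_add, ENNReal.coe_toNNReal hC]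
    unfold GaussianTL.triebelLizorkinNorm
    rw [mul_add]
    refine add_le_add (h1.trans ?_) ((hle f).trans ?_)
    · gcongr
      exact le_self_add
    · gcongr
      exact le_add_self
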